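/- Let $k$ be a field, let $\mathfrak{g}$ be a Lie algebra over $k$ of finite dimension $n$, and let $A = \mathrm{U}(\mathfrak{g})$ be its universal enveloping algebra. Put $A^{\mathrm{e}} := A \otimes_k A^{\circ}$, where $A^{\circ}$ is the opposite algebra, and let $\mathrm{H}^q(A, A^{\mathrm{e}})$, $q \ge 0$, be the Hochschild cohomology of $A$ with coefficients in the $A$-bimodule $A^{\mathrm{e}}$ with the outer structure $x(u \otimes v)y = xu \otimes vy$ (products of $v$ and $y$ taken in $A$). The inner structure $a(u \otimes v)b = ub \otimes av$ commutes with the outer one, and makes $\mathrm{H}^q(A, A^{\mathrm{e}})$ an $A$-bimodule. Let $\mathfrak{g}^* = \operatorname{Hom}_k(\mathfrak{g}, k)$, and consider $\bigwedge^n \mathfrak{g}^*$ as an $A$-bimodule with the trivial left action and the right coadjoint action, i.e. the action of $x \in \mathfrak{g}$ by the derivation that extends $(\xi \cdot x)(y) = \xi([x, y])$ for $\xi \in \mathfrak{g}^*$, $y \in \mathfrak{g}$. Let $\mathrm{U}(\mathfrak{g}) \otimes \bigwedge^n \mathfrak{g}^*$ be the tensor product over $k$ of $A$-bimodules, formed by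 means of the coproduct of $\mathrm{U}(\mathfrak{g})$; that is, $x(u \otimes \alpha) = xu \otimes \alpha$ and $(u \otimes \alpha)x = ux \otimes \alpha + u \otimes \alpha x$ for $x \in \mathfrak{g}$. Then there are isomorphisms of $\mathrm{U}(\mathfrak{g})$-bimodules \[ \mathrm{H}^q\bigl(\mathrm{U}(\mathfrak{g}), \mathrm{U}(\mathfrak{g})^{\mathrm{e}}\bigr) \cong \begin{cases} \mathrm{U}(\mathfrak{g}) \otimes \bigwedge^n \mathfrak{g}^* & \text{if } q = n, \\ 0 & \text{if } q \ne n. \end{cases} \] -/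

import Mathlib

open scoped TensorProduct

/-! ### Hochschild cohomology -/

namespace Hochschild

open MulOpposite

section Enveloping

variable (k A : Type*) [CommRing k] [Ring A] [Algebra k A]

/-- The enveloping algebra `A ⊗ A°` of a `k`-algebra `A`. A left module over it is the same thing
as a `k`-central `A`-bimodule: `(a ⊗ b) • m = a m b`. -/
abbrev Env : Type _ := A ⊗[k] Aᵐᵒᵖ

/-- The canonical involution `a ⊗ b ↦ b ⊗ a`, an isomorphism of the enveloping algebra
with its opposite. -/
noncomputable def Env.flip : Env k A ≃ₐ[k] (Env k A)ᵐᵒᵖ :=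
  (Algebra.TensorProduct.comm k A Aᵐᵒᵖ).trans
    ((Algebra.TensorProduct.congr AlgEquiv.refl (AlgEquiv.opOp k A)).trans
      (Algebra.TensorProduct.opAlgEquiv k k A Aᵐᵒᵖ))

variable {k A} in
theorem Env.flip_tmul (a b : A) :
    Env.flip k A (a ⊗ₜ[k] op b) = op (b ⊗ₜ[k] op a) := by
  simp [Env.flip]

end Enveloping

section Contract

variable {k A : Type*} [CommRing k] [Ring A] [Algebra k A]

/-- Changing one entry of `(a₀, …, a_q)` changes exactly one entry of
`(a₀, …, aⱼ aⱼ₊₁, …, a_q)`, and in a linear way. -/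
theorem contractNth_update {q : ℕ} (j : Fin q) (m : Fin (q + 1) → A) (i : Fin (q + 1)) :
    ∃ (l : Fin q) (L : A →ₗ[k] A), ∀ x : A,
      Fin.contractNth j.castSucc (· * ·) (Function.update m i x) =
        Function.update (Fin.contractNth j.castSucc (· * ·) m) l (L x) := by
  rcases lt_trichotomy (i : ℕ) (j : ℕ) with h | h | h
  · refine ⟨⟨i, by omega⟩, LinearMap.id, fun x => ?_⟩
    ext l
    simp only [Fin.contractNth, Function.update_apply, Fin.ext_iff, Fin.val_castSucc, Fin.val_succ,
      LinearMap.id_apply]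
    split_ifs <;> first | rfl | omega
  · refine ⟨j, LinearMap.mulRight k (m j.succ), fun x => ?_⟩
    ext l
    by_cases hl : l = j
    · subst hl
      simp [Fin.contractNth, Function.update_apply, Fin.ext_iff, h]
    · have hl' : (l : ℕ) ≠ j := fun e => hl (Fin.ext e)
      simp only [Fin.contractNth, Function.update_apply, Fin.ext_iff, Fin.val_castSucc,
        Fin.val_succ]
      split_ifs <;> first | rfl | omega
  · by_cases h' : (i : ℕ) = j + 1
    · refine ⟨j, LinearMap.mulLeft k (m j.castSucc), fun x => ?_⟩
      ext l
      by_cases hl : l = j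
      · subst hl
        simp [Fin.contractNth, Function.update_apply, Fin.ext_iff, h']
      · have hl' : (l : ℕ) ≠ j := fun e => hl (Fin.ext e)
        simp only [Fin.contractNth, Function.update_apply, Fin.ext_iff, Fin.val_castSucc,
          Fin.val_succ]
        split_ifs <;> first | rfl | omega
    · refine ⟨⟨(i : ℕ) - 1, by omega⟩, LinearMap.id, fun x => ?_⟩
      ext l
      simp only [Fin.contractNth, Function.update_apply, Fin.ext_iff, Fin.val_castSucc,
        Fin.val_succ, LinearMap.id_apply]
      split_ifs <;> first | rfl | omega

end Contract

section Complex

/- `M` is a bimodule, written as a left module over `A ⊗ A°`. The ring `S` acts on `M` by bimodule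
endomorphisms; it then acts on the whole cochain complex and on its cohomology. For `S = k` one
gets the plain Hochschild cohomology spaces. -/
variable (S k A M : Type*) [CommRing k] [Ring A] [Algebra k A]
  [AddCommGroup M] [Module k M] [Module (Env k A) M] [IsScalarTower k (Env k A) M]
  [Ring S] [Module S M] [SMulCommClass k S M] [SMulCommClass (Env k A) S M]

/-- Hochschild `q`-cochains: `k`-multilinear maps `A^q → M`. -/
abbrev Cochain (q : ℕ) : Type _ := MultilinearMap k (fun _ : Fin q => A) M

variable {S k A M}

/-- The Hochschild coboundary of a `q`-cochain `f`:
`(d f)(a₀, …, a_q) = a₀ f(a₁, …, a_q) + ∑_{j < q} (-1)^(j+1) f(a₀, …, aⱼ aⱼ₊₁, …, a_q)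
  + (-1)^(q+1) f(a₀, …, a_{q-1}) a_q`. -/
def coboundaryFun {q : ℕ} (f : Cochain k A M q) (a : Fin (q + 1) → A) : M :=
  (a 0 ⊗ₜ[k] (1 : Aᵐᵒᵖ) : Env k A) • f (Fin.tail a)
    + ∑ j : Fin q, (-1 : ℤ) ^ ((j : ℕ) + 1) • f (Fin.contractNth j.castSucc (· * ·) a)
    + (-1 : ℤ) ^ (q + 1) • ((1 : A) ⊗ₜ[k] op (a (Fin.last q)) : Env k A) • f (Fin.init a)

/-- The coboundary of a cochain is multilinear. -/
def coboundary {q : ℕ} (f : Cochain k A M q) : Cochain k A M (q + 1) where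
  toFun := coboundaryFun f
  map_update_add' := by
    intro inst m i x y
    obtain rfl : inst = instDecidableEqFin (q + 1) := Subsingleton.elim _ _
    have h1 : (Function.update m i (x + y) 0 ⊗ₜ[k] (1 : Aᵐᵒᵖ) : Env k A) •
          f (Fin.tail (Function.update m i (x + y))) =
        (Function.update m i x 0 ⊗ₜ[k] (1 : Aᵐᵒᵖ) : Env k A) • f (Fin.tail (Function.update m i x))
        + (Function.update m i y 0 ⊗ₜ[k] (1 : Aᵐᵒᵖ) : Env k A) •
          f (Fin.tail (Function.update m i y)) := by
      induction i using Fin.cases with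
      | zero => simp [Fin.tail_update_zero, TensorProduct.add_tmul, add_smul]
      | succ i =>
        simp [Fin.tail_update_succ, Function.update_of_ne (Fin.succ_ne_zero i).symm]
    have h3 : ((1 : A) ⊗ₜ[k] op (Function.update m i (x + y) (Fin.last q)) : Env k A) •
          f (Fin.init (Function.update m i (x + y))) =
        ((1 : A) ⊗ₜ[k] op (Function.update m i x (Fin.last q)) : Env k A) •
          f (Fin.init (Function.update m i x))
        + ((1 : A) ⊗ₜ[k] op (Function.update m i y (Fin.last q)) : Env k A) •
          f (Fin.init (Function.update m i y)) := by
      induction i using Fin.lastCases with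
      | last => simp [Fin.init_update_last, TensorProduct.tmul_add, add_smul]
      | cast i =>
        simp [Fin.init_update_castSucc, Function.update_of_ne (Fin.castSucc_ne_last i).symm]
    have h2 : ∀ j : Fin q,
        f (Fin.contractNth j.castSucc (· * ·) (Function.update m i (x + y))) =
        f (Fin.contractNth j.castSucc (· * ·) (Function.update m i x))
        + f (Fin.contractNth j.castSucc (· * ·) (Function.update m i y)) := by
      intro j
      obtain ⟨l, L, h⟩ := contractNth_update (k := k) j m i
      rw [h, h, h, map_add, MultilinearMap.map_update_add]
    simp only [coboundaryFun, h1, h2, h3, smul_add, Finset.sum_add_distrib]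
    abel
  map_update_smul' := by
    intro inst m i c x
    obtain rfl : inst = instDecidableEqFin (q + 1) := Subsingleton.elim _ _
    have h1 : (Function.update m i (c • x) 0 ⊗ₜ[k] (1 : Aᵐᵒᵖ) : Env k A) •
          f (Fin.tail (Function.update m i (c • x))) =
        c • (Function.update m i x 0 ⊗ₜ[k] (1 : Aᵐᵒᵖ) : Env k A) •
          f (Fin.tail (Function.update m i x)) := by
      induction i using Fin.cases with
      | zero => simp [Fin.tail_update_zero, ← TensorProduct.smul_tmul', smul_assoc]
      | succ i =>
        simp only [Fin.tail_update_succ, Function.update_of_ne (Fin.succ_ne_zero i).symm,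
          MultilinearMap.map_update_smul]
        rw [smul_comm]
    have h3 : ((1 : A) ⊗ₜ[k] op (Function.update m i (c • x) (Fin.last q)) : Env k A) •
          f (Fin.init (Function.update m i (c • x))) =
        c • ((1 : A) ⊗ₜ[k] op (Function.update m i x (Fin.last q)) : Env k A) •
          f (Fin.init (Function.update m i x)) := by
      induction i using Fin.lastCases with
      | last => simp [Fin.init_update_last, smul_assoc]
      | cast i =>
        simp only [Fin.init_update_castSucc, Function.update_of_ne (Fin.castSucc_ne_last i).symm,
          MultilinearMap.map_update_smul]
        rw [smul_comm]
    have h2 : ∀ j : Fin q,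
        f (Fin.contractNth j.castSucc (· * ·) (Function.update m i (c • x))) =
        c • f (Fin.contractNth j.castSucc (· * ·) (Function.update m i x)) := by
      intro j
      obtain ⟨l, L, h⟩ := contractNth_update (k := k) j m i
      rw [h, h, map_smul, MultilinearMap.map_update_smul]
    simp only [coboundaryFun, h1, h2, h3, smul_add, Finset.smul_sum,
      smul_comm c ((-1 : ℤ) ^ _)]

variable (S k A M)

/-- The Hochschild differential `C^q(A, M) → C^{q+1}(A, M)`. -/
def d (q : ℕ) : Cochain k A M q →ₗ[S] Cochain k A M (q + 1) where
  toFun := coboundary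
  map_add' f g := by
    ext a
    simp only [coboundary, coboundaryFun, MultilinearMap.coe_mk, _root_.add_apply,
      smul_add, Finset.sum_add_distrib]
    abel
  map_smul' s f := by
    ext a
    simp only [coboundary, coboundaryFun, MultilinearMap.coe_mk, _root_.smul_apply,
      smul_add, Finset.smul_sum, RingHom.id_apply, smul_comm (_ : Env k A) s,
      smul_comm ((-1 : ℤ) ^ _) s]

/-- Hochschild `q`-cocycles. -/
def cocycles (q : ℕ) : Submodule S (Cochain k A M q) := LinearMap.ker (d S k A M q)

instance (q : ℕ) : AddCommGroup (cocycles S k A M q) :=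
  inferInstanceAs (AddCommGroup (LinearMap.ker (d S k A M q)))

instance (q : ℕ) : Module S (cocycles S k A M q) :=
  inferInstanceAs (Module S (LinearMap.ker (d S k A M q)))

/-- Hochschild `q`-coboundaries. -/
def coboundaries : (q : ℕ) → Submodule S (Cochain k A M q)
  | 0 => ⊥
  | q + 1 => LinearMap.range (d S k A M q)

/-- The Hochschild cohomology `H^q(A, M)`, with the action of `S` that is induced from the one
on the coefficients `M`. -/
def Cohomology (q : ℕ) : Type _ :=
  cocycles S k A M q ⧸ (coboundaries S k A M q).submoduleOf (cocycles S k A M q)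

instance (q : ℕ) : AddCommGroup (Cohomology S k A M q) :=
  inferInstanceAs (AddCommGroup
    (cocycles S k A M q ⧸ (coboundaries S k A M q).submoduleOf (cocycles S k A M q)))

instance (q : ℕ) : Module S (Cohomology S k A M q) :=
  inferInstanceAs (Module S
    (cocycles S k A M q ⧸ (coboundaries S k A M q).submoduleOf (cocycles S k A M q)))

/-- The class of a cocycle. -/
def Cohomology.mk (q : ℕ) : cocycles S k A M q →ₗ[S] Cohomology S k A M q :=
  ((coboundaries S k A M q).submoduleOf (cocycles S k A M q)).mkQ

theorem Cohomology.mk_surjective (q : ℕ) : Function.Surjective (Cohomology.mk S k A M q) :=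
  Submodule.mkQ_surjective _

theorem Cohomology.mk_eq_zero (q : ℕ) (f : cocycles S k A M q) :
    Cohomology.mk S k A M q f = 0 ↔ (f : Cochain k A M q) ∈ coboundaries S k A M q :=
  Submodule.Quotient.mk_eq_zero _

end Complex

section EnvCoefficients

variable (k A : Type*) [CommRing k] [Ring A] [Algebra k A]

/-- The Hochschild cohomology `H^q(A, A^e)`: the cochain complex uses the left multiplication of
`A^e = A ⊗ A°` on itself (the outer bimodule structure `x (u ⊗ v) y = x u ⊗ v y`), and the right
multiplication of `A^e` on itself acts on the cohomology. -/
def EnvCohomology (q : ℕ) : Type _ := Cohomology (Env k A)ᵐᵒᵖ k A (Env k A) q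

noncomputable instance (q : ℕ) : AddCommGroup (EnvCohomology k A q) :=
  inferInstanceAs (AddCommGroup (Cohomology (Env k A)ᵐᵒᵖ k A (Env k A) q))

noncomputable instance instModuleOpEnvCohomology (q : ℕ) :
    Module (Env k A)ᵐᵒᵖ (EnvCohomology k A q) :=
  inferInstanceAs (Module (Env k A)ᵐᵒᵖ (Cohomology (Env k A)ᵐᵒᵖ k A (Env k A) q))

/-- The `A`-bimodule structure of `H^q(A, A^e)`, as a left `A^e`-module structure:
`(a ⊗ b) • h = h (b ⊗ a)`. On coefficients this is the inner structure
`a (u ⊗ v) b = u b ⊗ a v`. -/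
noncomputable instance instModuleEnvCohomology (q : ℕ) :
    Module (Env k A) (EnvCohomology k A q) :=
  Module.compHom _ (Env.flip k A : Env k A →+* (Env k A)ᵐᵒᵖ)

/-- The class of a cocycle with values in `A^e`. -/
def EnvCohomology.mk (q : ℕ) (f : cocycles (Env k A)ᵐᵒᵖ k A (Env k A) q) : EnvCohomology k A q :=
  Cohomology.mk (Env k A)ᵐᵒᵖ k A (Env k A) q f

variable {k A} in
theorem EnvCohomology.tmul_smul_mk (q : ℕ) (a b : A)
    (f : cocycles (Env k A)ᵐᵒᵖ k A (Env k A) q) :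
    (a ⊗ₜ[k] op b : Env k A) • EnvCohomology.mk k A q f =
      EnvCohomology.mk k A q ((op (b ⊗ₜ[k] op a) : (Env k A)ᵐᵒᵖ) • f) := by
  change Env.flip k A (a ⊗ₜ[k] op b) • EnvCohomology.mk k A q f = _
  rw [Env.flip_tmul]
  rfl

end EnvCoefficients

end Hochschild

/-! ### The bimodule `U(g) ⊗ ⋀ⁿ g*` -/

namespace Coadjoint

open MulOpposite

attribute [local instance 100] LieRing.ofAssociativeRing

section Derivation

variable {k V : Type*} [CommRing k] [AddCommGroup V] [Module k V]

/-- The alternating map `(v₁, …, vₙ) ↦ ∑ᵢ v₁ ∧ ⋯ ∧ φ vᵢ ∧ ⋯ ∧ vₙ`. -/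
noncomputable def derivAlt (n : ℕ) (φ : Module.End k V) : V [⋀^Fin n]→ₗ[k] ⋀[k]^n V where
  toFun v := ∑ i, exteriorPower.ιMulti k n (Function.update v i (φ (v i)))
  map_update_add' := by
    intro inst v i x y
    obtain rfl : inst = instDecidableEqFin n := Subsingleton.elim _ _
    rw [← Finset.sum_add_distrib]
    refine Finset.sum_congr rfl fun j _ => ?_
    by_cases h : j = i
    · subst h
      simp
    · simp only [Function.update_of_ne h, Function.update_comm (Ne.symm h), AlternatingMap.map_update_add]
  map_update_smul' := by
    intro inst v i c x
    obtain rfl : inst = instDecidableEqFin n := Subsingleton.elim _ _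
    rw [Finset.smul_sum]
    refine Finset.sum_congr rfl fun j _ => ?_
    by_cases h : j = i
    · subst h
      simp
    · simp only [Function.update_of_ne h, Function.update_comm (Ne.symm h), AlternatingMap.map_update_smul]
  map_eq_zero_of_eq' := by
    intro v i j hv hij
    rw [Fintype.sum_eq_add i j hij]
    · have : Function.update v j (φ (v j)) =
          Function.update v i (φ (v i)) ∘ Equiv.swap i j := by
        ext l
        rcases eq_or_ne l i with rfl | hi
        · simp [hij, hij.symm, hv]
        · rcases eq_or_ne l j with rfl | hj
          · simp [hv]
          · simp [Equiv.swap_apply_of_ne_of_ne hi hj, hi, hj]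
      rw [this, AlternatingMap.map_swap _ _ hij, add_neg_cancel]
    · intro l hl
      exact AlternatingMap.map_eq_zero_of_eq _ _
        (by rw [Function.update_of_ne hl.1.symm, Function.update_of_ne hl.2.symm, hv]) hij

/-- The endomorphism `v₁ ∧ ⋯ ∧ vₙ ↦ ∑ᵢ v₁ ∧ ⋯ ∧ φ vᵢ ∧ ⋯ ∧ vₙ` of `⋀ⁿ V` induced by an
endomorphism `φ` of `V`. -/
noncomputable def deriv (n : ℕ) (φ : Module.End k V) : Module.End k (⋀[k]^n V) :=
  exteriorPower.alternatingMapLinearEquiv (derivAlt n φ)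

theorem deriv_ιMulti (n : ℕ) (φ : Module.End k V) (v : Fin n → V) :
    deriv n φ (exteriorPower.ιMulti k n v) =
      ∑ i, exteriorPower.ιMulti k n (Function.update v i (φ (v i))) := by
  simp [deriv, derivAlt]

theorem deriv_add (n : ℕ) (φ ψ : Module.End k V) : deriv n (φ + ψ) = deriv n φ + deriv n ψ := by
  ext v
  simp [deriv_ιMulti, -exteriorPower.ιMulti_apply_coe, Finset.sum_add_distrib]

theorem deriv_smul (n : ℕ) (c : k) (φ : Module.End k V) : deriv n (c • φ) = c • deriv n φ := by
  ext v
  simp [deriv_ιMulti, -exteriorPower.ιMulti_apply_coe, Finset.smul_sum]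

theorem deriv_lie (n : ℕ) (φ ψ : Module.End k V) :
    deriv n (φ * ψ - ψ * φ) = deriv n φ * deriv n ψ - deriv n ψ * deriv n φ := by
  have key : ∀ (φ ψ : Module.End k V) (v : Fin n → V),
      deriv n φ (deriv n ψ (exteriorPower.ιMulti k n v)) =
        ∑ i, exteriorPower.ιMulti k n (Function.update v i (φ (ψ (v i)))) +
        ∑ i, ∑ j ∈ Finset.univ.erase i, exteriorPower.ιMulti k n
          (Function.update (Function.update v i (ψ (v i))) j (φ (v j))) := by
    intro φ ψ v
    rw [deriv_ιMulti, map_sum, ← Finset.sum_add_distrib]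
    refine Finset.sum_congr rfl fun i _ => ?_
    rw [deriv_ιMulti, ← Finset.add_sum_erase _ _ (Finset.mem_univ i)]
    congr 1
    · simp
    · refine Finset.sum_congr rfl fun j hj => ?_
      rw [Function.update_of_ne (Finset.ne_of_mem_erase hj)]
  have swap : ∀ v : Fin n → V,
      ∑ i, ∑ j ∈ Finset.univ.erase i, exteriorPower.ιMulti k n
          (Function.update (Function.update v i (ψ (v i))) j (φ (v j))) =
      ∑ i, ∑ j ∈ Finset.univ.erase i, exteriorPower.ιMulti k n
          (Function.update (Function.update v i (φ (v i))) j (ψ (v j))) := by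
    intro v
    rw [Finset.sum_comm' (t' := Finset.univ) (s' := fun i => Finset.univ.erase i)
      (by simp [ne_comm])]
    refine Finset.sum_congr rfl fun i _ => Finset.sum_congr rfl fun j hj => ?_
    rw [Function.update_comm (Finset.ne_of_mem_erase hj)]
  apply exteriorPower.linearMap_ext
  ext1 v
  simp only [LinearMap.compAlternatingMap_apply, LinearMap.sub_apply, Module.End.mul_apply]
  rw [key, key, deriv_ιMulti, swap v]
  simp only [LinearMap.sub_apply, Module.End.mul_apply, AlternatingMap.map_update_sub,
    Finset.sum_sub_distrib]
  abel

end Derivation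

section Bimodule

variable (k : Type*) (g : Type*) [Field k] [LieRing g] [LieAlgebra k g]

/-- The right coadjoint action of `x` on `g*`: `(ξ · x)(y) = ξ([x, y])`. -/
def coadR (x : g) : Module.End k (Module.Dual k g) :=
  (LieAlgebra.ad k g x).dualMap

/-- The right coadjoint action of `x` on `⋀ⁿ g*`. -/
noncomputable def coadPow (n : ℕ) (x : g) : Module.End k (⋀[k]^n (Module.Dual k g)) :=
  deriv n (coadR k g x)

theorem coadPow_add (n : ℕ) (x y : g) :
    coadPow k g n (x + y) = coadPow k g n x + coadPow k g n y := by
  rw [coadPow, coadPow, coadPow, ← deriv_add]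
  congr 1
  ext ξ z
  simp [coadR]

theorem coadPow_smul (n : ℕ) (c : k) (x : g) :
    coadPow k g n (c • x) = c • coadPow k g n x := by
  rw [coadPow, coadPow, ← deriv_smul]
  congr 1
  ext ξ z
  simp [coadR]

theorem coadPow_lie (n : ℕ) (x y : g) :
    coadPow k g n ⁅x, y⁆ = coadPow k g n y * coadPow k g n x - coadPow k g n x * coadPow k g n y := by
  rw [coadPow, coadPow, coadPow, ← deriv_lie]
  congr 1
  ext ξ z
  simp [coadR]

/-- The left `U(g)`-module `U(g) ⊗ ⋀ⁿ g*`. -/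
abbrev TensorSpace (n : ℕ) : Type _ :=
  UniversalEnvelopingAlgebra k g ⊗[k] ⋀[k]^n (Module.Dual k g)

/-- The right action of `x` in `g`, as a left `U(g)`-linear map:
`u ⊗ α ↦ u x ⊗ α + u ⊗ α x`. -/
noncomputable def rightGen (n : ℕ) (x : g) :
    Module.End (UniversalEnvelopingAlgebra k g) (TensorSpace k g n) :=
  TensorProduct.AlgebraTensorModule.map
      (LinearMap.toSpanSingleton (UniversalEnvelopingAlgebra k g) (UniversalEnvelopingAlgebra k g)
        (UniversalEnvelopingAlgebra.ι k x)) LinearMap.id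
    + TensorProduct.AlgebraTensorModule.map LinearMap.id (coadPow k g n x)

theorem rightGen_tmul (n : ℕ) (x : g) (u : UniversalEnvelopingAlgebra k g)
    (α : ⋀[k]^n (Module.Dual k g)) :
    rightGen k g n x (u ⊗ₜ[k] α) =
      ((u * UniversalEnvelopingAlgebra.ι k x) ⊗ₜ[k] α + u ⊗ₜ[k] coadPow k g n x α :
        TensorSpace k g n) := rfl

theorem end_ext (n : ℕ)
    {φ ψ : Module.End (UniversalEnvelopingAlgebra k g) (TensorSpace k g n)}
    (h : ∀ (u : UniversalEnvelopingAlgebra k g) (α : ⋀[k]^n (Module.Dual k g)),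
      φ (u ⊗ₜ[k] α) = ψ (u ⊗ₜ[k] α)) : φ = ψ := by
  refine LinearMap.ext fun t => ?_
  induction t using TensorProduct.induction_on with
  | zero => exact (map_zero φ).trans (map_zero ψ).symm
  | tmul u α => exact h u α
  | add s t hs ht =>
    exact (map_add φ s t).trans ((congrArg₂ (· + ·) hs ht).trans (map_add ψ s t).symm)

theorem rightGen_add (n : ℕ) (x y : g) :
    rightGen k g n (x + y) = rightGen k g n x + rightGen k g n y := by
  refine end_ext k g n fun u α => ?_
  rw [LinearMap.add_apply, rightGen_tmul, rightGen_tmul, rightGen_tmul, coadPow_add, map_add,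
    mul_add, LinearMap.add_apply, TensorProduct.add_tmul, TensorProduct.tmul_add]
  exact add_add_add_comm _ _ _ _

theorem rightGen_smul (n : ℕ) (c : k) (x : g) :
    rightGen k g n (c • x) = c • rightGen k g n x := by
  refine end_ext k g n fun u α => ?_
  rw [LinearMap.smul_apply, rightGen_tmul, rightGen_tmul, coadPow_smul, map_smul, mul_smul_comm,
    LinearMap.smul_apply, ← TensorProduct.smul_tmul', TensorProduct.tmul_smul, smul_add]

theorem rightGen_rightGen_tmul (n : ℕ) (x y : g) (u : UniversalEnvelopingAlgebra k g)
    (α : ⋀[k]^n (Module.Dual k g)) :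
    rightGen k g n x (rightGen k g n y (u ⊗ₜ[k] α)) =
      ((u * UniversalEnvelopingAlgebra.ι k y * UniversalEnvelopingAlgebra.ι k x) ⊗ₜ[k] α +
        (u * UniversalEnvelopingAlgebra.ι k y) ⊗ₜ[k] coadPow k g n x α) +
      ((u * UniversalEnvelopingAlgebra.ι k x) ⊗ₜ[k] coadPow k g n y α +
        u ⊗ₜ[k] coadPow k g n x (coadPow k g n y α)) := by
  rw [rightGen_tmul, map_add, rightGen_tmul, rightGen_tmul]

theorem rightGen_lie (n : ℕ) (x y : g) :
    rightGen k g n ⁅x, y⁆ =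
      rightGen k g n y * rightGen k g n x - rightGen k g n x * rightGen k g n y := by
  refine end_ext k g n fun u α => ?_
  rw [LinearMap.sub_apply, Module.End.mul_apply, Module.End.mul_apply, rightGen_rightGen_tmul,
    rightGen_rightGen_tmul, rightGen_tmul, coadPow_lie, LieHom.map_lie,
    LieRing.of_associative_ring_bracket, mul_sub, TensorProduct.sub_tmul, LinearMap.sub_apply,
    TensorProduct.tmul_sub, Module.End.mul_apply, Module.End.mul_apply, ← mul_assoc, ← mul_assoc]
  abel

/-- The right action of `g` is compatible with brackets. -/
noncomputable def rightLie (n : ℕ) :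
    g →ₗ⁅k⁆ (Module.End (UniversalEnvelopingAlgebra k g) (TensorSpace k g n))ᵐᵒᵖ where
  toFun x := op (rightGen k g n x)
  map_add' x y := congrArg op (rightGen_add k g n x y)
  map_smul' c x := congrArg op (rightGen_smul k g n c x)
  map_lie' {x y} := congrArg op (rightGen_lie k g n x y)

/-- The right action of `U(g)`. -/
noncomputable def rightHom (n : ℕ) : (UniversalEnvelopingAlgebra k g)ᵐᵒᵖ →ₐ[k]
    Module.End (UniversalEnvelopingAlgebra k g) (TensorSpace k g n) :=
  AlgHom.opComm (UniversalEnvelopingAlgebra.lift k (rightLie k g n))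

/-- The tensor product `U(g) ⊗ ⋀ⁿ g*`. It carries the `U(g)`-bimodule structure in which
`U(g)` is the regular bimodule, `⋀ⁿ g*` has the trivial left action and the right coadjoint
action, and the tensor product of bimodules is formed by means of the coproduct of `U(g)`:
`x (u ⊗ α) = x u ⊗ α` and `(u ⊗ α) x = u x ⊗ α + u ⊗ α x` for `x` in `g`. -/
def Bimodule (n : ℕ) : Type _ :=
  TensorSpace k g n

noncomputable instance (n : ℕ) : AddCommGroup (Bimodule k g n) :=
  inferInstanceAs (AddCommGroup (TensorSpace k g n))

noncomputable instance (n : ℕ) : Module k (Bimodule k g n) :=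
  inferInstanceAs (Module k (TensorSpace k g n))

/-- The left action `u' (u ⊗ α) = u' u ⊗ α`. -/
noncomputable instance (n : ℕ) : Module (UniversalEnvelopingAlgebra k g) (Bimodule k g n) :=
  inferInstanceAs (Module (UniversalEnvelopingAlgebra k g)
    (TensorSpace k g n))

instance (n : ℕ) : IsScalarTower k (UniversalEnvelopingAlgebra k g) (Bimodule k g n) :=
  inferInstanceAs (IsScalarTower k (UniversalEnvelopingAlgebra k g)
    (TensorSpace k g n))

/-- The right action, determined by `(u ⊗ α) x = u x ⊗ α + u ⊗ α x` for `x` in `g`. -/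
noncomputable instance (n : ℕ) : Module (UniversalEnvelopingAlgebra k g)ᵐᵒᵖ (Bimodule k g n) :=
  Module.compHom (TensorSpace k g n)
    (rightHom k g n).toRingHom

instance (n : ℕ) : IsScalarTower k (UniversalEnvelopingAlgebra k g)ᵐᵒᵖ (Bimodule k g n) where
  smul_assoc c u t := by
    exact LinearMap.congr_fun (map_smul (rightHom k g n) c u) t

instance (n : ℕ) : SMulCommClass (UniversalEnvelopingAlgebra k g)
    (UniversalEnvelopingAlgebra k g)ᵐᵒᵖ (Bimodule k g n) where
  smul_comm a u t := ((rightHom k g n u).map_smul a t).symm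

/-- The bimodule `U(g) ⊗ ⋀ⁿ g*` as a left module over `U(g) ⊗ U(g)°`:
`(a ⊗ b) • t = a t b`. -/
noncomputable instance instModuleEnv (n : ℕ) :
    Module (Hochschild.Env k (UniversalEnvelopingAlgebra k g)) (Bimodule k g n) :=
  TensorProduct.Algebra.module

end Bimodule

end Coadjoint

/-!
# Van den Bergh duality for enveloping algebras

Let `R = U(g) ⊗ U(g)°`, and let `n` be the dimension of `g`. The Hochschild cohomology `H^q(U(g), R)`
is `Ext_R^q(U(g), R)`, and may be computed by any projective resolution of `U(g)` over `R`. The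
Hochschild complex comes from the bar resolution (`BarResolution.lift_d`, `BarResolution.exact`).
The Koszul resolution `R ⊗ ⋀ g` is the Chevalley–Eilenberg complex of the Lie algebra homomorphism
`x ↦ x ⊗ 1 - 1 ⊗ x` from `g` to `R` (`PBW.adEnv`), acting on `R` by right multiplication. It is
compared with the bar resolution by `ProjectiveComplex.exists_homotopyEquiv`.

Both the exactness of the Koszul resolution and the cohomology of its dual are consequences of one
perturbation argument. By the Poincaré–Birkhoff–Witt theorem (`PBW.pbwEquiv`, proved by showing that
the rewriting of words into sorted ones is confluent), `R` has a filtration for which left and right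
multiplication by `bᵢ ⊗ 1 - 1 ⊗ bᵢ` are, up to terms of lower degree, multiplication by the variable
`xᵢ` on `k[x₁, …, xₙ] ⊗ U(g)°`. The two differentials are then `∑ xᵢ Eᵢ` up to terms of lower degree,
with `Eᵢ` the annihilation or the creation operators on the exterior algebra. The operators `Yᵢ Iᵢ`,
where `Yᵢ` divides by `xᵢ` and `Iᵢ` is the operator adjoint to `Eᵢ`, are homotopies for the leading
term; a descent on the degree (`PolyFiltration.Fermions.exists_sub_mem`) then moves each cycle, by
boundaries, into the vacuum of the `Iᵢ`, with coefficients `1 ⊗ v` of degree zero. So the Koszul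
complex is exact above degree zero, and each cocycle of the dual complex is cohomologous to one that
is concentrated in degree `n`, with value `1 ⊗ v`.

It remains to see which of these are coboundaries. In top degree the differential is
`∑ⱼ (bⱼ ⊗ 1 - 1 ⊗ bⱼ - tr(ad bⱼ)) cⱼ` (`ChevalleyEilenberg.boundary_single_univ`). On `U(g) ⊗ ⋀ⁿ g*`,
with the two factors of `R` exchanged, the elements `x ⊗ 1 - 1 ⊗ x` act on the generator `1 ⊗ β` by
the coadjoint action of `x` on `⋀ⁿ g*`, which is the scalar `tr(ad x)`. Hence the map that sends a
value `r` in `R` to the action of `r` on the generator (`Coadjoint.actGenerator`) kills the coboundaries,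
while it is bijective on the elements `1 ⊗ v`. It therefore induces the isomorphism.
-/

/-! ### The Poincaré–Birkhoff–Witt theorem -/

namespace PBW

section
variable {k g : Type*} [Field k] [LieRing g] [LieAlgebra k g]
variable {n : ℕ} (b : Module.Basis (Fin n) k g)

/-- The number of inversions of a word: pairs of positions at which the letters decrease. -/
def inversions : List (Fin n) → ℕ
  | [] => 0
  | a :: l => l.countP (· < a) + inversions l

theorem inversions_swap (u v : List (Fin n)) {a c : Fin n} (h : c < a) :
    inversions (u ++ a :: c :: v) = inversions (u ++ c :: a :: v) + 1 := by
  induction u with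
  | nil => simp [inversions, h, h.le.not_gt]; omega
  | cons x u ih =>
    have : (u ++ a :: c :: v).countP (· < x) = (u ++ c :: a :: v).countP (· < x) :=
      (List.Perm.append_left u (List.Perm.swap _ _ _)).countP_eq _
    simp only [List.cons_append, inversions, ih, this]
    omega

theorem exists_descent {w : List (Fin n)} (h : ¬ w.SortedLE) :
    ∃ (u : List (Fin n)) (a c : Fin n) (v : List (Fin n)), w = u ++ a :: c :: v ∧ c < a := by
  induction w with
  | nil => exact absurd (by simp [List.sortedLE_iff_pairwise]) h
  | cons x w ih =>
    by_cases hw : w.SortedLE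
    · cases w with
      | nil => exact absurd (by simp [List.sortedLE_iff_pairwise]) h
      | cons y w =>
        refine ⟨[], x, y, w, rfl, ?_⟩
        by_contra hxy
        refine h ?_
        rw [List.sortedLE_iff_pairwise] at hw ⊢
        rw [List.pairwise_cons]
        refine ⟨fun z hz => ?_, hw⟩
        rcases List.mem_cons.1 hz with rfl | hz
        · exact not_lt.1 hxy
        · exact (not_lt.1 hxy).trans ((List.pairwise_cons.1 hw).1 z hz)
    · obtain ⟨u, a, c, v, rfl, hlt⟩ := ih hw
      exact ⟨x :: u, a, c, v, rfl, hlt⟩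

open Classical in
/-- The normal form of a word in the basis vectors of `g`, as a combination of multisets (sorted
words). At a descent `a > c` the word is rewritten by means of `a c = c a + [a, c]`; the descent
is an arbitrary one. -/
noncomputable def normalForm (w : List (Fin n)) : Multiset (Fin n) →₀ k :=
  if h : ∃ (u : List (Fin n)) (a c : Fin n) (v : List (Fin n)), w = u ++ a :: c :: v ∧ c < a then
    normalForm (h.choose ++ h.choose_spec.choose_spec.choose :: h.choose_spec.choose ::
        h.choose_spec.choose_spec.choose_spec.choose)
      + ∑ i, b.repr ⁅b h.choose_spec.choose, b h.choose_spec.choose_spec.choose⁆ i •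
        normalForm (h.choose ++ i :: h.choose_spec.choose_spec.choose_spec.choose)
  else Finsupp.single (w : Multiset (Fin n)) 1
termination_by (w.length, inversions w)
decreasing_by
  · have hw := h.choose_spec.choose_spec.choose_spec.choose_spec
    conv_rhs => rw [hw.1]
    rw [inversions_swap _ _ hw.2]
    have e : (h.choose ++ h.choose_spec.choose_spec.choose :: h.choose_spec.choose ::
        h.choose_spec.choose_spec.choose_spec.choose).length = (h.choose ++ h.choose_spec.choose ::
        h.choose_spec.choose_spec.choose :: h.choose_spec.choose_spec.choose_spec.choose).length := by
      simp
    rw [e]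
    exact Prod.Lex.right _ (Nat.lt_succ_self _)
  · have hw := h.choose_spec.choose_spec.choose_spec.choose_spec
    conv_rhs => rw [hw.1]
    exact Prod.Lex.left _ _ (by simp)

theorem normalForm_of_sorted {w : List (Fin n)} (h : w.SortedLE) :
    normalForm b w = Finsupp.single (w : Multiset (Fin n)) 1 := by
  rw [normalForm, dif_neg]
  rintro ⟨u, a, c, v, rfl, hlt⟩
  rw [List.sortedLE_iff_pairwise, List.pairwise_append] at h
  exact hlt.not_ge ((List.pairwise_cons.1 h.2.1).1 c (by simp))

/-- The normal form of a word in which one letter is replaced by an arbitrary element of `g`. -/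
noncomputable def normalFormInsert (u v : List (Fin n)) : g →ₗ[k] Multiset (Fin n) →₀ k :=
  b.constr k fun i => normalForm b (u ++ i :: v)

theorem normalFormInsert_apply (u v : List (Fin n)) (x : g) :
    normalFormInsert b u v x = ∑ i, b.repr x i • normalForm b (u ++ i :: v) := by
  simp [normalFormInsert, Module.Basis.constr_apply_fintype]

theorem normalFormInsert_basis (u v : List (Fin n)) (i : Fin n) :
    normalFormInsert b u v (b i) = normalForm b (u ++ i :: v) := by
  simp [normalFormInsert]

/-- Some descent of a word that is not sorted is the one at which `normalForm` rewrites it. -/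
theorem exists_normalForm_eq {w : List (Fin n)} (h : ¬ w.SortedLE) :
    ∃ (u : List (Fin n)) (a c : Fin n) (v : List (Fin n)), w = u ++ a :: c :: v ∧ c < a ∧
      normalForm b w = normalForm b (u ++ c :: a :: v) + normalFormInsert b u v ⁅b a, b c⁆ := by
  have h' := exists_descent h
  refine ⟨h'.choose, h'.choose_spec.choose, h'.choose_spec.choose_spec.choose,
    h'.choose_spec.choose_spec.choose_spec.choose,
    h'.choose_spec.choose_spec.choose_spec.choose_spec.1,
    h'.choose_spec.choose_spec.choose_spec.choose_spec.2, ?_⟩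
  rw [normalForm, dif_pos h', normalFormInsert_apply]

/-- The rewriting rule at the letters `a`, `c` of the word `u a c v`. -/
def RewriteAt (u : List (Fin n)) (a c : Fin n) (v : List (Fin n)) : Prop :=
  normalForm b (u ++ a :: c :: v) =
    normalForm b (u ++ c :: a :: v) + normalFormInsert b u v ⁅b a, b c⁆

variable {b} in
theorem RewriteAt.symm {u v : List (Fin n)} {a c : Fin n} (h : RewriteAt b u a c v) :
    RewriteAt b u c a v := by
  rw [RewriteAt] at *
  rw [h, ← lie_skew (b c) (b a), map_neg]
  abel

/-- In shorter words the rewriting rule may be applied to a letter next to an arbitrary element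
of `g`. -/
theorem normalFormInsert_swap {u v : List (Fin n)} {c : Fin n}
    (h : ∀ a, RewriteAt b u a c v) (x : g) :
    normalFormInsert b u (c :: v) x =
      normalFormInsert b (u ++ [c]) v x + normalFormInsert b u v ⁅x, b c⁆ := by
  have h' : ∀ a, normalFormInsert b u (c :: v) (b a) =
      normalFormInsert b (u ++ [c]) v (b a) + normalFormInsert b u v ⁅b a, b c⁆ := by
    intro a
    have := h a
    rw [RewriteAt] at this
    simpa [normalFormInsert_basis] using this
  conv_lhs => rw [← b.sum_repr x]
  conv_rhs => rw [← b.sum_repr x]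
  simp only [map_sum, map_smul, sum_lie, smul_lie, h', smul_add, Finset.sum_add_distrib]

theorem lex_of_inversions_lt {w w' : List (Fin n)} (hl : w.length = w'.length)
    (hi : inversions w < inversions w') :
    Prod.Lex (· < ·) (· < ·) (w.length, inversions w) (w'.length, inversions w') := by
  rw [hl]
  exact Prod.Lex.right _ hi

/-- The rewriting rule holds in all words below `m`, in the order by length and then by the number
of inversions. -/
def RewritesBelow (m : ℕ × ℕ) : Prop :=
  ∀ (u : List (Fin n)) (a c : Fin n) (v : List (Fin n)),
    Prod.Lex (· < ·) (· < ·) ((u ++ a :: c :: v).length, inversions (u ++ a :: c :: v)) m →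
    c < a → RewriteAt b u a c v

variable {b} in
theorem RewritesBelow.rewriteAt {m : ℕ × ℕ} (h : RewritesBelow b m) {u : List (Fin n)}
    {a c : Fin n} {v : List (Fin n)} (hl : (u ++ a :: c :: v).length < m.1) :
    RewriteAt b u a c v := by
  rcases lt_trichotomy a c with hac | rfl | hac
  · refine (h u c a v (Prod.Lex.left _ _ ?_) hac).symm
    simpa using hl
  · simp [RewriteAt]
  · exact h u a c v (Prod.Lex.left _ _ hl) hac

/-- The two ways to rewrite `u a c d v` with `a > c > d` agree, by the Jacobi identity. -/
theorem confluent_of_overlap {u v : List (Fin n)} {a c d : Fin n} (hac : c < a) (hcd : d < c)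
    (h : RewritesBelow b ((u ++ a :: c :: d :: v).length, inversions (u ++ a :: c :: d :: v))) :
    normalForm b (u ++ c :: a :: d :: v) + normalFormInsert b u (d :: v) ⁅b a, b c⁆ =
      normalForm b ((u ++ [a]) ++ d :: c :: v) + normalFormInsert b (u ++ [a]) v ⁅b c, b d⁆ := by
  have i1 := inversions_swap u (d :: v) hac
  have i2 := inversions_swap (u ++ [c]) v (hcd.trans hac)
  have i3 := inversions_swap (u ++ [a]) v hcd
  have i4 := inversions_swap u (c :: v) (hcd.trans hac)
  simp only [List.append_assoc, List.cons_append, List.nil_append] at i1 i2 i3 i4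
  have e1 := h (u ++ [c]) a d v (lex_of_inversions_lt (by simp)
    (by simp only [List.append_assoc, List.cons_append, List.nil_append]; omega)) (hcd.trans hac)
  have e2 := h u c d (a :: v) (lex_of_inversions_lt (by simp) (by omega)) hcd
  have e3 := h u a d (c :: v) (lex_of_inversions_lt (by simp) (by omega)) (hcd.trans hac)
  have e4 := h (u ++ [d]) a c v (lex_of_inversions_lt (by simp)
    (by simp only [List.append_assoc, List.cons_append, List.nil_append]; omega)) hac
  have short : ∀ (x y : Fin n), RewriteAt b u x y v := fun x y => h.rewriteAt (by simp)
  have s1 := normalFormInsert_swap b (fun x => short x d) ⁅b a, b c⁆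
  have s2 := normalFormInsert_swap b (fun x => short x a) ⁅b c, b d⁆
  have s3 := normalFormInsert_swap b (fun x => short x c) ⁅b a, b d⁆
  have jac : normalFormInsert b u v ⁅⁅b a, b c⁆, b d⁆ + normalFormInsert b u v ⁅⁅b c, b d⁆, b a⁆ =
      normalFormInsert b u v ⁅⁅b a, b d⁆, b c⁆ := by
    rw [← map_add]
    congr 1
    rw [← lie_skew _ (b d), ← lie_skew ⁅b c, b d⁆ (b a), ← lie_skew ⁅b a, b d⁆ (b c),
      ← lie_skew (b a) (b d), lie_neg, ← sub_eq_zero, ← neg_eq_zero, ← lie_jacobi (b a) (b c) (b d)]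
    abel
  simp only [RewriteAt, List.append_assoc, List.cons_append, List.nil_append] at e1 e2 e3 e4 s1 s2 s3 ⊢
  rw [e1, e2, e3, e4, s1, s2, s3, ← jac]
  abel

/-- The two ways to rewrite disjoint descents agree. -/
theorem confluent_of_disjoint {u t v : List (Fin n)} {a c a' c' : Fin n} (hac : c < a)
    (hac' : c' < a')
    (h : RewritesBelow b ((u ++ a :: c :: (t ++ a' :: c' :: v)).length,
      inversions (u ++ a :: c :: (t ++ a' :: c' :: v)))) :
    normalForm b (u ++ c :: a :: (t ++ a' :: c' :: v)) +
        normalFormInsert b u (t ++ a' :: c' :: v) ⁅b a, b c⁆ =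
      normalForm b ((u ++ a :: c :: t) ++ c' :: a' :: v) +
        normalFormInsert b (u ++ a :: c :: t) v ⁅b a', b c'⁆ := by
  have i1 := inversions_swap u (t ++ a' :: c' :: v) hac
  have i2 := inversions_swap (u ++ a :: c :: t) v hac'
  simp only [List.append_assoc, List.cons_append] at i1 i2
  have e1 := h (u ++ c :: a :: t) a' c' v (lex_of_inversions_lt (by simp)
    (by simp only [List.append_assoc, List.cons_append]; omega)) hac'
  have e2 := h u a c (t ++ c' :: a' :: v) (lex_of_inversions_lt (by simp) (by omega)) hac
  have s1 : ∀ i, RewriteAt b (u ++ i :: t) a' c' v := fun i => h.rewriteAt (by simp)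
  have s2 : ∀ i, RewriteAt b u a c (t ++ i :: v) := fun i => h.rewriteAt (by simp)
  simp only [RewriteAt, List.append_assoc, List.cons_append] at e1 e2 s1 s2 ⊢
  rw [e1, e2, normalFormInsert_apply b u (t ++ a' :: c' :: v),
    normalFormInsert_apply b (u ++ a :: c :: t) v]
  simp only [List.append_assoc, List.cons_append, s1, s2, smul_add, Finset.sum_add_distrib]
  simp only [normalFormInsert_apply, Finset.smul_sum, List.append_assoc, List.cons_append]
  rw [Finset.sum_comm]
  simp only [smul_comm (b.repr ⁅b a, b c⁆ _)]
  abel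

/-- All the ways to rewrite a word agree: two descents coincide, overlap or are disjoint. -/
theorem confluent {u t v v' : List (Fin n)} {a c a' c' : Fin n} (hac : c < a) (hac' : c' < a')
    (e : a :: c :: v = t ++ a' :: c' :: v')
    (h : RewritesBelow b ((u ++ a :: c :: v).length, inversions (u ++ a :: c :: v))) :
    normalForm b (u ++ c :: a :: v) + normalFormInsert b u v ⁅b a, b c⁆ =
      normalForm b ((u ++ t) ++ c' :: a' :: v') + normalFormInsert b (u ++ t) v' ⁅b a', b c'⁆ := by
  match t, e with
  | [], e =>
    simp only [List.nil_append, List.cons.injEq] at e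
    obtain ⟨rfl, rfl, rfl⟩ := e
    simp
  | [x], e =>
    simp only [List.cons_append, List.nil_append, List.cons.injEq] at e
    obtain ⟨rfl, rfl, rfl⟩ := e
    exact confluent_of_overlap b hac hac' h
  | x :: y :: t, e =>
    simp only [List.cons_append, List.cons.injEq] at e
    obtain ⟨rfl, rfl, rfl⟩ := e
    exact confluent_of_disjoint b hac hac' h

/-- The diamond lemma: `normalForm` rewrites a word at a descent of its own choice, but by confluence
the outcome is the same for every descent. -/
theorem rewritesBelow (m : ℕ × ℕ) : RewritesBelow b m := by
  have wf : WellFounded (Prod.Lex (α := ℕ) (β := ℕ) (· < ·) (· < ·)) :=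
    WellFounded.prod_lex Nat.lt_wfRel.wf Nat.lt_wfRel.wf
  induction m using wf.induction with
  | _ m ih =>
    intro u a c v hm hac
    have ih' := ih _ hm
    have hs : ¬ (u ++ a :: c :: v).SortedLE := by
      intro h
      rw [List.sortedLE_iff_pairwise, List.pairwise_append] at h
      exact hac.not_ge ((List.pairwise_cons.1 h.2.1).1 c (by simp))
    obtain ⟨u', a', c', v', e, hac', hw⟩ := exists_normalForm_eq b hs
    rw [RewriteAt, hw]
    rcases List.append_eq_append_iff.1 e with ⟨t, rfl, e'⟩ | ⟨t, rfl, e'⟩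
    · exact (confluent b hac hac' e' ih').symm
    · rw [e] at ih'
      exact confluent b hac' hac e' ih'

/-- The normal form is compatible with the commutation relations of `g` at every place of a
word. -/
theorem rewriteAt (u : List (Fin n)) (a c : Fin n) (v : List (Fin n)) : RewriteAt b u a c v :=
  (rewritesBelow b ((u ++ a :: c :: v).length + 1, 0)).rewriteAt (Nat.lt_succ_self _)

/-- Induction on words, along the rewriting of descents. -/
theorem word_induction {p : List (Fin n) → Prop}
    (sorted : ∀ w : List (Fin n), w.SortedLE → p w)
    (swap : ∀ (u : List (Fin n)) (a c : Fin n) (v : List (Fin n)), c < a →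
      p (u ++ c :: a :: v) → (∀ i, p (u ++ i :: v)) → p (u ++ a :: c :: v)) (w : List (Fin n)) :
    p w := by
  have wf : WellFounded (Prod.Lex (α := ℕ) (β := ℕ) (· < ·) (· < ·)) :=
    WellFounded.prod_lex Nat.lt_wfRel.wf Nat.lt_wfRel.wf
  induction hm : (w.length, inversions w) using wf.induction generalizing w with
  | _ m ih =>
    subst hm
    by_cases hs : w.SortedLE
    · exact sorted w hs
    · obtain ⟨u, a, c, v, rfl, hac⟩ := exists_descent hs
      refine swap u a c v hac (ih _ ?_ _ rfl) fun i => ih _ ?_ _ rfl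
      · exact lex_of_inversions_lt (by simp) (by rw [inversions_swap u v hac]; omega)
      · exact Prod.Lex.left _ _ (by simp)

end
end PBW

namespace PBW

attribute [local instance 100] LieRing.ofAssociativeRing

section
variable {k g : Type*} [Field k] [LieRing g] [LieAlgebra k g]

/-- A subspace of `U(g)` that contains `1` and is stable under left multiplication by `g` is
everything. -/
theorem submodule_eq_top (S : Submodule k (UniversalEnvelopingAlgebra k g)) (h1 : 1 ∈ S)
    (h : ∀ (x : g), ∀ a ∈ S, UniversalEnvelopingAlgebra.ι k x * a ∈ S) : S = ⊤ := by
  let T : Subalgebra k (UniversalEnvelopingAlgebra k g) :=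
    { carrier := {c | ∀ a ∈ S, c * a ∈ S}
      mul_mem' := fun {c d} hc hd a ha => by rw [mul_assoc]; exact hc _ (hd _ ha)
      add_mem' := fun {c d} hc hd a ha => by rw [add_mul]; exact S.add_mem (hc _ ha) (hd _ ha)
      algebraMap_mem' := fun r a ha => by rw [← Algebra.smul_def]; exact S.smul_mem _ ha }
  let f : g →ₗ⁅k⁆ T :=
    { toFun := fun x => ⟨UniversalEnvelopingAlgebra.ι k x, h x⟩
      map_add' := fun x y => Subtype.ext (map_add _ x y)
      map_smul' := fun c x => Subtype.ext (map_smul _ c x)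
      map_lie' := fun {x y} => Subtype.ext (LieHom.map_lie _ x y) }
  have e : T.val.comp (UniversalEnvelopingAlgebra.lift k f) = AlgHom.id k _ := by
    apply UniversalEnvelopingAlgebra.hom_ext
    ext x
    exact congrArg T.val (UniversalEnvelopingAlgebra.lift_ι_apply k f x)
  refine eq_top_iff.2 fun a _ => ?_
  have ha := (UniversalEnvelopingAlgebra.lift k f a).2 1 h1
  rw [mul_one] at ha
  rw [← show T.val.comp (UniversalEnvelopingAlgebra.lift k f) a = a by rw [e]; rfl]
  exact ha

variable {n : ℕ} (b : Module.Basis (Fin n) k g)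

/-- The action of `g` on polynomials that left multiplication of normal forms induces. -/
noncomputable def act : g →ₗ[k] Module.End k (Multiset (Fin n) →₀ k) where
  toFun x := Finsupp.linearCombination k fun s => normalFormInsert b [] (s.sort (· ≤ ·)) x
  map_add' x y := by ext; simp
  map_smul' c x := by ext; simp

/-- Left multiplication by `x` of a normal form is the normal form of the word with `x` put in front. -/
theorem act_normalForm (x : g) (w : List (Fin n)) :
    act b x (normalForm b w) = normalFormInsert b [] w x := by
  induction w using word_induction with
  | sorted w hw =>
    rw [normalForm_of_sorted b hw]
    have : (w : Multiset (Fin n)).sort (· ≤ ·) = w := by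
      rw [Multiset.coe_sort]
      exact List.mergeSort_of_pairwise (by simpa [List.sortedLE_iff_pairwise] using hw)
    simp [act, this]
  | swap u a c v hac h1 h2 =>
    have r := rewriteAt b u a c v
    have r' : ∀ i, _ := fun i => rewriteAt b (i :: u) a c v
    simp only [RewriteAt] at r r'
    rw [r, map_add, h1, normalFormInsert_apply b u v, map_sum]
    simp only [map_smul, h2, normalFormInsert_apply, List.nil_append, List.cons_append] at r' ⊢
    simp only [r', smul_add, Finset.sum_add_distrib, Finset.smul_sum]
    rw [Finset.sum_comm]
    simp only [smul_comm (b.repr x _)]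

theorem normalForm_sort (s : Multiset (Fin n)) :
    normalForm b (s.sort (· ≤ ·)) = Finsupp.single s 1 := by
  rw [normalForm_of_sorted, Multiset.sort_eq]
  exact List.sortedLE_iff_pairwise.2 (Multiset.pairwise_sort _ _)

/-- The action respects brackets, since normal forms may be rewritten at the first two letters. -/
theorem act_lie (x y : g) : act b ⁅x, y⁆ = act b x * act b y - act b y * act b x := by
  have key : ∀ (x y : g) (w : List (Fin n)), act b x (act b y (normalForm b w)) =
      ∑ j, b.repr y j • normalFormInsert b [j] w x + normalFormInsert b [] w ⁅x, y⁆ := by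
    intro x y w
    rw [act_normalForm, normalFormInsert_apply, map_sum]
    have : ⁅x, y⁆ = ∑ j, b.repr y j • ⁅x, b j⁆ := by
      conv_lhs => rw [← b.sum_repr y]
      simp only [lie_sum, lie_smul]
    rw [this, map_sum, ← Finset.sum_add_distrib]
    refine Finset.sum_congr rfl fun j _ => ?_
    rw [map_smul, List.nil_append, act_normalForm,
      normalFormInsert_swap b (fun a => rewriteAt b [] a j w), map_smul, smul_add]
    rfl
  have key' : ∀ (x y : g) (w : List (Fin n)), act b y (act b x (normalForm b w)) =
      ∑ j, b.repr y j • normalFormInsert b [j] w x := by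
    intro x y w
    rw [act_normalForm, normalFormInsert_apply b [] w, map_sum]
    simp only [map_smul, act_normalForm, normalFormInsert_apply, Finset.smul_sum, List.nil_append,
      List.cons_append]
    rw [Finset.sum_comm]
    simp only [smul_comm (b.repr x _)]
  refine Finsupp.lhom_ext' fun s => LinearMap.ext_ring ?_
  simp only [LinearMap.comp_apply, Finsupp.lsingle_apply, LinearMap.sub_apply,
    Module.End.mul_apply, ← normalForm_sort b s]
  rw [key, key', act_normalForm, add_sub_cancel_left]

/-- The product in `U(g)` of the letters of a word. -/
noncomputable def wordProd (w : List (Fin n)) : UniversalEnvelopingAlgebra k g :=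
  (w.map fun i => UniversalEnvelopingAlgebra.ι k (b i)).prod

/-- The action of `U(g)` on polynomials. -/
noncomputable def actHom :
    UniversalEnvelopingAlgebra k g →ₐ[k] Module.End k (Multiset (Fin n) →₀ k) :=
  UniversalEnvelopingAlgebra.lift k { act b with map_lie' := fun {x y} => act_lie b x y }

theorem actHom_ι (x : g) : actHom b (UniversalEnvelopingAlgebra.ι k x) = act b x :=
  UniversalEnvelopingAlgebra.lift_ι_apply k _ x

theorem ι_lie (x y : g) : UniversalEnvelopingAlgebra.ι k ⁅x, y⁆ =
    UniversalEnvelopingAlgebra.ι k x * UniversalEnvelopingAlgebra.ι k y -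
      UniversalEnvelopingAlgebra.ι k y * UniversalEnvelopingAlgebra.ι k x := by
  rw [LieHom.map_lie, LieRing.of_associative_ring_bracket]

/-- Applied to the constant polynomial, the product of a word gives back its normal form; this is
what makes sorted words linearly independent in `U(g)`. -/
theorem actHom_wordProd (w : List (Fin n)) :
    actHom b (wordProd b w) (Finsupp.single 0 1) = normalForm b w := by
  induction w with
  | nil =>
    rw [normalForm_of_sorted b (by simp [List.sortedLE_iff_pairwise])]
    simp [wordProd]
  | cons i w ih =>
    have : wordProd b (i :: w) = UniversalEnvelopingAlgebra.ι k (b i) * wordProd b w := by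
      simp [wordProd]
    rw [this, map_mul, Module.End.mul_apply, ih, actHom_ι, act_normalForm, normalFormInsert_basis,
      List.nil_append]

theorem wordProd_swap (u : List (Fin n)) (a c : Fin n) (v : List (Fin n)) :
    wordProd b (u ++ a :: c :: v) = wordProd b (u ++ c :: a :: v) +
      ∑ i, b.repr ⁅b a, b c⁆ i • wordProd b (u ++ i :: v) := by
  have : UniversalEnvelopingAlgebra.ι k (b a) * UniversalEnvelopingAlgebra.ι k (b c) =
      UniversalEnvelopingAlgebra.ι k (b c) * UniversalEnvelopingAlgebra.ι k (b a) +
      ∑ i, b.repr ⁅b a, b c⁆ i • UniversalEnvelopingAlgebra.ι k (b i) := by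
    rw [← sub_eq_iff_eq_add', ← ι_lie, ← LieHom.coe_toLinearMap]
    simp only [← map_smul, ← map_sum, b.sum_repr]
  simp only [wordProd, List.map_append, List.map_cons, List.prod_append, List.prod_cons]
  rw [← mul_assoc (UniversalEnvelopingAlgebra.ι k (b a)), this]
  simp only [add_mul, mul_add, Finset.sum_mul, Finset.mul_sum, smul_mul_assoc, mul_smul_comm,
    mul_assoc]

/-- The linear map that sends a monomial to the sorted product of its variables in `U(g)`. -/
noncomputable def sortedProd : (Multiset (Fin n) →₀ k) →ₗ[k] UniversalEnvelopingAlgebra k g :=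
  Finsupp.linearCombination k fun s => wordProd b (s.sort (· ≤ ·))

theorem sortedProd_normalForm (w : List (Fin n)) : sortedProd b (normalForm b w) = wordProd b w := by
  induction w using word_induction with
  | sorted w hw =>
    rw [normalForm_of_sorted b hw]
    have : (w : Multiset (Fin n)).sort (· ≤ ·) = w := by
      rw [Multiset.coe_sort]
      exact List.mergeSort_of_pairwise (by simpa [List.sortedLE_iff_pairwise] using hw)
    simp [sortedProd, this]
  | swap u a c v hac h1 h2 =>
    have r := rewriteAt b u a c v
    rw [RewriteAt] at r
    rw [r, map_add, h1, normalFormInsert_apply, map_sum, wordProd_swap b u a c v]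
    simp only [map_smul, h2]

/-- The Poincaré–Birkhoff–Witt theorem: `U(g)` is isomorphic, as a vector space, to the space of
polynomials, by sorted products of basis vectors. -/
noncomputable def pbwEquiv : UniversalEnvelopingAlgebra k g ≃ₗ[k] (Multiset (Fin n) →₀ k) :=
  LinearEquiv.ofLinearMap ((LinearMap.applyₗ (Finsupp.single 0 1)).comp (actHom b).toLinearMap)
    (sortedProd b)
    (by
      refine Finsupp.lhom_ext' fun s => LinearMap.ext_ring ?_
      simp [sortedProd, actHom_wordProd, normalForm_sort])
    (by
      have key : ∀ w, sortedProd b (actHom b (wordProd b w) (Finsupp.single 0 1)) =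
          wordProd b w := fun w => by rw [actHom_wordProd, sortedProd_normalForm]
      have top := submodule_eq_top (Submodule.span k (Set.range (wordProd b)))
        (Submodule.subset_span ⟨[], by simp [wordProd]⟩) (by
          intro x a ha
          have hx : UniversalEnvelopingAlgebra.ι k x =
              ∑ i, b.repr x i • UniversalEnvelopingAlgebra.ι k (b i) := by
            rw [← LieHom.coe_toLinearMap]
            simp only [← map_smul, ← map_sum, b.sum_repr]
          rw [hx, Finset.sum_mul]
          refine Submodule.sum_mem _ fun i _ => ?_
          rw [smul_mul_assoc]
          refine Submodule.smul_mem _ _ ?_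
          induction ha using Submodule.span_induction with
          | mem a ha =>
            obtain ⟨w, rfl⟩ := ha
            exact Submodule.subset_span ⟨i :: w, by simp [wordProd]⟩
          | zero => simp
          | add y z _ _ hy hz => rw [mul_add]; exact Submodule.add_mem _ hy hz
          | smul c y _ hy => rw [mul_smul_comm]; exact Submodule.smul_mem _ _ hy)
      refine LinearMap.ext_on_range top fun w => ?_
      exact key w)

theorem pbwEquiv_wordProd (w : List (Fin n)) : pbwEquiv b (wordProd b w) = normalForm b w :=
  actHom_wordProd b w

theorem pbwEquiv_symm_single (s : Multiset (Fin n)) :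
    (pbwEquiv b).symm (Finsupp.single s 1) = wordProd b (s.sort (· ≤ ·)) := by
  rw [LinearEquiv.symm_apply_eq, pbwEquiv_wordProd, normalForm_sort]

/-- The leading term of the normal form of a word is the monomial of its letters. -/
theorem normalForm_sub_single_mem (w : List (Fin n)) :
    normalForm b w - Finsupp.single (w : Multiset (Fin n)) 1 ∈
      Finsupp.supported k k {s : Multiset (Fin n) | s.card < w.length} := by
  induction w using word_induction with
  | sorted w hw => rw [normalForm_of_sorted b hw, sub_self]; exact Submodule.zero_mem _
  | swap u a c v hac h1 h2 =>
    have r := rewriteAt b u a c v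
    rw [RewriteAt] at r
    have e : ((u ++ a :: c :: v : List (Fin n)) : Multiset (Fin n)) = (u ++ c :: a :: v : List _) :=
      Multiset.coe_eq_coe.2 (List.Perm.append_left u (List.Perm.swap _ _ _))
    rw [r, e, add_sub_right_comm, normalFormInsert_apply]
    refine Submodule.add_mem _ ?_ (Submodule.sum_mem _ fun i _ => Submodule.smul_mem _ _ ?_)
    · simpa using h1
    · rw [← sub_add_cancel (normalForm b (u ++ i :: v))
        (Finsupp.single ((u ++ i :: v : List (Fin n)) : Multiset (Fin n)) 1)]
      refine Submodule.add_mem _ (Finsupp.supported_mono ?_ (h2 i))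
        (Finsupp.single_mem_supported k _ ?_)
      · intro s hs
        simp only [Set.mem_ofPred_eq, List.length_append, List.length_cons] at hs ⊢
        omega
      · simp
end
end PBW

/-! ### Perturbed Koszul differentials on filtered spaces -/

/-- A filtration of a vector space `N` that looks like the filtration of `k[xᵢ : i ∈ ι] ⊗ V` by
degree: `F p` stands for the elements of degree less than `p`, `X i` for multiplication by `xᵢ`,
and `Y i` for division by `xᵢ`, with remainder. -/
structure PolyFiltration (ι k N : Type*) [CommRing k] [AddCommGroup N] [Module k N] where
  F : ℕ → Submodule k N
  X : ι → Module.End k N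
  Y : ι → Module.End k N
  F_zero : F 0 = ⊥
  F_mono : Monotone F
  exists_mem : ∀ z, ∃ p, z ∈ F p
  Y_mul_X : ∀ i, Y i * X i = 1
  X_mul_Y : ∀ i j, i ≠ j → X i * Y j = Y j * X i
  X_le : ∀ i p, F p ≤ (F (p + 1)).comap (X i)
  Y_le : ∀ i p, F (p + 1) ≤ (F p).comap (Y i)
  /-- The terms that involve none of the variables have degree zero. -/
  prod_mem : ∀ (l : List ι) (_ : ∀ i, i ∈ l) (z : N), (l.map fun i => 1 - X i * Y i).prod z ∈ F 1

namespace PolyFiltration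

section Transfer

variable {ι k N N' : Type*} [CommRing k] [AddCommGroup N] [Module k N]
  [AddCommGroup N'] [Module k N']

/-- Transport of a filtration along a construction that turns operators `T` on `N` into operators
`Φ T` on `N'`, and subspaces `S` of `N` into subspaces `G S` of `N'`. -/
def transfer (f : PolyFiltration ι k N) (Φ : Module.End k N →+* Module.End k N')
    (G : Submodule k N → Submodule k N') (mono : Monotone G) (bot : G ⊥ = ⊥) (top : G ⊤ = ⊤)
    (compat : ∀ (T : Module.End k N) (S S' : Submodule k N),
      S ≤ S'.comap T → G S ≤ (G S').comap (Φ T))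
    (exh : ∀ z, ∃ p, z ∈ G (f.F p)) : PolyFiltration ι k N' where
  F p := G (f.F p)
  X i := Φ (f.X i)
  Y i := Φ (f.Y i)
  F_zero := by rw [f.F_zero, bot]
  F_mono := mono.comp f.F_mono
  exists_mem := exh
  Y_mul_X i := by rw [← map_mul, f.Y_mul_X, map_one]
  X_mul_Y i j h := by rw [← map_mul, f.X_mul_Y i j h, map_mul]
  X_le i p := compat _ _ _ (f.X_le i p)
  Y_le i p := compat _ _ _ (f.Y_le i p)
  prod_mem l hl z := by
    have h := compat (l.map fun i => 1 - f.X i * f.Y i).prod ⊤ (f.F 1)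
      (fun z _ => f.prod_mem l hl z) (top ▸ Submodule.mem_top : z ∈ G ⊤)
    simpa [map_list_prod, Function.comp_def] using h

/-- Transport of a filtration along a linear isomorphism. -/
noncomputable def congr (f : PolyFiltration ι k N) (e : N ≃ₗ[k] N') : PolyFiltration ι k N' :=
  f.transfer e.conjRingEquiv.toRingHom (Submodule.map e.toLinearMap)
    (fun _ _ h => Submodule.map_mono h) (Submodule.map_bot _) (by simp)
    (by
      rintro T S S' h _ ⟨z, hz, rfl⟩
      exact ⟨T z, h hz, by simp⟩)
    (fun z => by
      obtain ⟨p, hp⟩ := f.exists_mem (e.symm z)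
      exact ⟨p, e.symm z, hp, by simp⟩)

/-- The filtration of `N ⊗ V` by the degree in `N`. -/
noncomputable def rTensor (f : PolyFiltration ι k N) (V : Type*) [AddCommGroup V] [Module k V] :
    PolyFiltration ι k (N ⊗[k] V) :=
  f.transfer (Module.End.rTensorAlgHom k N V).toRingHom
    (fun S => Submodule.map₂ (TensorProduct.mk k N V) S ⊤)
    (fun _ _ h => Submodule.map₂_le_map₂_left h) (by simp)
    (TensorProduct.map₂_mk_top_top_eq_top k N V)
    (by
      intro T S S' h
      refine Submodule.map₂_le.2 fun u hu v hv => ?_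
      exact Submodule.apply_mem_map₂ _ (h hu) hv)
    (fun z => by
      induction z using TensorProduct.induction_on with
      | zero => exact ⟨0, Submodule.zero_mem _⟩
      | tmul u v =>
        obtain ⟨p, hp⟩ := f.exists_mem u
        exact ⟨p, Submodule.apply_mem_map₂ _ hp Submodule.mem_top⟩
      | add y z hy hz =>
        obtain ⟨p, hp⟩ := hy
        obtain ⟨q, hq⟩ := hz
        exact ⟨max p q, Submodule.add_mem _
          (Submodule.map₂_le_map₂_left (f.F_mono (le_max_left p q)) hp)
          (Submodule.map₂_le_map₂_left (f.F_mono (le_max_right p q)) hq)⟩)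

/-- The action of operators on functions by composition. -/
@[simps]
def pointwise (J : Type*) : Module.End k N →+* Module.End k (J → N) where
  toFun T := T.compLeft J
  map_one' := rfl
  map_mul' _ _ := rfl
  map_zero' := rfl
  map_add' _ _ := rfl

/-- The pointwise filtration of functions on a finite set. -/
def pi (f : PolyFiltration ι k N) (J : Type*) [Fintype J] : PolyFiltration ι k (J → N) :=
  f.transfer (pointwise J) (fun S => Submodule.pi Set.univ fun _ => S)
    (fun _ _ h z hz j hj => h (hz j hj))
    (by
      refine eq_bot_iff.2 fun z hz => ?_
      ext j
      exact (Submodule.mem_bot k).1 (hz j trivial))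
    (eq_top_iff.2 fun z _ j _ => trivial)
    (fun T S S' h z hz j hj => h (hz j hj))
    (fun z => by
      choose p hp using fun j => f.exists_mem (z j)
      exact ⟨Finset.univ.sup p, fun j _ => f.F_mono (Finset.le_sup (Finset.mem_univ j)) (hp j)⟩)

end Transfer

section Polynomial

variable (ι k : Type*) [CommRing k] [DecidableEq ι]

/-- The product of the projections `1 - Xᵢ Yᵢ` keeps the monomials without any of these variables. -/
theorem polynomial_prod (l : List ι) (s : Multiset ι) :
    (l.map fun i => (1 - Finsupp.lmapDomain k k (fun s : Multiset ι => i ::ₘ s) *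
      Finsupp.linearCombination k fun s : Multiset ι =>
        if i ∈ s then Finsupp.single (s.erase i) (1 : k) else 0 :
          Module.End k (Multiset ι →₀ k))).prod (Finsupp.single s 1) =
      if ∀ i ∈ l, i ∉ s then Finsupp.single s 1 else 0 := by
  induction l with
  | nil => simp
  | cons i l ih =>
    rw [List.map_cons, List.prod_cons, Module.End.mul_apply, ih]
    by_cases h : ∀ j ∈ l, j ∉ s
    · rw [if_pos h]
      by_cases hi : i ∈ s
      · simp [hi]
      · rw [if_pos (show ∀ j ∈ i :: l, j ∉ s by simpa using ⟨hi, h⟩)]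
        simp [hi]
    · have : ¬ ∀ j ∈ i :: l, j ∉ s := fun h' => h fun j hj => h' j (List.mem_cons_of_mem _ hj)
      rw [if_neg h, if_neg this, map_zero]

/-- The filtration of the polynomial ring by degree. -/
noncomputable def polynomial : PolyFiltration ι k (Multiset ι →₀ k) where
  F p := Finsupp.supported k k {s | s.card < p}
  X i := Finsupp.lmapDomain k k fun s => i ::ₘ s
  Y i := Finsupp.linearCombination k fun s => if i ∈ s then Finsupp.single (s.erase i) 1 else 0
  F_zero := by simp
  F_mono p q h := Finsupp.supported_mono fun s hs => lt_of_lt_of_le hs h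
  exists_mem z := ⟨z.support.sup Multiset.card + 1, fun s hs =>
    Nat.lt_succ_of_le (Finset.le_sup (f := Multiset.card) hs)⟩
  Y_mul_X i := by
    refine Finsupp.lhom_ext' fun s => LinearMap.ext_ring ?_
    simp
  X_mul_Y i j h := by
    refine Finsupp.lhom_ext' fun s => LinearMap.ext_ring ?_
    by_cases hj : j ∈ s
    · simp [hj, Multiset.erase_cons_tail, h]
    · simp [hj, h.symm]
  X_le i p := by
    rw [← Submodule.map_le_iff_le_comap, Finsupp.lmapDomain_supported]
    refine Finsupp.supported_mono ?_
    rintro _ ⟨s, hs, rfl⟩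
    simpa using hs
  Y_le i p := by
    rw [Finsupp.supported_eq_span_single, Submodule.span_le]
    rintro _ ⟨s, hs, rfl⟩
    by_cases hi : i ∈ s
    · have hs : s.card < p + 1 := hs
      have := Multiset.card_erase_add_one hi
      simpa [hi] using Finsupp.single_mem_supported k (1 : k) (a := s.erase i)
        (s := {s | s.card < p}) (show _ < p by omega)
    · simp [hi]
  prod_mem l hl z := by
    induction z using Finsupp.induction_linear with
    | zero => simp
    | add y z hy hz => rw [map_add]; exact Submodule.add_mem _ hy hz
    | single s c =>
      rw [← mul_one c, ← smul_eq_mul, ← Finsupp.smul_single, map_smul, polynomial_prod]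
      refine Submodule.smul_mem _ _ ?_
      split_ifs with h
      · refine Finsupp.single_mem_supported k _ ?_
        have : s = 0 := Multiset.eq_zero_of_forall_notMem fun i => h i (hl i)
        simp [this]
      · exact Submodule.zero_mem _

end Polynomial

section Perturbation

variable {ι k N : Type*} [Fintype ι] [DecidableEq ι] [CommRing k] [AddCommGroup N] [Module k N]
  (f : PolyFiltration ι k N)

/-- Operators `E i` and `I i` that satisfy the canonical anticommutation relations, are compatible
with the operators `X i`, `Y i` of a filtration and preserve the filtration. -/
structure Fermions (E I : ι → Module.End k N) : Prop where
  anticomm : ∀ i j, E i * I j + I j * E i = if i = j then 1 else 0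
  X_I : ∀ i j, Commute (f.X i) (I j)
  Y_E : ∀ i j, Commute (f.Y i) (E j)
  E_le : ∀ i p, f.F p ≤ (f.F p).comap (E i)
  I_le : ∀ i p, f.F p ≤ (f.F p).comap (I i)

variable {f} {E I : ι → Module.End k N} (c : f.Fermions E I)
include c

/-- The Koszul differential `∑ Xⱼ Eⱼ` has the partial contracting homotopy `Yᵢ Iᵢ`. -/
theorem Fermions.homotopy (i : ι) :
    (∑ j, f.X j * E j) * (f.Y i * I i) + f.Y i * I i * ∑ j, f.X j * E j =
      1 - (1 - f.X i * f.Y i) * (E i * I i) := by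
  rw [Finset.sum_mul, Finset.mul_sum, ← Finset.sum_add_distrib, Finset.sum_eq_single i]
  · have h1 : f.X i * E i * (f.Y i * I i) = f.X i * f.Y i * (E i * I i) := by
      rw [mul_assoc, ← mul_assoc (E i), ← (c.Y_E i i).eq]
      simp only [mul_assoc]
    have h2 : f.Y i * I i * (f.X i * E i) = I i * E i := by
      rw [mul_assoc, ← mul_assoc (I i), ← (c.X_I i i).eq, ← mul_assoc, ← mul_assoc, f.Y_mul_X,
        one_mul]
    have h3 := c.anticomm i i
    rw [if_pos rfl, ← eq_sub_iff_add_eq'] at h3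
    rw [h1, h2, h3]
    noncomm_ring
  · intro j _ hji
    have h1 : f.X j * E j * (f.Y i * I i) = f.Y i * f.X j * (E j * I i) := by
      rw [← f.X_mul_Y j i hji, mul_assoc, ← mul_assoc (E j), ← (c.Y_E i j).eq]
      simp only [mul_assoc]
    have h2 : f.Y i * I i * (f.X j * E j) = f.Y i * f.X j * (I i * E j) := by
      rw [mul_assoc, ← mul_assoc (I i), ← (c.X_I j i).eq]
      simp only [mul_assoc]
    rw [h1, h2, ← mul_add, c.anticomm, if_neg hji, mul_zero]
  · simp

variable {D : Module.End k N} (hD : D * D = 0)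
  (hlow : ∀ p, f.F p ≤ (f.F p).comap (D - ∑ j, f.X j * E j))
include hlow

/-- The homotopy `Yᵢ Iᵢ` turns a cycle into its image under the projection `(1 - Xᵢ Yᵢ) Eᵢ Iᵢ`, up to
a boundary and terms of lower degree. -/
theorem Fermions.sub_mem (i : ι) {p : ℕ} {z : N} (hz : z ∈ f.F (p + 1)) (hDz : D z = 0) :
    z - D (f.Y i (I i z)) - (1 - f.X i * f.Y i) (E i (I i z)) ∈ f.F p := by
  set D' := D - ∑ j, f.X j * E j with hD'
  have key := LinearMap.congr_fun (c.homotopy i) z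
  have h0 : (∑ j, f.X j * E j) = D - D' := by rw [hD']; abel
  rw [h0] at key
  simp only [LinearMap.add_apply, Module.End.mul_apply, LinearMap.sub_apply, Module.End.one_apply,
    hDz, zero_sub, map_neg] at key
  have h1 : f.Y i (I i (D' z)) ∈ f.F p := f.Y_le i p (c.I_le i _ (hlow _ hz))
  have h2 : D' (f.Y i (I i z)) ∈ f.F p := hlow _ (f.Y_le i p (c.I_le i _ hz))
  have e : z - D (f.Y i (I i z)) - (1 - f.X i * f.Y i) (E i (I i z)) =
      -(f.Y i (I i (D' z)) + D' (f.Y i (I i z))) := by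
    simp only [LinearMap.sub_apply, Module.End.one_apply, Module.End.mul_apply]
    rw [sub_sub, sub_eq_iff_eq_add, ← sub_eq_iff_eq_add', neg_add_rev, sub_eq_iff_eq_add]
    rw [eq_comm, sub_eq_iff_eq_add] at key
    rw [← sub_eq_zero] at key ⊢
    rw [← key]
    abel
  rw [e]
  exact Submodule.neg_mem _ (Submodule.add_mem _ h1 h2)

include hD in
/-- A differential with leading term the Koszul differential has no cohomology, apart from the
terms that all the projections `(1 - Xᵢ Yᵢ) Eᵢ Iᵢ` preserve. -/
theorem Fermions.exists_sub_mem {l : List ι} {G : Submodule k N} (hG : G ≤ f.F 1)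
    (hl : ∀ z, (l.map fun i => (1 - f.X i * f.Y i) * (E i * I i)).prod z ∈ G)
    (z : N) (hz : D z = 0) : ∃ y, z - D y ∈ G := by
  have hDD : ∀ y, D (D y) = 0 := fun y => LinearMap.congr_fun hD y
  -- The homotopies for the indices in `l` apply one after the other, modulo lower degree.
  have step : ∀ (l : List ι) (p : ℕ) (z : N), z ∈ f.F (p + 1) → D z = 0 →
      ∃ y, z - D y - (l.map fun i => (1 - f.X i * f.Y i) * (E i * I i)).prod z ∈ f.F p := by
    intro l p z hz hDz
    induction l with
    | nil => exact ⟨0, by simp⟩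
    | cons i l ih =>
      obtain ⟨y, hy⟩ := ih
      have pres : ∀ (i : ι) (q : ℕ) (w : N), w ∈ f.F q →
          ((1 - f.X i * f.Y i) * (E i * I i)) w ∈ f.F q := by
        intro i q w hw
        rw [Module.End.mul_apply, Module.End.mul_apply, LinearMap.sub_apply, Module.End.one_apply,
          Module.End.mul_apply]
        have hw' := c.E_le i q (c.I_le i q hw)
        rcases q with _ | q
        · rw [f.F_zero] at hw' ⊢
          have : E i (I i w) = 0 := hw'
          simp [this]
        · exact Submodule.sub_mem _ hw' (f.X_le i q (f.Y_le i q hw'))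
      have presP : ∀ (l : List ι), (l.map fun i => (1 - f.X i * f.Y i) * (E i * I i)).prod z ∈
          f.F (p + 1) := by
        intro l
        induction l with
        | nil => simpa using hz
        | cons j l ih => rw [List.map_cons, List.prod_cons]; exact pres j _ _ ih
      have hzy : z - D y ∈ f.F (p + 1) := by
        rw [← sub_add_cancel (z - D y) ((l.map fun i => (1 - f.X i * f.Y i) * (E i * I i)).prod z)]
        exact Submodule.add_mem _ (f.F_mono (Nat.le_succ p) hy) (presP l)
      have h : z - D y - D (f.Y i (I i (z - D y))) -
          ((1 - f.X i * f.Y i) * (E i * I i)) (z - D y) ∈ f.F p :=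
        c.sub_mem hlow i hzy (by rw [map_sub, hDz, hDD, sub_zero])
      refine ⟨y + f.Y i (I i (z - D y)), ?_⟩
      have h' := Submodule.add_mem _ h (pres i p _ hy)
      rw [List.map_cons, List.prod_cons, Module.End.mul_apply]
      rw [map_sub _ (z - D y)] at h'
      convert h' using 1
      rw [map_add]
      abel
  -- The error terms have lower degree, and vanish in degree less than zero.
  have descent : ∀ (p : ℕ) (z : N), z ∈ f.F (p + 1) → D z = 0 → ∃ y, z - D y ∈ G := by
    intro p
    induction p with
    | zero =>
      intro z hz hDz
      obtain ⟨y, hy⟩ := step l 0 z hz hDz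
      rw [f.F_zero, Submodule.mem_bot, sub_eq_zero] at hy
      exact ⟨y, hy ▸ hl z⟩
    | succ p ih =>
      intro z hz hDz
      obtain ⟨y, hy⟩ := step l (p + 1) z hz hDz
      obtain ⟨y', hy'⟩ := ih (z - D y) (by
        rw [← sub_add_cancel (z - D y) ((l.map fun i => (1 - f.X i * f.Y i) * (E i * I i)).prod z)]
        exact Submodule.add_mem _ hy (f.F_mono (by omega) (hG (hl z))))
        (by rw [map_sub, hDz, hDD, sub_zero])
      exact ⟨y + y', by rwa [map_add, ← sub_sub]⟩
  obtain ⟨p, hp⟩ := f.exists_mem z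
  exact descent p z (f.F_mono (Nat.le_succ p) hp) hz

end Perturbation
end PolyFiltration

/-! ### The degree filtrations of `U(g)` and of `U(g) ⊗ U(g)°` -/

namespace PBW
open MulOpposite

attribute [local instance 100] LieRing.ofAssociativeRing

section
variable {k g : Type*} [Field k] [LieRing g] [LieAlgebra k g]
variable {n : ℕ} (b : Module.Basis (Fin n) k g)

/-- The filtration of `U(g)` by degree. -/
noncomputable def filtration : PolyFiltration (Fin n) k (UniversalEnvelopingAlgebra k g) :=
  (PolyFiltration.polynomial (Fin n) k).congr (pbwEquiv b).symm

theorem filtration_F (p : ℕ) : (filtration b).F p =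
    Submodule.span k
      ((fun s : Multiset (Fin n) => wordProd b (s.sort (· ≤ ·))) '' {s | s.card < p}) := by
  change Submodule.map _ (Finsupp.supported k k {s : Multiset (Fin n) | s.card < p}) = _
  rw [Finsupp.supported_eq_span_single, Submodule.map_span, Set.image_image]
  congr 1
  refine Set.image_congr fun s _ => ?_
  exact pbwEquiv_symm_single b s

theorem filtration_X_wordProd (i : Fin n) (s : Multiset (Fin n)) :
    (filtration b).X i (wordProd b (s.sort (· ≤ ·))) =
      (pbwEquiv b).symm (Finsupp.single (i ::ₘ s) 1) := by
  change (pbwEquiv b).symm (Finsupp.lmapDomain k k _ (pbwEquiv b (wordProd b _))) = _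
  rw [pbwEquiv_wordProd, normalForm_sort]
  simp

theorem wordProd_sub_mem (i : Fin n) (s : Multiset (Fin n)) (w : List (Fin n))
    (h : (w : Multiset (Fin n)) = i ::ₘ s) {p : ℕ} (hs : s.card < p) :
    wordProd b w - (filtration b).X i (wordProd b (s.sort (· ≤ ·))) ∈ (filtration b).F p := by
  refine ⟨pbwEquiv b (wordProd b w - (filtration b).X i (wordProd b (s.sort (· ≤ ·)))), ?_, by simp⟩
  rw [map_sub, filtration_X_wordProd, LinearEquiv.apply_symm_apply, pbwEquiv_wordProd, ← h]
  refine Finsupp.supported_mono ?_ (normalForm_sub_single_mem b w)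
  intro t ht
  have : w.length = s.card + 1 := by rw [← Multiset.coe_card, h, Multiset.card_cons]
  simp only [Set.mem_ofPred_eq] at ht ⊢
  omega

/-- Left multiplication by `bᵢ` is multiplication by the variable `xᵢ`, up to terms of lower degree. -/
theorem mul_sub_X_mem (i : Fin n) {p : ℕ} {a : UniversalEnvelopingAlgebra k g}
    (ha : a ∈ (filtration b).F p) :
    UniversalEnvelopingAlgebra.ι k (b i) * a - (filtration b).X i a ∈ (filtration b).F p := by
  suffices (filtration b).F p ≤ ((filtration b).F p).comap
      (LinearMap.mulLeft k (UniversalEnvelopingAlgebra.ι k (b i)) - (filtration b).X i) from this ha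
  rw [filtration_F, Submodule.span_le]
  rintro _ ⟨s, hs, rfl⟩
  have := wordProd_sub_mem b i s (i :: s.sort (· ≤ ·)) (by simp [← Multiset.cons_coe]) hs
  rw [filtration_F] at this
  simpa [wordProd] using this

/-- Right multiplication by `bᵢ` is multiplication by the variable `xᵢ`, up to terms of lower degree. -/
theorem mul_ι_sub_X_mem (i : Fin n) {p : ℕ} {a : UniversalEnvelopingAlgebra k g}
    (ha : a ∈ (filtration b).F p) :
    a * UniversalEnvelopingAlgebra.ι k (b i) - (filtration b).X i a ∈ (filtration b).F p := by
  suffices (filtration b).F p ≤ ((filtration b).F p).comap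
      (LinearMap.mulRight k (UniversalEnvelopingAlgebra.ι k (b i)) - (filtration b).X i) from this ha
  rw [filtration_F, Submodule.span_le]
  rintro _ ⟨s, hs, rfl⟩
  have := wordProd_sub_mem b i s (s.sort (· ≤ ·) ++ [i])
    (by rw [← Multiset.coe_add, Multiset.sort_eq, Multiset.coe_singleton, add_comm,
      Multiset.singleton_add]) hs
  rw [filtration_F] at this
  simpa [wordProd] using this

theorem mem_filtration_one {a : UniversalEnvelopingAlgebra k g} (ha : a ∈ (filtration b).F 1) :
    ∃ c : k, a = c • 1 := by
  rw [filtration_F] at ha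
  have : (fun s : Multiset (Fin n) => wordProd b (s.sort (· ≤ ·))) ''
      {s : Multiset (Fin n) | s.card < 1} = {1} := by
    ext a
    simp [wordProd]
  rw [this, Submodule.mem_span_singleton] at ha
  obtain ⟨c, rfl⟩ := ha
  exact ⟨c, rfl⟩

variable (k) in
/-- The element `x ⊗ 1 - 1 ⊗ x` of the enveloping algebra of `U(g)`. -/
noncomputable def adEnv : g →ₗ[k] Hochschild.Env k (UniversalEnvelopingAlgebra k g) :=
  ((TensorProduct.mk k _ (UniversalEnvelopingAlgebra k g)ᵐᵒᵖ).flip 1 -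
    TensorProduct.mk k _ _ 1 ∘ₗ (opLinearEquiv k).toLinearMap) ∘ₗ
      (UniversalEnvelopingAlgebra.ι k : g →ₗ⁅k⁆ UniversalEnvelopingAlgebra k g).toLinearMap

variable (k) in
theorem adEnv_apply (x : g) : adEnv k x = UniversalEnvelopingAlgebra.ι k x ⊗ₜ 1 -
    1 ⊗ₜ op (UniversalEnvelopingAlgebra.ι k x) := rfl

theorem adEnv_lie (x y : g) :
    adEnv k ⁅x, y⁆ = adEnv k x * adEnv k y - adEnv k y * adEnv k x := by
  simp only [adEnv_apply, ι_lie, op_sub, op_mul, TensorProduct.sub_tmul, TensorProduct.tmul_sub,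
    mul_sub, sub_mul, Algebra.TensorProduct.tmul_mul_tmul, one_mul, mul_one]
  abel

/-- The filtration of `U(g) ⊗ U(g)°` by the degree of the first factor. -/
noncomputable def envFiltration :
    PolyFiltration (Fin n) k (Hochschild.Env k (UniversalEnvelopingAlgebra k g)) :=
  (filtration b).rTensor (UniversalEnvelopingAlgebra k g)ᵐᵒᵖ

theorem envFiltration_F (p : ℕ) : (envFiltration b).F p =
    Submodule.map₂ (TensorProduct.mk k _ _) ((filtration b).F p) ⊤ := rfl

theorem envFiltration_X_tmul (i : Fin n) (u : UniversalEnvelopingAlgebra k g)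
    (v : (UniversalEnvelopingAlgebra k g)ᵐᵒᵖ) :
    (envFiltration b).X i (u ⊗ₜ v) = (filtration b).X i u ⊗ₜ v := rfl

/-- In `U(g) ⊗ U(g)°`, multiplication by `bᵢ ⊗ 1 - 1 ⊗ bᵢ` has the leading term `bᵢ ⊗ 1`, since the
filtration does not see the second factor. -/
theorem adEnv_mul_sub_X_mem (i : Fin n) {p : ℕ}
    {r : Hochschild.Env k (UniversalEnvelopingAlgebra k g)} (hr : r ∈ (envFiltration b).F p) :
    adEnv k (b i) * r - (envFiltration b).X i r ∈ (envFiltration b).F p := by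
  suffices (envFiltration b).F p ≤ ((envFiltration b).F p).comap
      (LinearMap.mulLeft k (adEnv k (b i)) - (envFiltration b).X i) from this hr
  rw [envFiltration_F]
  refine Submodule.map₂_le.2 fun u hu v _ => ?_
  have e : (LinearMap.mulLeft k (adEnv k (b i)) - (envFiltration b).X i) (u ⊗ₜ v) =
      (UniversalEnvelopingAlgebra.ι k (b i) * u - (filtration b).X i u) ⊗ₜ v -
        u ⊗ₜ (op (UniversalEnvelopingAlgebra.ι k (b i)) * v) := by
    simp [adEnv_apply, sub_mul, TensorProduct.sub_tmul, envFiltration_X_tmul]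
    abel
  rw [Submodule.mem_comap, TensorProduct.mk_apply, e]
  exact Submodule.sub_mem _
    (Submodule.apply_mem_map₂ _ (mul_sub_X_mem b i hu) Submodule.mem_top)
    (Submodule.apply_mem_map₂ _ hu Submodule.mem_top)

theorem mul_adEnv_sub_X_mem (i : Fin n) {p : ℕ}
    {r : Hochschild.Env k (UniversalEnvelopingAlgebra k g)} (hr : r ∈ (envFiltration b).F p) :
    r * adEnv k (b i) - (envFiltration b).X i r ∈ (envFiltration b).F p := by
  suffices (envFiltration b).F p ≤ ((envFiltration b).F p).comap
      (LinearMap.mulRight k (adEnv k (b i)) - (envFiltration b).X i) from this hr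
  rw [envFiltration_F]
  refine Submodule.map₂_le.2 fun u hu v _ => ?_
  have e : (LinearMap.mulRight k (adEnv k (b i)) - (envFiltration b).X i) (u ⊗ₜ v) =
      (u * UniversalEnvelopingAlgebra.ι k (b i) - (filtration b).X i u) ⊗ₜ v -
        u ⊗ₜ (v * op (UniversalEnvelopingAlgebra.ι k (b i))) := by
    simp [adEnv_apply, mul_sub, TensorProduct.sub_tmul, envFiltration_X_tmul]
    abel
  rw [Submodule.mem_comap, TensorProduct.mk_apply, e]
  exact Submodule.sub_mem _
    (Submodule.apply_mem_map₂ _ (mul_ι_sub_X_mem b i hu) Submodule.mem_top)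
    (Submodule.apply_mem_map₂ _ hu Submodule.mem_top)

theorem mem_envFiltration_one {r : Hochschild.Env k (UniversalEnvelopingAlgebra k g)}
    (hr : r ∈ (envFiltration b).F 1) : ∃ v, r = 1 ⊗ₜ v := by
  suffices (envFiltration b).F 1 ≤ LinearMap.range (TensorProduct.mk k
      (UniversalEnvelopingAlgebra k g) (UniversalEnvelopingAlgebra k g)ᵐᵒᵖ 1) by
    obtain ⟨v, hv⟩ := this hr
    exact ⟨v, hv.symm⟩
  rw [envFiltration_F]
  refine Submodule.map₂_le.2 fun u hu v _ => ?_
  obtain ⟨c, rfl⟩ := mem_filtration_one b hu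
  exact ⟨c • v, by simp⟩

end
end PBW

/-! ### Creation and annihilation operators -/

namespace Fock

section
variable {ι : Type*} [LinearOrder ι]

/-- The sign of moving `i` past the elements of `S` that are smaller than `i`. -/
def sgn (i : ι) (S : Finset ι) : ℤ := (-1) ^ (S.filter (· < i)).card

theorem sgn_mul_self (i : ι) (S : Finset ι) : sgn i S * sgn i S = 1 := by
  rw [sgn, ← pow_add, ← two_mul, pow_mul]
  simp

theorem sgn_insert {i j : ι} {S : Finset ι} (h : j ∉ S) :
    sgn i (insert j S) = (if j < i then -1 else 1) * sgn i S := by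
  rw [sgn, sgn, Finset.filter_insert]
  split_ifs
  · rw [Finset.card_insert_of_notMem (by simp [h]), pow_succ']
  · rw [one_mul]

theorem sgn_erase {i j : ι} {S : Finset ι} (h : j ∈ S) :
    sgn i (S.erase j) = (if j < i then -1 else 1) * sgn i S := by
  conv_rhs => rw [← Finset.insert_erase h, sgn_insert (Finset.notMem_erase j S)]
  split_ifs <;> simp

variable (k : Type*) {N : Type*} [CommRing k] [AddCommGroup N] [Module k N]

/-- The creation operator, which multiplies by the basis vector `i` of the exterior algebra.
An element of `⋀ ⊗ N` is written as the function of its coefficients. -/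
def create (i : ι) : Module.End k (Finset ι → N) where
  toFun ω S := if i ∈ S then sgn i S • ω (S.erase i) else 0
  map_add' ω η := by
    ext S
    by_cases h : i ∈ S <;> simp [h]
  map_smul' c ω := by
    ext S
    by_cases h : i ∈ S <;> simp [h, smul_comm c]

/-- The annihilation operator, which contracts with the vector `i` of the dual basis. -/
def annih (i : ι) : Module.End k (Finset ι → N) where
  toFun ω S := if i ∈ S then 0 else sgn i S • ω (insert i S)
  map_add' ω η := by
    ext S
    by_cases h : i ∈ S <;> simp [h]
  map_smul' c ω := by
    ext S
    by_cases h : i ∈ S <;> simp [h, smul_comm c]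

variable {k}

theorem create_apply (i : ι) (ω : Finset ι → N) (S : Finset ι) :
    create k i ω S = if i ∈ S then sgn i S • ω (S.erase i) else 0 := rfl

theorem annih_apply (i : ι) (ω : Finset ι → N) (S : Finset ι) :
    annih k i ω S = if i ∈ S then 0 else sgn i S • ω (insert i S) := rfl

theorem create_annih_self (i : ι) (ω : Finset ι → N) (S : Finset ι) :
    create k i (annih k i ω) S = if i ∈ S then ω S else 0 := by
  rw [create_apply]
  split_ifs with h
  · rw [annih_apply, if_neg (Finset.notMem_erase i S), Finset.insert_erase h, sgn_erase h,
      if_neg (lt_irrefl i), one_mul, smul_smul, sgn_mul_self, one_smul]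
  · rfl

theorem annih_create_self (i : ι) (ω : Finset ι → N) (S : Finset ι) :
    annih k i (create k i ω) S = if i ∈ S then 0 else ω S := by
  rw [annih_apply]
  split_ifs with h
  · rfl
  · rw [create_apply, if_pos (Finset.mem_insert_self i S), Finset.erase_insert h, sgn_insert h,
      if_neg (lt_irrefl i), one_mul, smul_smul, sgn_mul_self, one_smul]

/-- The canonical anticommutation relations. -/
theorem create_annih (i j : ι) :
    (create k i * annih k j + annih k j * create k i : Module.End k (Finset ι → N)) =
      if i = j then 1 else 0 := by
  refine LinearMap.ext fun ω => ?_
  ext S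
  rw [LinearMap.add_apply, Pi.add_apply]
  split_ifs with h
  · subst h
    rw [Module.End.mul_apply, Module.End.mul_apply, create_annih_self, annih_create_self]
    by_cases hi : i ∈ S <;> simp [hi]
  · simp only [Module.End.mul_apply, create_apply, annih_apply, Finset.mem_erase,
      Finset.mem_insert, h, Ne.symm h, Ne, not_false_eq_true, true_and, false_or]
    by_cases hi : i ∈ S
    · by_cases hj : j ∈ S
      · simp [hi, hj]
      · have e : (insert j S).erase i = insert j (S.erase i) :=
          Finset.erase_insert_of_ne (Ne.symm h)
        simp only [hi, hj, if_true, if_false, sgn_insert hj, sgn_erase hi, e, smul_smul, ← add_smul]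
        rcases lt_or_gt_of_ne h with hij | hij
        · simp [hij, hij.not_gt, mul_comm]
        · simp [hij, hij.not_gt, mul_comm]
    · simp [hi]

theorem create_create (i j : ι) :
    (create k i * create k j + create k j * create k i : Module.End k (Finset ι → N)) = 0 := by
  refine LinearMap.ext fun ω => ?_
  ext S
  rw [LinearMap.add_apply, Pi.add_apply, Module.End.mul_apply, Module.End.mul_apply]
  by_cases h : i = j
  · subst h
    simp [create_apply]
  · simp only [create_apply, Finset.mem_erase, h, Ne.symm h, Ne, not_false_eq_true, true_and]
    by_cases hi : i ∈ S
    · by_cases hj : j ∈ S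
      · simp only [hi, hj, if_true, sgn_erase hj, sgn_erase hi, Finset.erase_right_comm (a := i),
          smul_smul, ← add_smul]
        rcases lt_or_gt_of_ne h with hij | hij
        · simp [hij, hij.not_gt, mul_comm]
        · simp [hij, hij.not_gt, mul_comm]
      · simp [hj]
    · simp [hi]

theorem pointwise_commute_create (T : Module.End k N) (i : ι) :
    Commute (PolyFiltration.pointwise (Finset ι) T) (create k i) := by
  refine LinearMap.ext fun ω => ?_
  ext S
  simp only [Module.End.mul_apply, PolyFiltration.pointwise_apply, LinearMap.compLeft_apply,
    Function.comp_apply, create_apply]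
  split_ifs <;> simp

theorem pointwise_commute_annih (T : Module.End k N) (i : ι) :
    Commute (PolyFiltration.pointwise (Finset ι) T) (annih k i) := by
  refine LinearMap.ext fun ω => ?_
  ext S
  simp only [Module.End.mul_apply, PolyFiltration.pointwise_apply, LinearMap.compLeft_apply,
    Function.comp_apply, annih_apply]
  split_ifs <;> simp

variable (k) in
theorem create_single [DecidableEq (Finset ι)] (i : ι) (S : Finset ι) (h : i ∉ S) (r : N) :
    create k i (Pi.single S r) = Pi.single (insert i S) (sgn i S • r) := by
  ext T
  rw [create_apply]
  by_cases hT : T = insert i S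
  · subst hT
    simp [h, sgn_insert h]
  · rw [Pi.single_eq_of_ne hT]
    split_ifs with hi
    · rw [Pi.single_eq_of_ne, smul_zero]
      rintro rfl
      exact hT (Finset.insert_erase hi).symm
    · rfl

theorem annih_single_empty [DecidableEq (Finset ι)] (i : ι) (r : N) :
    annih k i (Pi.single ∅ r) = 0 := by
  ext T
  rw [annih_apply]
  split_ifs with h
  · rfl
  · rw [Pi.single_eq_of_ne (Finset.insert_ne_empty i T), smul_zero]
    rfl

/-- An operator that commutes or anticommutes with creation and kills the vacuum is zero. -/
theorem eq_zero_of_create [Finite ι] [DecidableEq (Finset ι)] (ε : ℤ)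
    (T : Module.End k (Finset ι → N))
    (h : ∀ i, T * create k i = ε • (create k i * T)) (h0 : ∀ r, T (Pi.single ∅ r) = 0) :
    T = 0 := by
  have := Fintype.ofFinite ι
  have key : ∀ (S : Finset ι) (r : N), T (Pi.single S r) = 0 := by
    intro S
    induction S using Finset.induction_on with
    | empty => exact h0
    | insert i S hi ih =>
      intro r
      have e := LinearMap.congr_fun (h i) (Pi.single S (sgn i S • r))
      rw [Module.End.mul_apply, create_single k i S hi, smul_smul, sgn_mul_self, one_smul,
        LinearMap.smul_apply, Module.End.mul_apply, ih, map_zero, smul_zero] at e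
      exact e
  refine LinearMap.pi_ext fun S r => ?_
  rw [LinearMap.zero_apply]
  exact key S r

/-- What all creation operators kill is concentrated in top degree. -/
theorem eq_single_univ_of_create [Fintype ι] [DecidableEq (Finset ι)] (ω : Finset ι → N)
    (h : ∀ i, create k i ω = 0) {S : Finset ι} (hS : S ≠ Finset.univ) : ω S = 0 := by
  obtain ⟨i, hi⟩ : ∃ i, i ∉ S := by
    by_contra! hc
    exact hS (Finset.eq_univ_iff_forall.2 hc)
  have := congrFun (h i) (insert i S)
  rw [create_apply, if_pos (Finset.mem_insert_self i S), Finset.erase_insert hi] at this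
  have h2 := congrArg (sgn i (insert i S) • ·) this
  simpa [smul_smul, sgn_mul_self] using h2

/-- Functions that are supported on subsets with `q` elements. -/
def degree (R N : Type*) [Ring R] [AddCommGroup N] [Module R N] (ι : Type*) (q : ℕ) :
    Submodule R (Finset ι → N) where
  carrier := {ω | ∀ S, S.card ≠ q → ω S = 0}
  add_mem' h h' S hS := by rw [Pi.add_apply, h S hS, h' S hS, add_zero]
  zero_mem' _ _ := rfl
  smul_mem' c ω h S hS := by rw [Pi.smul_apply, h S hS, smul_zero]

end
end Fock

/-! ### The Chevalley–Eilenberg differential -/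

namespace ChevalleyEilenberg

section
variable {k g : Type*} [Field k] [LieRing g] [LieAlgebra k g]
variable {n : ℕ} (b : Module.Basis (Fin n) k g)

/-- A ring of operators that contains exterior multiplications `e x`, for `x` in `g`, and the
contractions `c j` with the dual basis of `b`. The left ideal `V` stands for the operators that
kill the vacuum. -/
structure Operators (𝓔 : Type*) [Ring 𝓔] [Algebra k 𝓔] where
  e : g →ₗ[k] 𝓔
  c : Fin n → 𝓔
  V : Submodule 𝓔 𝓔
  e_mul_c : ∀ x j, e x * c j + c j * e x = b.repr x j • 1
  e_mul_e : ∀ x y, e x * e y = -(e y * e x)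
  c_mem : ∀ j, c j ∈ V
  /-- The exterior algebra is generated by exterior multiplications from the vacuum. -/
  eq_zero : ∀ (ε : ℤ), ∀ T ∈ V, (∀ x, T * e x = ε • (e x * T)) → T = 0

namespace Operators

variable {b} {𝓔 : Type*} [Ring 𝓔] [Algebra k 𝓔] (o : Operators b 𝓔)

theorem c_mul_e (x : g) (j : Fin n) : o.c j * o.e x = b.repr x j • 1 - o.e x * o.c j := by
  rw [← o.e_mul_c x j, add_sub_cancel_left]

/-- The adjoint action of `g` on its exterior algebra. -/
noncomputable def adExt (x : g) : 𝓔 :=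
  ∑ j, o.e ⁅x, b j⁆ * o.c j

theorem sum_repr_e_lie (x y : g) : ∑ j, b.repr y j • o.e ⁅x, b j⁆ = o.e ⁅x, y⁆ := by
  simp only [← map_smul, ← map_sum, ← lie_smul, ← lie_sum, b.sum_repr]

theorem adExt_mul_e (x y : g) :
    o.adExt x * o.e y = o.e y * o.adExt x + o.e ⁅x, y⁆ := by
  rw [adExt, Finset.sum_mul, Finset.mul_sum, ← o.sum_repr_e_lie x y, ← Finset.sum_add_distrib]
  refine Finset.sum_congr rfl fun j _ => ?_
  rw [mul_assoc, c_mul_e, mul_sub, mul_smul_comm, mul_one, ← mul_assoc, o.e_mul_e _ y, neg_mul,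
    sub_neg_eq_add, mul_assoc, add_comm]

theorem adExt_mem (x : g) : o.adExt x ∈ o.V :=
  Submodule.sum_mem _ fun j _ => o.V.smul_mem _ (o.c_mem j)

/-- The two sides have the same commutator with exterior multiplication, and kill the vacuum. -/
theorem adExt_lie (x y : g) :
    o.adExt ⁅x, y⁆ = o.adExt x * o.adExt y - o.adExt y * o.adExt x := by
  rw [eq_comm, ← sub_eq_zero]
  refine o.eq_zero 1 _ (o.V.sub_mem (o.V.sub_mem (o.V.smul_mem _ (o.adExt_mem y))
    (o.V.smul_mem _ (o.adExt_mem x))) (o.adExt_mem _)) fun z => ?_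
  have h : ∀ x y, o.adExt x * o.adExt y * o.e z = o.e z * (o.adExt x * o.adExt y) +
      o.e ⁅x, z⁆ * o.adExt y + (o.e ⁅y, z⁆ * o.adExt x + o.e ⁅x, ⁅y, z⁆⁆) := by
    intro x y
    rw [mul_assoc, adExt_mul_e, mul_add, ← mul_assoc, adExt_mul_e, adExt_mul_e, add_mul, mul_assoc]
  rw [one_smul, sub_mul, sub_mul, h, h, adExt_mul_e, lie_lie, map_sub]
  noncomm_ring

/-- The part of the differential that involves the bracket of `g`:
`x₁ ∧ ⋯ ∧ x_q ↦ ∑_{i < j} (-1)^(i+j) [xᵢ, xⱼ] ∧ x₁ ∧ ⋯ ∧ x_q`, with `xᵢ` and `xⱼ` left out. -/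
noncomputable def bracketPart : 𝓔 :=
  -∑ i, ∑ j, if i < j then o.e ⁅b i, b j⁆ * o.c j * o.c i else 0

/-- Cartan's formula for trivial coefficients. -/
theorem bracketPart_mul_e (x : g) :
    o.bracketPart * o.e x + o.e x * o.bracketPart = -o.adExt x := by
  have h : ∀ y (i j : Fin n), o.e y * o.c j * o.c i * o.e x +
      o.e x * (o.e y * o.c j * o.c i) =
      b.repr x i • (o.e y * o.c j) - b.repr x j • (o.e y * o.c i) := by
    intro y i j
    rw [mul_assoc _ (o.c i), c_mul_e, mul_sub, mul_smul_comm, mul_one, ← mul_assoc _ (o.e x),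
      mul_assoc _ (o.c j) (o.e x), c_mul_e, mul_sub, mul_smul_comm, mul_one, sub_mul,
      smul_mul_assoc, ← mul_assoc (o.e y) (o.e x), o.e_mul_e y x]
    noncomm_ring
  rw [bracketPart, neg_mul, mul_neg, ← neg_add, Finset.sum_mul, Finset.mul_sum,
    ← Finset.sum_add_distrib]
  congr 1
  simp only [Finset.sum_mul, Finset.mul_sum, ← Finset.sum_add_distrib, ite_mul, mul_ite, zero_mul,
    mul_zero]
  have e : ∀ i j : Fin n, ((if i < j then o.e ⁅b i, b j⁆ * o.c j * o.c i * o.e x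
        else 0) + if i < j then o.e x * (o.e ⁅b i, b j⁆ * o.c j * o.c i) else 0) =
      (if i < j then b.repr x i • (o.e ⁅b i, b j⁆ * o.c j) else 0) +
      (if i < j then b.repr x j • (o.e ⁅b j, b i⁆ * o.c i) else 0) := by
    intro i j
    split_ifs
    · rw [h, ← lie_skew (b j) (b i), map_neg, neg_mul, smul_neg, sub_eq_add_neg]
    · simp
  simp only [e, Finset.sum_add_distrib]
  rw [Finset.sum_comm (f := fun i j => if i < j then b.repr x j • (o.e ⁅b j, b i⁆ * o.c i)
    else 0), ← Finset.sum_add_distrib]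
  simp only [← Finset.sum_add_distrib]
  rw [Finset.sum_comm, adExt]
  refine Finset.sum_congr rfl fun j _ => ?_
  have hx : o.e ⁅x, b j⁆ = ∑ i, b.repr x i • o.e ⁅b i, b j⁆ := by
    rw [← lie_skew, map_neg, ← sum_repr_e_lie, ← Finset.sum_neg_distrib]
    refine Finset.sum_congr rfl fun i _ => ?_
    rw [← lie_skew, map_neg, smul_neg, neg_neg]
  rw [hx, Finset.sum_mul]
  refine Finset.sum_congr rfl fun i _ => ?_
  rcases lt_trichotomy i j with h | rfl | h
  · simp [h, h.not_gt]
  · simp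
  · simp [h, h.not_gt]

theorem bracketPart_mem : o.bracketPart ∈ o.V := by
  refine o.V.neg_mem (Submodule.sum_mem _ fun i _ => Submodule.sum_mem _ fun j _ => ?_)
  split_ifs
  · exact o.V.smul_mem _ (o.c_mem i)
  · exact o.V.zero_mem

/-- The right action of `g` on the coefficients, as operators that commute with exterior
multiplications and contractions. -/
structure Coefficients (m : g →ₗ[k] 𝓔) : Prop where
  commute_e : ∀ x y, Commute (m x) (o.e y)
  commute_c : ∀ x j, Commute (m x) (o.c j)
  map_lie : ∀ x y, m ⁅x, y⁆ = m y * m x - m x * m y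
  mul_mem : ∀ T ∈ o.V, ∀ x, T * m x ∈ o.V

variable (m : g →ₗ[k] 𝓔)

/-- The Chevalley–Eilenberg differential `∑ⱼ m(bⱼ) cⱼ + Q`, with `Q` the bracket part. -/
noncomputable def boundary : 𝓔 :=
  ∑ j, m (b j) * o.c j + o.bracketPart

theorem boundary_mem : o.boundary m ∈ o.V :=
  o.V.add_mem (Submodule.sum_mem _ fun j _ => o.V.smul_mem _ (o.c_mem j)) o.bracketPart_mem

variable {o m} (hm : o.Coefficients m)
include hm

theorem Coefficients.commute_adExt (x y : g) : Commute (m x) (o.adExt y) :=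
  Commute.sum_right _ _ _ fun j _ => (hm.commute_e x _).mul_right (hm.commute_c x j)

/-- Cartan's formula: the anticommutator with exterior multiplication is the Lie derivative. -/
theorem Coefficients.boundary_mul_e (x : g) :
    o.boundary m * o.e x + o.e x * o.boundary m = m x - o.adExt x := by
  rw [boundary, add_mul, mul_add, add_add_add_comm, bracketPart_mul_e, sub_eq_add_neg]
  congr 1
  rw [Finset.sum_mul, Finset.mul_sum, ← Finset.sum_add_distrib]
  conv_rhs => rw [← b.sum_repr x, map_sum]
  refine Finset.sum_congr rfl fun j _ => ?_
  rw [← mul_assoc (o.e x), ← (hm.commute_e _ x).eq, mul_assoc, mul_assoc, ← mul_add,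
    add_comm, o.e_mul_c, mul_smul_comm, mul_one, map_smul]

theorem Coefficients.lieDerivative_lie (x y : g) :
    (m x - o.adExt x) * (m y - o.adExt y) -
      (m y - o.adExt y) * (m x - o.adExt x) =
      -(m ⁅x, y⁆ - o.adExt ⁅x, y⁆) := by
  rw [hm.map_lie, adExt_lie]
  have h1 := (hm.commute_adExt x y).eq
  have h2 := (hm.commute_adExt y x).eq
  simp only [sub_mul, mul_sub, h1, h2]
  abel

/-- By Cartan's formula, the commutator anticommutes with exterior multiplication. -/
theorem Coefficients.boundary_commute_lieDerivative (x : g) :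
    o.boundary m * (m x - o.adExt x) = (m x - o.adExt x) * o.boundary m := by
  rw [← sub_eq_zero]
  refine o.eq_zero (-1) _ (o.V.sub_mem ?_ (o.V.smul_mem _ (o.boundary_mem m))) fun y => ?_
  · rw [mul_sub]
    exact o.V.sub_mem (hm.mul_mem _ (o.boundary_mem m) x) (o.V.smul_mem _ (o.adExt_mem x))
  · have h1 : ∀ y, o.boundary m * o.e y =
        m y - o.adExt y - o.e y * o.boundary m := fun y => by
      rw [← hm.boundary_mul_e, add_sub_cancel_right]
    have h2 : (m x - o.adExt x) * o.e y =
        o.e y * (m x - o.adExt x) - o.e ⁅x, y⁆ := by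
      rw [sub_mul, adExt_mul_e, (hm.commute_e x y).eq]
      noncomm_ring
    have h3 := hm.lieDerivative_lie x y
    rw [sub_mul, mul_assoc, h2, mul_sub, ← mul_assoc, h1, h1, mul_assoc _ (o.boundary m), h1,
      mul_sub _ _ (o.e y * o.boundary m), ← mul_assoc _ (o.e y) (o.boundary m), h2]
    rw [← sub_eq_zero] at h3 ⊢
    rw [← neg_eq_zero, ← h3]
    noncomm_ring

/-- By Cartan's formula, the square of the differential commutes with exterior multiplication. -/
theorem Coefficients.boundary_mul_boundary : o.boundary m * o.boundary m = 0 := by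
  refine o.eq_zero 1 _ (o.V.smul_mem _ (o.boundary_mem m)) fun x => ?_
  have h1 : o.boundary m * o.e x =
      m x - o.adExt x - o.e x * o.boundary m := by
    rw [← hm.boundary_mul_e, add_sub_cancel_right]
  rw [one_smul, mul_assoc, h1, mul_sub, hm.boundary_commute_lieDerivative, ← mul_assoc, h1]
  noncomm_ring

end Operators

end
end ChevalleyEilenberg

namespace ChevalleyEilenberg

open Fock PolyFiltration

section
variable {k g : Type*} [Field k] [LieRing g] [LieAlgebra k g]
variable {n : ℕ} (b : Module.Basis (Fin n) k g)

section
variable (N : Type*) [AddCommGroup N] [Module k N]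

/-- Exterior multiplication by an element of `g`. -/
noncomputable def ext : g →ₗ[k] Module.End k (Finset (Fin n) → N) :=
  b.constr k fun i => create k i

theorem ext_apply (x : g) : ext b N x = ∑ i, b.repr x i • create k i := by
  simp [ext, Module.Basis.constr_apply_fintype]

theorem ext_basis (i : Fin n) : ext b N (b i) = create k i := by
  simp [ext]

/-- The operators on functions of subsets of the basis, with creation and annihilation. -/
noncomputable def operators : Operators b (Module.End k (Finset (Fin n) → N)) where
  e := ext b N
  c := annih k
  V :=
    { carrier := {T | ∀ r, T (Pi.single ∅ r) = 0}
      add_mem' := fun {S T} hS hT r => by rw [LinearMap.add_apply, hS, hT, add_zero]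
      zero_mem' := fun r => rfl
      smul_mem' := fun S T hT r => by rw [smul_eq_mul, Module.End.mul_apply, hT, map_zero] }
  e_mul_c x j := by
    rw [ext_apply, Finset.sum_mul, Finset.mul_sum, ← Finset.sum_add_distrib]
    simp only [smul_mul_assoc, mul_smul_comm, ← smul_add, create_annih]
    simp
  e_mul_e x y := by
    refine add_eq_zero_iff_eq_neg.1 ?_
    rw [ext_apply, ext_apply, Finset.sum_mul_sum, Finset.sum_mul_sum, Finset.sum_comm,
      ← Finset.sum_add_distrib]
    refine Finset.sum_eq_zero fun i _ => ?_
    rw [← Finset.sum_add_distrib]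
    refine Finset.sum_eq_zero fun j _ => ?_
    simp only [smul_mul_assoc, mul_smul_comm]
    rw [smul_comm (b.repr x j), ← smul_add, ← smul_add, create_create, smul_zero, smul_zero]
  c_mem j r := annih_single_empty j r
  eq_zero ε T h0 h := eq_zero_of_create ε T (fun i => by rw [← ext_basis b, h]) h0

/-- The projection onto the exterior power of degree `q`. -/
def proj (q : ℕ) : Module.End k (Finset (Fin n) → N) where
  toFun ω S := if S.card = q then ω S else 0
  map_add' ω η := by
    ext S
    by_cases h : S.card = q <;> simp [h]
  map_smul' c ω := by
    ext S
    by_cases h : S.card = q <;> simp [h]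

variable {N}

theorem proj_apply (q : ℕ) (ω : Finset (Fin n) → N) (S : Finset (Fin n)) :
    proj (k := k) N q ω S = if S.card = q then ω S else 0 := rfl

theorem annih_proj_succ (q : ℕ) (j : Fin n) (ω : Finset (Fin n) → N) :
    annih k j (proj (k := k) N (q + 1) ω) = proj (k := k) N q (annih k j ω) := by
  ext S
  simp only [annih_apply, proj_apply]
  by_cases h : j ∈ S
  · simp [h]
  · simp [h]

theorem annih_proj_zero (j : Fin n) (ω : Finset (Fin n) → N) :
    annih k j (proj (k := k) N 0 ω) = 0 := by
  ext S
  simp only [annih_apply, proj_apply]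
  by_cases h : j ∈ S
  · simp [h]
  · simp [h]

theorem ext_proj (q : ℕ) (x : g) (ω : Finset (Fin n) → N) :
    ext b N x (proj (k := k) N q ω) = proj (k := k) N (q + 1) (ext b N x ω) := by
  have h : ∀ i, create k i (proj (k := k) N q ω) = proj (k := k) N (q + 1) (create k i ω) := by
    intro i
    ext S
    simp only [create_apply, proj_apply]
    by_cases h : i ∈ S
    · have := Finset.card_erase_add_one h
      have e : (S.erase i).card = q ↔ S.card = q + 1 := by omega
      simp only [h, if_true, e]
      split_ifs <;> simp
    · simp [h]
  simp only [ext_apply, LinearMap.sum_apply, LinearMap.smul_apply, map_sum, map_smul, h]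

theorem mem_degree_iff (R : Type*) [Ring R] [Module R N] (q : ℕ) (ω : Finset (Fin n) → N) :
    ω ∈ degree R N (Fin n) q ↔ proj (k := k) N q ω = ω := by
  constructor
  · intro h
    ext S
    rw [proj_apply]
    split_ifs with hS
    · rfl
    · exact (h S hS).symm
  · intro h S hS
    rw [← h, proj_apply, if_neg hS]

theorem bracketPart_apply (ω : Finset (Fin n) → N) : (operators b N).bracketPart ω =
    -∑ i, ∑ j, if i < j then ext b N ⁅b i, b j⁆ (annih k j (annih k i ω)) else 0 := by
  rw [Operators.bracketPart]
  change -((∑ i, ∑ j, if i < j then ext b N ⁅b i, b j⁆ * annih k j * annih k i else 0 :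
    Module.End k (Finset (Fin n) → N)) ω) = _
  simp only [LinearMap.sum_apply]
  congr 1
  refine Finset.sum_congr rfl fun i _ => Finset.sum_congr rfl fun j _ => ?_
  split_ifs <;> rfl

end

section
variable {R : Type*} [Ring R] [Algebra k R] (a : g →ₗ[k] R)

/-- Right multiplication of the coefficients by `a x`. -/
def mulRight : g →ₗ[k] Module.End k (Finset (Fin n) → R) where
  toFun x := pointwise (Finset (Fin n)) (LinearMap.mulRight k (a x))
  map_add' x y := by
    refine LinearMap.ext fun ω => ?_
    ext S
    simp [mul_add]
  map_smul' c x := by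
    refine LinearMap.ext fun ω => ?_
    ext S
    simp

theorem mulRight_apply (x : g) (ω : Finset (Fin n) → R) (S : Finset (Fin n)) :
    mulRight a x ω S = ω S * a x := rfl

theorem mulRight_coefficients (ha : ∀ x y, a ⁅x, y⁆ = a x * a y - a y * a x) :
    (operators b R).Coefficients (mulRight a) where
  commute_e x y := by
    change Commute _ (ext b R y)
    rw [ext_apply]
    exact Commute.sum_right _ _ _ fun i _ => (pointwise_commute_create _ i).smul_right _
  commute_c x j := pointwise_commute_annih _ j
  map_lie x y := by
    refine LinearMap.ext fun ω => ?_
    ext S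
    change ω S * a ⁅x, y⁆ = ω S * a x * a y - ω S * a y * a x
    rw [ha, mul_sub, mul_assoc, mul_assoc]
  mul_mem T hT x r := by
    have e : mulRight a x (Pi.single ∅ r : Finset (Fin n) → R) = Pi.single ∅ (r * a x) := by
      ext S
      rw [mulRight_apply]
      by_cases h : S = ∅
      · subst h
        simp
      · simp [h]
    rw [Module.End.mul_apply, e]
    exact hT _

/-- The Chevalley–Eilenberg differential on `R ⊗ ⋀ g`, for a homomorphism `a` from `g` to an
algebra `R`, through which `g` acts on `R` on the right. -/
noncomputable def boundary : Module.End k (Finset (Fin n) → R) :=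
  (operators b R).boundary (mulRight a)

theorem boundary_apply (ω : Finset (Fin n) → R) : boundary b a ω =
    ∑ j, mulRight a (b j) (annih k j ω) + (operators b R).bracketPart ω := by
  rw [boundary, Operators.boundary, LinearMap.add_apply, LinearMap.sum_apply]
  rfl

theorem boundary_boundary (ha : ∀ x y, a ⁅x, y⁆ = a x * a y - a y * a x)
    (ω : Finset (Fin n) → R) : boundary b a (boundary b a ω) = 0 :=
  LinearMap.congr_fun (mulRight_coefficients b a ha).boundary_mul_boundary ω

theorem boundary_smul (r : R) (ω : Finset (Fin n) → R) :
    boundary b a (r • ω) = r • boundary b a ω := by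
  have h1 : ∀ j (ω : Finset (Fin n) → R), annih k j (r • ω) = r • annih k j ω := fun j ω =>
    (LinearMap.congr_fun (pointwise_commute_annih (LinearMap.mulLeft k r) j).eq ω).symm
  have h2 : ∀ j (ω : Finset (Fin n) → R), create k j (r • ω) = r • create k j ω := fun j ω =>
    (LinearMap.congr_fun (pointwise_commute_create (LinearMap.mulLeft k r) j).eq ω).symm
  have h3 : ∀ x (ω : Finset (Fin n) → R), ext b R x (r • ω) = r • ext b R x ω := by
    intro x ω
    simp only [ext_apply, LinearMap.sum_apply, LinearMap.smul_apply, h2, Finset.smul_sum]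
    exact Finset.sum_congr rfl fun i _ => smul_comm _ _ _
  have h4 : ∀ x (ω : Finset (Fin n) → R), mulRight a x (r • ω) = r • mulRight a x ω := by
    intro x ω
    ext S
    simp [mulRight_apply, mul_assoc]
  simp only [boundary_apply, bracketPart_apply, h1, h3, h4, smul_add, Finset.smul_sum, smul_neg,
    smul_ite, smul_zero]

theorem boundary_proj_succ (q : ℕ) (ω : Finset (Fin n) → R) :
    boundary b a (proj (k := k) R (q + 1) ω) = proj (k := k) R q (boundary b a ω) := by
  have h4 : ∀ x q (ω : Finset (Fin n) → R),
      mulRight a x (proj (k := k) R q ω) = proj (k := k) R q (mulRight a x ω) := by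
    intro x q ω
    ext S
    simp [mulRight_apply, proj_apply]
  have h5 : ∀ x i j, ext b R x (annih k j (proj (k := k) R q (annih k i ω))) =
      proj (k := k) R q (ext b R x (annih k j (annih k i ω))) := by
    intro x i j
    rcases q with _ | q
    · rw [annih_proj_zero, map_zero]
      ext S
      rw [proj_apply]
      split_ifs with h
      · rw [Finset.card_eq_zero.1 h, ext_apply]
        simp [create_apply]
      · rfl
    · rw [annih_proj_succ, ext_proj]
  simp only [boundary_apply, bracketPart_apply, annih_proj_succ, h4, h5, map_add, map_sum, map_neg,
    apply_ite (proj (k := k) R q), map_zero]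

theorem boundary_proj_zero (ω : Finset (Fin n) → R) :
    boundary b a (proj (k := k) R 0 ω) = 0 := by
  simp [boundary_apply, bracketPart_apply, annih_proj_zero]

/-- In top degree the differential is `∑ⱼ (bⱼ - tr(ad bⱼ)) cⱼ`. -/
theorem boundary_single_univ (r : R) : boundary b a (Pi.single Finset.univ r) =
    ∑ j, (mulRight a (b j) (annih k j (Pi.single Finset.univ r)) -
      LinearMap.trace k g (LieAlgebra.ad k g (b j)) • annih k j (Pi.single Finset.univ r)) := by
  set δ : Finset (Fin n) → R := Pi.single Finset.univ r with hδ
  set o := operators b R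
  have eδ : ∀ x, ext b R x δ = 0 := by
    intro x
    rw [ext_apply, LinearMap.sum_apply]
    refine Finset.sum_eq_zero fun i _ => ?_
    rw [LinearMap.smul_apply]
    convert smul_zero _
    ext S
    rw [create_apply]
    split_ifs with h
    · rw [hδ, Pi.single_eq_of_ne, smul_zero]
      · rfl
      · intro h'
        exact Finset.notMem_erase i S (h' ▸ Finset.mem_univ i)
    · rfl
  have ecδ : ∀ x j, ext b R x (annih k j δ) = b.repr x j • δ := by
    intro x j
    have := LinearMap.congr_fun (o.e_mul_c x j) δ
    rw [LinearMap.add_apply, Module.End.mul_apply, Module.End.mul_apply] at this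
    change ext b R x (annih k j δ) + annih k j (ext b R x δ) = _ at this
    rwa [eδ, map_zero, add_zero] at this
  have adδ : ∀ x, o.adExt x δ = LinearMap.trace k g (LieAlgebra.ad k g x) • δ := by
    intro x
    rw [Operators.adExt, LinearMap.sum_apply, LinearMap.trace_eq_matrix_trace k b, Matrix.trace,
      Finset.sum_smul]
    refine Finset.sum_congr rfl fun j _ => ?_
    change ext b R ⁅x, b j⁆ (annih k j δ) = _
    rw [ecδ]
    simp [LinearMap.toMatrix_apply]
  have hv : o.bracketPart δ +
      ∑ j, LinearMap.trace k g (LieAlgebra.ad k g (b j)) • annih k j δ = 0 := by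
    ext S
    by_cases hS : S = Finset.univ
    · subst hS
      have h1 : ∀ j (ω : Finset (Fin n) → R), annih k j ω Finset.univ = 0 := fun j ω => by
        simp [annih_apply]
      have h2 : ∀ x i j, ext b R x (annih k j (annih k i δ)) Finset.univ = 0 := by
        intro x i j
        have := LinearMap.congr_fun (o.e_mul_c x j) (annih k i δ)
        rw [LinearMap.add_apply, Module.End.mul_apply, Module.End.mul_apply] at this
        have := congrFun this Finset.univ
        change ext b R x (annih k j (annih k i δ)) Finset.univ +
          annih k j (ext b R x (annih k i δ)) Finset.univ =
            b.repr x j • annih k i δ Finset.univ at this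
        rwa [h1, h1, add_zero, smul_zero] at this
      have h3 : o.bracketPart δ Finset.univ = 0 := by
        rw [bracketPart_apply, Pi.neg_apply, Finset.sum_apply, neg_eq_zero]
        refine Finset.sum_eq_zero fun i _ => ?_
        rw [Finset.sum_apply]
        refine Finset.sum_eq_zero fun j _ => ?_
        split_ifs
        · exact h2 _ _ _
        · rfl
      rw [Pi.add_apply, h3, Finset.sum_apply]
      simp [h1]
    · refine eq_single_univ_of_create (k := k) _ (fun i => ?_) hS
      have h1 := LinearMap.congr_fun (o.bracketPart_mul_e (b i)) δ
      change o.bracketPart (ext b R (b i) δ) + ext b R (b i) (o.bracketPart δ) =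
        -(o.adExt (b i) δ) at h1
      rw [eδ, map_zero, zero_add, adδ, ext_basis] at h1
      rw [map_add, h1, map_sum]
      simp only [map_smul, ← ext_basis b, ecδ]
      simp [Finsupp.single_apply]
  rw [boundary_apply, Finset.sum_sub_distrib, sub_eq_add_neg, eq_neg_of_add_eq_zero_left hv]

end

end
end ChevalleyEilenberg

/-! ### Homology and cohomology of the Chevalley–Eilenberg differential -/

namespace ChevalleyEilenberg

open Fock PolyFiltration

section
variable {k g : Type*} [Field k] [LieRing g] [LieAlgebra k g]
variable {n : ℕ} (b : Module.Basis (Fin n) k g)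

section
variable {R : Type*} [Ring R] [Algebra k R] (a : g →ₗ[k] R)

/-- The pairing `⟨κ, ω⟩ = ∑_S κ(S) ω(S)`, which is `R`-linear in `κ`. -/
def pairing (ω : Finset (Fin n) → R) : (Finset (Fin n) → R) →ₗ[R] R where
  toFun κ := ∑ S, κ S * ω S
  map_add' κ κ' := by simp [add_mul, Finset.sum_add_distrib]
  map_smul' r κ := by simp [mul_assoc, Finset.mul_sum]

theorem pairing_apply (ω κ : Finset (Fin n) → R) : pairing ω κ = ∑ S, κ S * ω S := rfl

theorem pairing_single (ω : Finset (Fin n) → R) (S : Finset (Fin n)) (r : R) :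
    pairing ω (Pi.single S r) = r * ω S := by
  rw [pairing_apply, Finset.sum_eq_single S]
  · simp
  · intro T _ hT
    simp [hT]
  · simp

theorem pairing_add (ω ω' κ : Finset (Fin n) → R) :
    pairing (ω + ω') κ = pairing ω κ + pairing ω' κ := by
  simp [pairing_apply, mul_add, Finset.sum_add_distrib]

theorem pairing_sum {J : Type*} (s : Finset J) (ω : J → Finset (Fin n) → R)
    (κ : Finset (Fin n) → R) : pairing (∑ j ∈ s, ω j) κ = ∑ j ∈ s, pairing (ω j) κ := by
  simp only [pairing_apply, Finset.sum_apply, Finset.mul_sum]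
  exact Finset.sum_comm

theorem pairing_smul (c : k) (ω κ : Finset (Fin n) → R) :
    pairing (c • ω) κ = c • pairing ω κ := by
  simp [pairing_apply, Finset.smul_sum]

theorem pairing_create (i : Fin n) (κ ω : Finset (Fin n) → R) :
    pairing ω (create k i κ) = pairing (annih k i ω) κ := by
  have : (pairing ω).restrictScalars k ∘ₗ create k i = (pairing (annih k i ω)).restrictScalars k := by
    refine LinearMap.pi_ext fun S r => ?_
    simp only [LinearMap.comp_apply, LinearMap.restrictScalars_apply]
    rw [pairing_single, annih_apply]
    by_cases h : i ∈ S
    · rw [if_pos h, mul_zero, pairing_apply]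
      refine Finset.sum_eq_zero fun T _ => ?_
      rw [create_apply]
      split_ifs
      · rw [Pi.single_eq_of_ne, smul_zero, zero_mul]
        rintro rfl
        exact Finset.notMem_erase _ _ h
      · exact zero_mul _
    · rw [create_single k i S h, pairing_single, if_neg h, smul_mul_assoc, mul_smul_comm]
  exact LinearMap.congr_fun this κ

theorem pairing_annih (i : Fin n) (κ ω : Finset (Fin n) → R) :
    pairing ω (annih k i κ) = pairing (create k i ω) κ := by
  have : (pairing ω).restrictScalars k ∘ₗ annih k i = (pairing (create k i ω)).restrictScalars k := by
    refine LinearMap.pi_ext fun S r => ?_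
    simp only [LinearMap.comp_apply, LinearMap.restrictScalars_apply]
    rw [pairing_single, create_apply]
    by_cases h : i ∈ S
    · obtain ⟨T, hT, rfl⟩ : ∃ T, i ∉ T ∧ insert i T = S :=
        ⟨S.erase i, Finset.notMem_erase i S, Finset.insert_erase h⟩
      have e : annih k i (Pi.single (insert i T) r : Finset (Fin n) → R) =
          Pi.single T (sgn i T • r) := by
        have h1 : (Pi.single (insert i T) r : Finset (Fin n) → R) =
            create k i (Pi.single T (sgn i T • r)) := by
          rw [create_single k i T hT, smul_smul, sgn_mul_self, one_smul]
        rw [h1]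
        ext U
        rw [annih_create_self]
        split_ifs with hU
        · rw [Pi.single_eq_of_ne]
          rintro rfl
          exact hT hU
        · rfl
      rw [e, pairing_single, if_pos h, Finset.erase_insert hT, sgn_insert hT, if_neg (lt_irrefl i),
        one_mul, smul_mul_assoc, mul_smul_comm]
    · rw [if_neg h, mul_zero, pairing_apply]
      refine Finset.sum_eq_zero fun T _ => ?_
      rw [annih_apply]
      split_ifs
      · exact zero_mul _
      · rw [Pi.single_eq_of_ne, smul_zero, zero_mul]
        rintro rfl
        exact h (Finset.mem_insert_self i T)
  exact LinearMap.congr_fun this κ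

/-- Left multiplication of the coefficients by `a x`. -/
def mulLeft (x : g) : Module.End k (Finset (Fin n) → R) :=
  pointwise (Finset (Fin n)) (LinearMap.mulLeft k (a x))

theorem mulLeft_apply (x : g) (ω : Finset (Fin n) → R) (S : Finset (Fin n)) :
    mulLeft a x ω S = a x * ω S := rfl

theorem pairing_mulRight (x : g) (κ ω : Finset (Fin n) → R) :
    pairing ω (mulRight a x κ) = pairing (mulLeft a x ω) κ := by
  simp [pairing_apply, mulRight_apply, mulLeft_apply, mul_assoc]

variable (R) in
/-- The transpose of the bracket part of the differential. -/
noncomputable def bracketPartT : Module.End k (Finset (Fin n) → R) :=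
  -∑ i, ∑ j, if i < j then ∑ l, b.repr ⁅b i, b j⁆ l • (create k i * create k j * annih k l) else 0

theorem bracketPartT_apply (ω : Finset (Fin n) → R) : bracketPartT b R ω =
    -∑ i, ∑ j, if i < j then
      ∑ l, b.repr ⁅b i, b j⁆ l • create k i (create k j (annih k l ω)) else 0 := by
  change -((∑ i, ∑ j, if i < j then
    ∑ l, b.repr ⁅b i, b j⁆ l • (create k i * create k j * annih k l) else 0 :
      Module.End k (Finset (Fin n) → R)) ω) = _
  simp only [LinearMap.sum_apply]
  congr 1
  refine Finset.sum_congr rfl fun i _ => Finset.sum_congr rfl fun j _ => ?_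
  split_ifs
  · rw [LinearMap.sum_apply]
    rfl
  · rfl

/-- The Chevalley–Eilenberg differential on cochains with values in `R`, on which `g` acts on the
left. -/
noncomputable def coboundary : Module.End k (Finset (Fin n) → R) :=
  ∑ j, mulLeft a (b j) * create k j + bracketPartT b R

theorem coboundary_apply (ω : Finset (Fin n) → R) : coboundary b a ω =
    ∑ j, mulLeft a (b j) (create k j ω) + bracketPartT b R ω := by
  rw [coboundary, LinearMap.add_apply, LinearMap.sum_apply]
  rfl

/-- The differentials on chains and on cochains are transposes of each other. -/
theorem pairing_boundary (κ ω : Finset (Fin n) → R) :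
    pairing ω (boundary b a κ) = pairing (coboundary b a ω) κ := by
  have neg : ∀ ω κ : Finset (Fin n) → R, pairing (-ω) κ = -pairing ω κ := fun ω κ => by
    simp [pairing_apply]
  have zero : ∀ κ : Finset (Fin n) → R, pairing 0 κ = 0 := fun κ => by simp [pairing_apply]
  have smul : ∀ (c : k) (ω κ : Finset (Fin n) → R), pairing ω (c • κ) = c • pairing ω κ :=
    fun c ω κ => by simp [pairing_apply, Finset.smul_sum]
  rw [boundary_apply, bracketPart_apply, coboundary_apply, bracketPartT_apply, map_add, map_sum,
    map_neg, map_sum, pairing_add, pairing_sum, neg, pairing_sum]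
  simp only [map_sum, pairing_sum, pairing_mulRight, pairing_annih]
  refine congrArg₂ (· + ·) (Finset.sum_congr rfl fun j _ => congrArg (fun ω => pairing ω κ)
    (LinearMap.congr_fun (pointwise_commute_create (LinearMap.mulLeft k (a (b j))) j).eq ω).symm)
    (congrArg Neg.neg
    (Finset.sum_congr rfl fun i _ => Finset.sum_congr rfl fun j _ => ?_))
  split_ifs
  · simp only [ext_apply, LinearMap.sum_apply, LinearMap.smul_apply, map_sum, smul, pairing_sum,
      pairing_smul, pairing_create, pairing_annih]
  · rw [map_zero, zero]

theorem eq_zero_of_pairing (ω : Finset (Fin n) → R) (h : ∀ κ, pairing ω κ = 0) : ω = 0 := by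
  ext S
  simpa [pairing_single] using h (Pi.single S 1)

theorem coboundary_coboundary (ha : ∀ x y, a ⁅x, y⁆ = a x * a y - a y * a x)
    (ω : Finset (Fin n) → R) : coboundary b a (coboundary b a ω) = 0 := by
  refine eq_zero_of_pairing _ fun κ => ?_
  rw [← pairing_boundary, ← pairing_boundary, boundary_boundary b a ha, map_zero]

end

section Acyclic

variable {N : Type*} [AddCommGroup N] [Module k N] (f : PolyFiltration (Fin n) k N)

theorem mem_pi_F {p : ℕ} {ω : Finset (Fin n) → N} :
    ω ∈ (f.pi (Finset (Fin n))).F p ↔ ∀ S, ω S ∈ f.F p :=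
  ⟨fun h S => h S trivial, fun h S _ => h S⟩

theorem create_le (i : Fin n) (p : ℕ) :
    (f.pi (Finset (Fin n))).F p ≤ ((f.pi (Finset (Fin n))).F p).comap (create k i) := by
  intro ω hω S _
  change create k i ω S ∈ f.F p
  rw [create_apply]
  split_ifs
  · exact zsmul_mem (hω _ trivial) _
  · exact Submodule.zero_mem _

theorem annih_le (i : Fin n) (p : ℕ) :
    (f.pi (Finset (Fin n))).F p ≤ ((f.pi (Finset (Fin n))).F p).comap (annih k i) := by
  intro ω hω S _
  change annih k i ω S ∈ f.F p
  rw [annih_apply]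
  split_ifs
  · exact Submodule.zero_mem _
  · exact zsmul_mem (hω _ trivial) _

theorem fermions_create : (f.pi (Finset (Fin n))).Fermions (create k) (annih k) where
  anticomm := create_annih
  X_I _ _ := pointwise_commute_annih _ _
  Y_E _ _ := pointwise_commute_create _ _
  E_le := create_le f
  I_le := annih_le f

theorem fermions_annih : (f.pi (Finset (Fin n))).Fermions (annih k) (create k) where
  anticomm i j := by
    rw [add_comm, create_annih]
    simp only [eq_comm]
  X_I _ _ := pointwise_commute_create _ _
  Y_E _ _ := pointwise_commute_annih _ _
  E_le := annih_le f
  I_le := create_le f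

/-- The projections that occur in `Fermions.exists_sub_mem` compose to one onto top degree. -/
theorem prod_create_annih (l : List (Fin n)) (ω : Finset (Fin n) → N) (S : Finset (Fin n)) :
    ((l.map fun i => (1 - (f.pi (Finset (Fin n))).X i * (f.pi (Finset (Fin n))).Y i) *
      (create k i * annih k i)).prod : Module.End k (Finset (Fin n) → N)) ω S =
      if ∀ i ∈ l, i ∈ S then (l.map fun i => 1 - f.X i * f.Y i).prod (ω S) else 0 := by
  induction l with
  | nil => simp
  | cons i l ih =>
    rw [List.map_cons, List.prod_cons, List.map_cons, List.prod_cons]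
    set ω' := (l.map fun i => (1 - (f.pi (Finset (Fin n))).X i * (f.pi (Finset (Fin n))).Y i) *
      (create k i * annih k i) : List (Module.End k (Finset (Fin n) → N))).prod ω
    change (1 - f.X i * f.Y i) (create k i (annih k i ω') S) = _
    rw [create_annih_self, ih]
    by_cases hi : i ∈ S
    · by_cases h : ∀ j ∈ l, j ∈ S
      · rw [if_pos hi, if_pos h, if_pos (by simpa using ⟨hi, h⟩)]
        rfl
      · rw [if_pos hi, if_neg h, if_neg (fun h' => h fun j hj => h' j (List.mem_cons_of_mem _ hj)),
          map_zero]
    · rw [if_neg hi, if_neg (fun h' => hi (h' i List.mem_cons_self)), map_zero]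

/-- The projections that occur in `Fermions.exists_sub_mem` compose to one onto degree zero. -/
theorem prod_annih_create (l : List (Fin n)) (ω : Finset (Fin n) → N) (S : Finset (Fin n)) :
    ((l.map fun i => (1 - (f.pi (Finset (Fin n))).X i * (f.pi (Finset (Fin n))).Y i) *
      (annih k i * create k i)).prod : Module.End k (Finset (Fin n) → N)) ω S =
      if ∀ i ∈ l, i ∉ S then (l.map fun i => 1 - f.X i * f.Y i).prod (ω S) else 0 := by
  induction l with
  | nil => simp
  | cons i l ih =>
    rw [List.map_cons, List.prod_cons, List.map_cons, List.prod_cons]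
    set ω' := (l.map fun i => (1 - (f.pi (Finset (Fin n))).X i * (f.pi (Finset (Fin n))).Y i) *
      (annih k i * create k i) : List (Module.End k (Finset (Fin n) → N))).prod ω
    change (1 - f.X i * f.Y i) (annih k i (create k i ω') S) = _
    rw [annih_create_self, ih]
    by_cases hi : i ∈ S
    · rw [if_pos hi, if_neg (fun h' => h' i List.mem_cons_self hi), map_zero]
    · by_cases h : ∀ j ∈ l, j ∉ S
      · rw [if_neg hi, if_pos h, if_pos (by simpa using ⟨hi, h⟩)]
        rfl
      · rw [if_neg hi, if_neg h, if_neg (fun h' => h fun j hj => h' j (List.mem_cons_of_mem _ hj)),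
          map_zero]

variable {R : Type*} [Ring R] [Algebra k R] (a : g →ₗ[k] R)
  (ha : ∀ x y, a ⁅x, y⁆ = a x * a y - a y * a x) (f : PolyFiltration (Fin n) k R)
include ha

/-- The homology of `R ⊗ ⋀ g` is concentrated in degree zero, if `g` acts on `R` on the right like
the variables act on polynomials, up to terms of lower degree. -/
theorem exists_sub_boundary_mem
    (hf : ∀ i p, ∀ r ∈ f.F p, r * a (b i) - f.X i r ∈ f.F p)
    (κ : Finset (Fin n) → R) (h : boundary b a κ = 0) :
    ∃ y, ∀ S, S ≠ ∅ → (κ - boundary b a y) S = 0 := by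
  have low : ∀ p, (f.pi (Finset (Fin n))).F p ≤ ((f.pi (Finset (Fin n))).F p).comap
      (boundary b a - ∑ j, (f.pi (Finset (Fin n))).X j * annih k j) := by
    intro p ω hω
    have e : (boundary b a - ∑ j, (f.pi (Finset (Fin n))).X j * annih k j) ω =
        ∑ j, (mulRight a (b j) (annih k j ω) - (f.pi (Finset (Fin n))).X j (annih k j ω)) +
          (operators b R).bracketPart ω := by
      rw [LinearMap.sub_apply, boundary_apply, LinearMap.sum_apply, Finset.sum_sub_distrib]
      exact add_sub_right_comm _ _ _
    rw [Submodule.mem_comap, e, bracketPart_apply]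
    refine Submodule.add_mem _ (Submodule.sum_mem _ fun j _ => ?_)
      (Submodule.neg_mem _ (Submodule.sum_mem _ fun i _ => Submodule.sum_mem _ fun j _ => ?_))
    · intro S _
      exact hf j p _ (annih_le f j p hω S trivial)
    · split_ifs
      · rw [ext_apply, LinearMap.sum_apply]
        exact Submodule.sum_mem _ fun l _ => Submodule.smul_mem _ _
          (create_le f l p (annih_le f j p (annih_le f i p hω)))
      · exact Submodule.zero_mem _
  obtain ⟨y, hy⟩ := (fermions_annih f).exists_sub_mem
    (LinearMap.ext fun ω => boundary_boundary b a ha ω) low (l := List.finRange n)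
    (G := (f.pi (Finset (Fin n))).F 1 ⊓ degree k R (Fin n) 0) inf_le_left (by
      refine fun z => ⟨(mem_pi_F f).2 fun S => ?_, fun S hS => ?_⟩
      · rw [prod_annih_create]
        split_ifs
        · exact f.prod_mem _ List.mem_finRange _
        · exact Submodule.zero_mem _
      · obtain ⟨i, hi⟩ := Finset.card_ne_zero.1 hS
        rw [prod_annih_create, if_neg (fun h' => h' i (List.mem_finRange i) hi)]) κ h
  exact ⟨y, fun S hS => hy.2 S (Finset.card_ne_zero.2 (Finset.nonempty_iff_ne_empty.2 hS))⟩

/-- The cohomology of the cochains with values in `R` is concentrated in top degree, and there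
represented by elements of degree zero, if `g` acts on `R` on the left like the variables act on
polynomials, up to terms of lower degree. -/
theorem exists_sub_coboundary_mem
    (hf : ∀ i p, ∀ r ∈ f.F p, a (b i) * r - f.X i r ∈ f.F p)
    (ω : Finset (Fin n) → R) (h : coboundary b a ω = 0) :
    ∃ y, (ω - coboundary b a y) Finset.univ ∈ f.F 1 ∧
      ∀ S, S ≠ Finset.univ → (ω - coboundary b a y) S = 0 := by
  have low : ∀ p, (f.pi (Finset (Fin n))).F p ≤ ((f.pi (Finset (Fin n))).F p).comap
      (coboundary b a - ∑ j, (f.pi (Finset (Fin n))).X j * create k j) := by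
    intro p ω hω
    have e : (coboundary b a - ∑ j, (f.pi (Finset (Fin n))).X j * create k j) ω =
        ∑ j, (mulLeft a (b j) (create k j ω) - (f.pi (Finset (Fin n))).X j (create k j ω)) +
          bracketPartT b R ω := by
      rw [LinearMap.sub_apply, coboundary_apply, LinearMap.sum_apply, Finset.sum_sub_distrib]
      exact add_sub_right_comm _ _ _
    rw [Submodule.mem_comap, e, bracketPartT_apply]
    refine Submodule.add_mem _ (Submodule.sum_mem _ fun j _ => ?_)
      (Submodule.neg_mem _ (Submodule.sum_mem _ fun i _ => Submodule.sum_mem _ fun j _ => ?_))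
    · intro S _
      exact hf j p _ (create_le f j p hω S trivial)
    · split_ifs
      · exact Submodule.sum_mem _ fun l _ => Submodule.smul_mem _ _
          (create_le f i p (create_le f j p (annih_le f l p hω)))
      · exact Submodule.zero_mem _
  obtain ⟨y, hy⟩ := (fermions_create f).exists_sub_mem
    (LinearMap.ext fun ω => coboundary_coboundary b a ha ω) low (l := List.finRange n)
    (G := (f.pi (Finset (Fin n))).F 1 ⊓ degree k R (Fin n) n) inf_le_left (by
      refine fun z => ⟨(mem_pi_F f).2 fun S => ?_, fun S hS => ?_⟩
      · rw [prod_create_annih]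
        split_ifs
        · exact f.prod_mem _ List.mem_finRange _
        · exact Submodule.zero_mem _
      · rw [prod_create_annih, if_neg]
        intro h'
        refine hS ?_
        rw [Finset.eq_univ_of_forall fun i => h' i (List.mem_finRange i), Finset.card_univ,
          Fintype.card_fin]) ω h
  refine ⟨y, (mem_pi_F f).1 hy.1 _, fun S hS => hy.2 S fun hc => hS ?_⟩
  rw [← Finset.card_eq_iff_eq_univ, hc, Fintype.card_fin]

end Acyclic

end
end ChevalleyEilenberg

/-! ### Complexes of projective modules -/

namespace ProjectiveComplex

section
variable {R : Type*} [Ring R]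

/-- Maps from a projective module lift along `d`, as soon as their values do. -/
theorem exists_lift {P X Y : Type*} [AddCommGroup P] [Module R P] [Module.Projective R P]
    [AddCommGroup X] [Module R X] [AddCommGroup Y] [Module R Y] (d : X →ₗ[R] Y) (u : P →ₗ[R] Y)
    (h : ∀ p, ∃ x, d x = u p) : ∃ v : P →ₗ[R] X, ∀ p, d (v p) = u p := by
  obtain ⟨v, hv⟩ := Module.projective_lifting_property d.rangeRestrict
    (u.codRestrict (LinearMap.range d) h) d.surjective_rangeRestrict
  exact ⟨v, fun p => congrArg Subtype.val (LinearMap.congr_fun hv p)⟩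

variable {P Q : ℕ → Type*} [∀ q, AddCommGroup (P q)] [∀ q, Module R (P q)]
  [∀ q, AddCommGroup (Q q)] [∀ q, Module R (Q q)]
  (dP : ∀ q, P (q + 1) →ₗ[R] P q) (dQ : ∀ q, Q (q + 1) →ₗ[R] Q q)
  [∀ q, Module.Projective R (P q)] (hP : ∀ q x, dP q (dP (q + 1) x) = 0)

include hP

/-- A map in degree zero lifts to a chain map from a complex of projective modules to an exact
complex. -/
theorem exists_chainMap
    (exact : ∀ q y, dQ q y = 0 → ∃ z, dQ (q + 1) z = y) (φ : P 0 →ₗ[R] Q 0)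
    (hφ : ∀ x, ∃ y, dQ 0 y = φ (dP 0 x)) :
    ∃ f : ∀ q, P q →ₗ[R] Q q, f 0 = φ ∧ ∀ q x, dQ q (f (q + 1) x) = f q (dP q x) := by
  let T : ℕ → Type _ := fun q => {p : (P q →ₗ[R] Q q) × (P (q + 1) →ₗ[R] Q (q + 1)) //
    ∀ x, dQ q (p.2 x) = p.1 (dP q x)}
  have init : ∃ v : P 1 →ₗ[R] Q 1, ∀ x, dQ 0 (v x) = φ (dP 0 x) :=
    exists_lift (dQ 0) (φ ∘ₗ dP 0) hφ
  have next : ∀ q (t : T q), ∃ v : P (q + 2) →ₗ[R] Q (q + 2),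
      ∀ x, dQ (q + 1) (v x) = t.1.2 (dP (q + 1) x) := fun q t =>
    exists_lift (dQ (q + 1)) (t.1.2 ∘ₗ dP (q + 1)) fun x => exact q _ (by
      rw [LinearMap.comp_apply, t.2, hP, map_zero])
  choose nxt hnxt using next
  let F : ∀ q, T q := fun q => Nat.rec (motive := T) ⟨(φ, init.choose), init.choose_spec⟩
    (fun q t => ⟨(t.1.2, nxt q t), hnxt q t⟩) q
  exact ⟨fun q => (F q).1.1, rfl, fun q x => (F q).2 x⟩

/-- A chain endomorphism of an exact complex of projective modules that is the identity in degree
zero is homotopic to the identity. -/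
theorem exists_homotopy (exact : ∀ q y, dP q y = 0 → ∃ z, dP (q + 1) z = y)
    (f : ∀ q, P q →ₗ[R] P q) (hf0 : f 0 = LinearMap.id)
    (hf : ∀ q x, dP q (f (q + 1) x) = f q (dP q x)) :
    ∃ h : ∀ q, P q →ₗ[R] P (q + 1), ∀ q x,
      f (q + 1) x - x = dP (q + 1) (h (q + 1) x) + h q (dP q x) := by
  let T : ℕ → Type _ := fun q => {p : (P q →ₗ[R] P (q + 1)) × (P (q + 1) →ₗ[R] P (q + 2)) //
    ∀ x, dP (q + 1) (p.2 x) = f (q + 1) x - x - p.1 (dP q x)}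
  have init : ∃ v : P 1 →ₗ[R] P 2, ∀ x, dP 1 (v x) = f 1 x - x - (0 : P 0 →ₗ[R] P 1) (dP 0 x) :=
    exists_lift (dP 1) (f 1 - LinearMap.id - 0 ∘ₗ dP 0) fun x => exact 0 _ (by simp [hf, hf0])
  have next : ∀ q (t : T q), ∃ v : P (q + 2) →ₗ[R] P (q + 3),
      ∀ x, dP (q + 2) (v x) = f (q + 2) x - x - t.1.2 (dP (q + 1) x) := fun q t =>
    exists_lift (dP (q + 2)) (f (q + 2) - LinearMap.id - t.1.2 ∘ₗ dP (q + 1)) fun x =>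
      exact (q + 1) _ (by simp [hf, t.2, hP])
  choose nxt hnxt using next
  let F : ∀ q, T q := fun q => Nat.rec (motive := T) ⟨(0, init.choose), init.choose_spec⟩
    (fun q t => ⟨(t.1.2, nxt q t), hnxt q t⟩) q
  refine ⟨fun q => (F q).1.1, fun q x => ?_⟩
  have := (F q).2 x
  rw [← sub_eq_iff_eq_add]
  exact this.symm

end

section
variable {R : Type*} [Ring R]
variable {P Q : ℕ → Type*} [∀ q, AddCommGroup (P q)] [∀ q, Module R (P q)]
  [∀ q, AddCommGroup (Q q)] [∀ q, Module R (Q q)]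
  (dP : ∀ q, P (q + 1) →ₗ[R] P q) (dQ : ∀ q, Q (q + 1) →ₗ[R] Q q)
  [∀ q, Module.Projective R (P q)] [∀ q, Module.Projective R (Q q)]

/-- Two projective resolutions of the same module are homotopy equivalent. -/
theorem exists_homotopyEquiv
    (hP : ∀ q x, dP q (dP (q + 1) x) = 0) (hQ : ∀ q x, dQ q (dQ (q + 1) x) = 0)
    (exactP : ∀ q y, dP q y = 0 → ∃ z, dP (q + 1) z = y)
    (exactQ : ∀ q y, dQ q y = 0 → ∃ z, dQ (q + 1) z = y)
    (φ : P 0 →ₗ[R] Q 0) (ψ : Q 0 →ₗ[R] P 0) (hψφ : ψ ∘ₗ φ = LinearMap.id)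
    (hφψ : φ ∘ₗ ψ = LinearMap.id)
    (hφ : ∀ x, ∃ y, dQ 0 y = φ (dP 0 x)) (hψ : ∀ x, ∃ y, dP 0 y = ψ (dQ 0 x)) :
    ∃ (f : ∀ q, P q →ₗ[R] Q q) (g : ∀ q, Q q →ₗ[R] P q) (h : ∀ q, P q →ₗ[R] P (q + 1))
      (h' : ∀ q, Q q →ₗ[R] Q (q + 1)),
      (∀ q x, dQ q (f (q + 1) x) = f q (dP q x)) ∧ (∀ q x, dP q (g (q + 1) x) = g q (dQ q x)) ∧
      (∀ x, g 0 (f 0 x) = x) ∧ (∀ x, f 0 (g 0 x) = x) ∧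
      (∀ q x, g (q + 1) (f (q + 1) x) - x = dP (q + 1) (h (q + 1) x) + h q (dP q x)) ∧
      (∀ q x, f (q + 1) (g (q + 1) x) - x = dQ (q + 1) (h' (q + 1) x) + h' q (dQ q x)) := by
  obtain ⟨f, hf0, hf⟩ := exists_chainMap dP dQ hP exactQ φ hφ
  obtain ⟨g, hg0, hg⟩ := exists_chainMap dQ dP hQ exactP ψ hψ
  obtain ⟨h, hh⟩ := exists_homotopy dP hP exactP (fun q => g q ∘ₗ f q) (by rw [hf0, hg0, hψφ])
    fun q x => by simp only [LinearMap.comp_apply, hf, hg]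
  obtain ⟨h', hh'⟩ := exists_homotopy dQ hQ exactQ (fun q => f q ∘ₗ g q) (by rw [hf0, hg0, hφψ])
    fun q x => by simp only [LinearMap.comp_apply, hf, hg]
  refine ⟨f, g, h, h', hf, hg, fun x => ?_, fun x => ?_, hh, hh'⟩
  · rw [hf0, hg0]
    exact LinearMap.congr_fun hψφ x
  · rw [hf0, hg0]
    exact LinearMap.congr_fun hφψ x

end
end ProjectiveComplex

/-! ### The bar resolution -/

namespace BarResolution
open Hochschild MulOpposite
section
variable {k A : Type*} [Field k] [Ring A] [Algebra k A]

variable (k A) in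
/-- The modules of the bar resolution of `A`. -/
abbrev Bar (q : ℕ) : Type _ := Env k A ⊗[k] (⨂[k] _ : Fin q, A)

section Lift
variable {M : Type*} [AddCommGroup M] [Module k M] [Module (Env k A) M]
  [IsScalarTower k (Env k A) M] {q : ℕ}

/-- Hochschild cochains are linear maps on the bar resolution. -/
noncomputable def lift (f : Cochain k A M q) : Bar k A q →ₗ[Env k A] M :=
  TensorProduct.AlgebraTensorModule.lift
    (LinearMap.toSpanSingleton (Env k A) ((⨂[k] _ : Fin q, A) →ₗ[k] M) (PiTensorProduct.lift f))

theorem lift_tmul (f : Cochain k A M q) (r : Env k A) (v : Fin q → A) :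
    lift f (r ⊗ₜ PiTensorProduct.tprod k v) = r • f v := by
  simp [lift]

/-- Linear maps on the bar resolution agree if they do on the free generators. -/
theorem bar_ext {φ ψ : Bar k A q →ₗ[Env k A] M}
    (h : ∀ v : Fin q → A, φ (1 ⊗ₜ PiTensorProduct.tprod k v) =
      ψ (1 ⊗ₜ PiTensorProduct.tprod k v)) : φ = ψ := by
  refine TensorProduct.AlgebraTensorModule.ext fun r t => ?_
  induction t using PiTensorProduct.induction_on with
  | smul_tprod c v =>
    have e : (r ⊗ₜ[k] (c • PiTensorProduct.tprod k v) : Bar k A q) =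
        (c • r) • ((1 : Env k A) ⊗ₜ[k] PiTensorProduct.tprod k v) := by
      rw [TensorProduct.smul_tmul', smul_eq_mul, mul_one, TensorProduct.smul_tmul]
    rw [e, map_smul, map_smul, h]
  | add x y hx hy => rw [TensorProduct.tmul_add, map_add, map_add, hx, hy]

variable (k A q) in
/-- The universal cochain. -/
noncomputable def univ : Cochain k A (Bar k A q) q :=
  (TensorProduct.mk k (Env k A) (⨂[k] _ : Fin q, A) 1).compMultilinearMap (PiTensorProduct.tprod k)

theorem univ_apply (v : Fin q → A) : univ k A q v = 1 ⊗ₜ PiTensorProduct.tprod k v := rfl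

theorem coboundary_apply (f : Cochain k A M q) (v : Fin (q + 1) → A) :
    coboundary f v = coboundaryFun f v := rfl

variable (k A q) in
/-- The differential of the bar resolution. -/
noncomputable def d : Bar k A (q + 1) →ₗ[Env k A] Bar k A q := lift (coboundary (univ k A q))

/-- Composition with the differential of the bar resolution is the Hochschild coboundary. -/
theorem lift_d (f : Cochain k A M q) (x : Bar k A (q + 1)) :
    lift f (d k A q x) = lift (coboundary f) x := by
  refine LinearMap.congr_fun (f := lift f ∘ₗ d k A q) (bar_ext fun v => ?_) x
  rw [LinearMap.comp_apply, d, lift_tmul, lift_tmul, one_smul, one_smul, coboundary_apply,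
    coboundary_apply]
  simp only [coboundaryFun, map_add, map_smul, map_sum, map_zsmul, univ_apply, lift_tmul, one_smul]

end Lift

variable (k A) in
/-- The contracting homotopy of the bar resolution:
`(a ⊗ b) ⊗ (v₁, …, v_q) ↦ (1 ⊗ b) ⊗ (a, v₁, …, v_q)`. -/
noncomputable def contraction (q : ℕ) : Bar k A q →ₗ[k] Bar k A (q + 1) :=
  TensorProduct.lift (TensorProduct.lift (LinearMap.mk₂ k
    (fun (a : A) (c : Aᵐᵒᵖ) => TensorProduct.mk k (Env k A) (⨂[k] _ : Fin (q + 1), A) (1 ⊗ₜ c) ∘ₗ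
      PiTensorProduct.lift ((PiTensorProduct.tprod k (s := fun _ : Fin (q + 1) => A)).curryLeft a))
    (fun a a' c => by rw [map_add, map_add, LinearMap.comp_add])
    (fun r a c => by rw [map_smul, map_smul, LinearMap.comp_smul])
    (fun a c c' => by rw [TensorProduct.tmul_add, map_add, LinearMap.add_comp])
    (fun r a c => by rw [TensorProduct.tmul_smul, map_smul, LinearMap.smul_comp])))

theorem contraction_tmul (q : ℕ) (a : A) (c : Aᵐᵒᵖ) (v : Fin q → A) :
    contraction k A q ((a ⊗ₜ c) ⊗ₜ PiTensorProduct.tprod k v) =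
      (1 ⊗ₜ c) ⊗ₜ PiTensorProduct.tprod k (Fin.cons a v) := by
  simp [contraction, MultilinearMap.curryLeft_apply]

theorem contractNth_zero_cons {q : ℕ} (a : A) (v : Fin (q + 1) → A) :
    Fin.contractNth (0 : Fin (q + 1)).castSucc (· * ·) (Fin.cons a v : Fin (q + 2) → A) =
      Fin.cons (a * v 0) (Fin.tail v) := by
  ext l
  induction l using Fin.cases with
  | zero => simp [Fin.contractNth]
  | succ l => simp [Fin.contractNth, Fin.tail]

theorem contractNth_succ_cons {q : ℕ} (j : Fin q) (a : A) (v : Fin (q + 1) → A) :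
    Fin.contractNth j.succ.castSucc (· * ·) (Fin.cons a v : Fin (q + 2) → A) =
      Fin.cons a (Fin.contractNth j.castSucc (· * ·) v) := by
  ext l
  induction l using Fin.cases with
  | zero => simp [Fin.contractNth]
  | succ l => simp [Fin.contractNth]

omit [Ring A] in
theorem init_cons {q : ℕ} (a : A) (v : Fin (q + 1) → A) :
    Fin.init (Fin.cons a v : Fin (q + 2) → A) = Fin.cons a (Fin.init v) := by
  ext l
  induction l using Fin.cases with
  | zero => simp [Fin.init]
  | succ l => simp [Fin.init]

theorem d_tmul (q : ℕ) (r : Env k A) (v : Fin (q + 1) → A) :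
    d k A q (r ⊗ₜ PiTensorProduct.tprod k v) =
      (r * v 0 ⊗ₜ 1) ⊗ₜ PiTensorProduct.tprod k (Fin.tail v) +
      ∑ j : Fin q, (-1 : ℤ) ^ ((j : ℕ) + 1) •
        (r ⊗ₜ PiTensorProduct.tprod k (Fin.contractNth j.castSucc (· * ·) v) : Bar k A q) +
      (-1 : ℤ) ^ (q + 1) • ((r * 1 ⊗ₜ op (v (Fin.last q))) ⊗ₜ
        PiTensorProduct.tprod k (Fin.init v) : Bar k A q) := by
  have h : ∀ (s : Env k A) (t : ⨂[k] _ : Fin q, A),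
      (r • s • ((1 : Env k A) ⊗ₜ t : Bar k A q) : Bar k A q) = (r * s) ⊗ₜ t := fun s t => by
    rw [TensorProduct.smul_tmul', TensorProduct.smul_tmul', smul_eq_mul, smul_eq_mul, mul_one]
  have h' : ∀ t : ⨂[k] _ : Fin q, A, (r • ((1 : Env k A) ⊗ₜ t : Bar k A q) : Bar k A q) = r ⊗ₜ t :=
    fun t => by rw [TensorProduct.smul_tmul', smul_eq_mul, mul_one]
  rw [d, lift_tmul, coboundary_apply, coboundaryFun, smul_add, smul_add, Finset.smul_sum]
  simp only [univ_apply]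
  have hz : ∀ (z : ℤ) (t : Bar k A q), r • (z • t) = z • (r • t) := fun z t =>
    map_zsmul (DistribSMul.toAddMonoidHom (Bar k A q) r) z t
  rw [h, hz, h]
  congr 2
  exact Finset.sum_congr rfl fun j _ => by rw [hz, h']

theorem add_alternating_cancel {X κ : Type*} [AddCommGroup X] [Fintype κ] (x y z : X) (f : κ → X)
    (s : κ → ℕ) (q : ℕ) :
    x + ((-1 : ℤ) ^ (0 + 1) • y + ∑ i, (-1 : ℤ) ^ (s i + 1 + 1) • f i) +
        (-1 : ℤ) ^ (q + 1 + 1) • z +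
      (y + ∑ i, (-1 : ℤ) ^ (s i + 1) • f i + (-1 : ℤ) ^ (q + 1) • z) = x := by
  simp only [pow_succ, pow_zero, mul_neg, mul_one, neg_smul, one_smul, Finset.sum_neg_distrib,
    neg_neg]
  abel

/-- The contraction is a homotopy from the identity to zero. -/
theorem d_contraction (q : ℕ) (x : Bar k A (q + 1)) :
    d k A (q + 1) (contraction k A (q + 1) x) + contraction k A q (d k A q x) = x := by
  have key : (d k A (q + 1)).restrictScalars k ∘ₗ contraction k A (q + 1) +
      contraction k A q ∘ₗ (d k A q).restrictScalars k = LinearMap.id := by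
    refine TensorProduct.ext (TensorProduct.ext' fun a c => PiTensorProduct.ext ?_)
    ext v
    change d k A (q + 1) (contraction k A (q + 1) ((a ⊗ₜ c) ⊗ₜ PiTensorProduct.tprod k v)) +
      contraction k A q (d k A q ((a ⊗ₜ c) ⊗ₜ PiTensorProduct.tprod k v)) =
        (a ⊗ₜ c) ⊗ₜ PiTensorProduct.tprod k v
    rw [contraction_tmul, d_tmul, d_tmul, Fin.sum_univ_succ]
    simp only [contractNth_zero_cons, contractNth_succ_cons, init_cons, map_add, map_sum,
      map_zsmul, contraction_tmul, Algebra.TensorProduct.tmul_mul_tmul, one_mul, mul_one]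
    simp only [Fin.cons_zero, Fin.tail_cons, Fin.val_zero, Fin.val_succ, Fin.cons_last]
    exact add_alternating_cancel (X := Bar k A (q + 1)) (κ := Fin q) _ _ _ _ _ _
  exact LinearMap.congr_fun key x

theorem alternating_cancel {X : Type*} [AddCommGroup X] (x y z : X) :
    x + (-1 : ℤ) ^ (0 + 1) • y + (-1 : ℤ) ^ (0 + 1) • (x + (-1 : ℤ) ^ (0 + 1) • z) +
      (-1 : ℤ) ^ (0 + 1 + 1) • (y + (-1 : ℤ) ^ (0 + 1) • z) = 0 := by
  simp only [pow_succ, pow_zero, mul_neg, mul_one, neg_smul, one_smul, neg_neg]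
  abel

theorem left_eq_zero_of_add_eq {X : Type*} [AddCommGroup X] {x y : X} (h : x + y = y) : x = 0 :=
  add_eq_right.mp h

/-- By induction: the generators are in the image of the contraction, where `d_contraction` reduces the
claim to one degree less. -/
theorem d_comp_d (q : ℕ) : d k A q ∘ₗ d k A (q + 1) = 0 := by
  induction q with
  | zero =>
    refine bar_ext (M := Bar k A 0) (q := 2) fun v => ?_
    have h0 : (Fin.contractNth (0 : Fin 1).castSucc (· * ·) v) = fun _ => v 0 * v 1 := by
      ext l
      simp [Fin.contractNth, Subsingleton.elim l 0]
    rw [LinearMap.comp_apply, LinearMap.zero_apply, d_tmul, map_add, map_add, map_sum,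
      Fin.sum_univ_one, map_zsmul, map_zsmul, d_tmul, d_tmul, d_tmul]
    simp only [Finset.univ_eq_empty, Finset.sum_empty, add_zero,
      Algebra.TensorProduct.tmul_mul_tmul, one_mul, mul_one, h0]
    rw [Subsingleton.elim (Fin.tail (Fin.tail v)) Fin.elim0,
      Subsingleton.elim (Fin.init (Fin.tail v)) Fin.elim0,
      Subsingleton.elim (Fin.tail (Fin.init v)) Fin.elim0,
      Subsingleton.elim (Fin.init (Fin.init v)) Fin.elim0,
      Subsingleton.elim (Fin.tail fun _ : Fin 1 => v 0 * v 1) Fin.elim0,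
      Subsingleton.elim (Fin.init fun _ : Fin 1 => v 0 * v 1) Fin.elim0]
    exact alternating_cancel (X := Bar k A 0) _ _ _
  | succ q ih =>
    refine bar_ext (M := Bar k A (q + 1)) (q := q + 3) fun v => ?_
    have e : (1 ⊗ₜ PiTensorProduct.tprod k v : Bar k A (q + 3)) =
        contraction k A (q + 2) ((v 0 ⊗ₜ 1) ⊗ₜ PiTensorProduct.tprod k (Fin.tail v)) := by
      rw [contraction_tmul, Fin.cons_self_tail]
      rfl
    rw [e, LinearMap.comp_apply, LinearMap.zero_apply]
    set y : Bar k A (q + 2) := (v 0 ⊗ₜ 1) ⊗ₜ PiTensorProduct.tprod k (Fin.tail v)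
    have h0 : d k A q (d k A (q + 1) y) = 0 := LinearMap.congr_fun ih y
    have h1 := congrArg (d k A (q + 1)) (d_contraction (q + 1) y)
    have h2 := d_contraction q (d k A (q + 1) y)
    rw [h0, map_zero, add_zero] at h2
    rw [map_add, h2] at h1
    exact left_eq_zero_of_add_eq (X := Bar k A (q + 1)) h1

theorem d_d (q : ℕ) (x : Bar k A (q + 2)) : d k A q (d k A (q + 1) x) = 0 :=
  LinearMap.congr_fun (d_comp_d q) x

theorem exact (q : ℕ) (y : Bar k A (q + 1)) (h : d k A q y = 0) :
    ∃ z, d k A (q + 1) z = y :=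
  ⟨contraction k A (q + 1) y, by
    conv_rhs => rw [← d_contraction q y, h, map_zero, add_zero]⟩

instance (q : ℕ) : Module.Projective (Env k A) (Bar k A q) := inferInstance

end

section
variable {k A : Type*} [Field k] [Ring A] [Algebra k A]

theorem d_zero_tmul (r : Env k A) (v : Fin 1 → A) :
    d k A 0 (r ⊗ₜ PiTensorProduct.tprod k v) =
      (r * (v 0 ⊗ₜ 1 - 1 ⊗ₜ op (v 0))) ⊗ₜ PiTensorProduct.tprod k Fin.elim0 := by
  rw [d_tmul, Subsingleton.elim (Fin.tail v) Fin.elim0, Subsingleton.elim (Fin.init v) Fin.elim0,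
    Fin.sum_univ_zero, add_zero, mul_sub, TensorProduct.sub_tmul]
  have h : ∀ x y : Bar k A 0, x + (-1 : ℤ) ^ (0 + 1) • y = x - y := fun x y => by
    rw [zero_add, pow_one, sub_eq_add_neg]
    exact congrArg (x + ·) (neg_one_zsmul y)
  exact h _ _

variable {M : Type*} [AddCommGroup M] [Module k M] [Module (Env k A) M]
  [IsScalarTower k (Env k A) M] {q : ℕ}

theorem lift_injective {z z' : Cochain k A M q} (h : lift z = lift z') : z = z' := by
  ext v
  have := LinearMap.congr_fun h (1 ⊗ₜ PiTensorProduct.tprod k v)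
  rwa [lift_tmul, lift_tmul, one_smul, one_smul] at this

theorem exists_lift_eq (θ : Bar k A q →ₗ[Env k A] M) : ∃ z : Cochain k A M q, lift z = θ := by
  refine ⟨(θ.restrictScalars k).compMultilinearMap (univ k A q), bar_ext fun v => ?_⟩
  rw [lift_tmul, one_smul]
  rfl

theorem mem_coboundaries_succ {q : ℕ} (z : Cochain k A (Env k A) (q + 1))
    (θ : Bar k A q →ₗ[Env k A] Env k A) (h : ∀ w, lift z w = θ (d k A q w)) :
    z ∈ coboundaries (Env k A)ᵐᵒᵖ k A (Env k A) (q + 1) := by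
  obtain ⟨c, hc⟩ := exists_lift_eq θ
  refine ⟨c, lift_injective (LinearMap.ext fun w => ?_)⟩
  rw [h, ← hc, lift_d]
  rfl

theorem mem_coboundaries_zero (z : Cochain k A (Env k A) 0) (h : ∀ w, lift z w = 0) :
    z ∈ coboundaries (Env k A)ᵐᵒᵖ k A (Env k A) 0 :=
  (Submodule.mem_bot _).2 (MultilinearMap.ext fun v => by
    have := h (1 ⊗ₜ PiTensorProduct.tprod k v)
    rwa [lift_tmul, one_smul] at this)

theorem lift_zero {q : ℕ} (w : Bar k A q) : lift (0 : Cochain k A (Env k A) q) w = 0 := by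
  refine LinearMap.congr_fun (g := 0) (bar_ext fun v => ?_) w
  rw [lift_tmul, one_smul]
  rfl

theorem lift_d_eq_zero {q : ℕ} {z : Cochain k A (Env k A) q} (hz : coboundary z = 0)
    (w : Bar k A (q + 1)) : lift z (d k A q w) = 0 := by
  rw [lift_d, hz, lift_zero]

theorem coboundary_eq_zero {q : ℕ} {z : Cochain k A (Env k A) q}
    (h : ∀ w, lift z (d k A q w) = 0) : coboundary z = 0 := by
  ext v
  have := h (1 ⊗ₜ PiTensorProduct.tprod k v)
  rwa [lift_d, lift_tmul, one_smul] at this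

theorem lift_op_smul {q : ℕ} (z : Cochain k A (Env k A) q) (s : Env k A) (w : Bar k A q) :
    lift (op s • z) w = lift z w * s := by
  refine LinearMap.congr_fun (g := LinearMap.toSpanSingleton (Env k A) (Env k A) s ∘ₗ lift z)
    (bar_ext fun v => ?_) w
  rw [LinearMap.comp_apply, lift_tmul, lift_tmul, one_smul, one_smul]
  rfl

theorem lift_add {q : ℕ} (z z' : Cochain k A (Env k A) q) (w : Bar k A q) :
    lift (z + z') w = lift z w + lift z' w := by
  refine LinearMap.congr_fun (g := lift z + lift z') (bar_ext fun v => ?_) w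
  rw [LinearMap.add_apply, lift_tmul, lift_tmul, lift_tmul, one_smul, one_smul, one_smul]
  rfl

end
end BarResolution

/-! ### The Koszul complex -/

namespace ChevalleyEilenberg

open Fock PolyFiltration

section
variable {k g : Type*} [Field k] [LieRing g] [LieAlgebra k g]
variable {n : ℕ} (b : Module.Basis (Fin n) k g)
variable {R : Type*} [Ring R]

section Chains

variable (R n) in
/-- The chains of degree `q`, that is `R ⊗ ⋀^q g`. -/
abbrev Chains (q : ℕ) : Type _ := degree R R (Fin n) q

variable (R n) in
/-- The projection onto the chains of degree `q`. -/
noncomputable def toChains (q : ℕ) : (Finset (Fin n) → R) →ₗ[R] Chains n R q where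
  toFun ω := ⟨fun S => if S.card = q then ω S else 0, fun S hS => if_neg hS⟩
  map_add' ω η := by
    ext S
    by_cases h : S.card = q <;> simp [h]
  map_smul' c ω := by
    ext S
    by_cases h : S.card = q <;> simp [h]

theorem toChains_apply (q : ℕ) (ω : Finset (Fin n) → R) (S : Finset (Fin n)) :
    (toChains n R q ω).1 S = if S.card = q then ω S else 0 := rfl

theorem toChains_coe (q : ℕ) (x : Chains n R q) : toChains n R q x.1 = x := by
  ext S
  rw [toChains_apply]
  split_ifs with h
  · rfl
  · exact (x.2 S h).symm

instance (q : ℕ) : Module.Projective R (Chains n R q) :=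
  Module.Projective.of_split (degree R R (Fin n) q).subtype (toChains n R q)
    (LinearMap.ext fun x => toChains_coe q x)

theorem exists_eq_pairing (ψ : (Finset (Fin n) → R) →ₗ[R] R) : ∃ y, ψ = pairing y := by
  refine ⟨fun S => ψ (Pi.single S 1), LinearMap.pi_ext fun S r => ?_⟩
  rw [pairing_single, ← smul_eq_mul, ← map_smul, ← Pi.single_smul, smul_eq_mul, mul_one]

theorem pairing_of_eq_zero {w : Finset (Fin n) → R} (hw : ∀ S ≠ Finset.univ, w S = 0)
    (κ : Finset (Fin n) → R) : pairing w κ = κ Finset.univ * w Finset.univ := by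
  rw [pairing_apply, Finset.sum_eq_single Finset.univ]
  · exact fun S _ hS => by rw [hw S hS, mul_zero]
  · exact fun h => absurd (Finset.mem_univ _) h

theorem chain_univ_eq_zero {q : ℕ} (hq : q ≠ n) (x : Chains n R q) : x.1 Finset.univ = 0 :=
  x.2 _ (by simpa using hq.symm)

theorem eq_zero_of_chain_empty (x : Chains n R 0) (h : x.1 ∅ = 0) : x = 0 := by
  ext S
  by_cases hS : S.card = 0
  · rw [Finset.card_eq_zero.1 hS]
    exact h
  · exact x.2 S hS

theorem chain_eq_zero {q : ℕ} (hq : n < q) (x : Chains n R q) : x = 0 := by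
  ext S
  exact x.2 S (((Finset.card_le_univ S).trans_lt (by simpa using hq)).ne)

end Chains

variable [Algebra k R] (a : g →ₗ[k] R)

theorem proj_coe (q : ℕ) (x : Chains n R q) : proj (k := k) R q x.1 = x.1 :=
  (mem_degree_iff (k := k) R q x.1).1 x.2

/-- The differential of the Koszul complex. -/
noncomputable def diff (q : ℕ) : Chains n R (q + 1) →ₗ[R] Chains n R q where
  toFun x := ⟨boundary b a x.1, (mem_degree_iff (k := k) R q _).2 (by
    rw [← boundary_proj_succ, proj_coe])⟩
  map_add' x y := Subtype.ext (map_add (boundary b a) x.1 y.1)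
  map_smul' r x := Subtype.ext (boundary_smul b a r x.1)

theorem diff_coe (q : ℕ) (x : Chains n R (q + 1)) : (diff b a q x).1 = boundary b a x.1 := rfl

theorem boundary_chain_zero (x : Chains n R 0) : boundary b a x.1 = 0 := by
  rw [← proj_coe (k := k) 0 x, boundary_proj_zero]

theorem diff_toChains (q : ℕ) (ω : Finset (Fin n) → R) :
    diff b a q (toChains n R (q + 1) ω) = toChains n R q (boundary b a ω) :=
  Subtype.ext (boundary_proj_succ b a q ω)

/-- The differential from degree one to degree zero. -/
theorem boundary_apply_empty (ω : Finset (Fin n) → R) :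
    boundary b a ω ∅ = ∑ j, ω {j} * a (b j) := by
  have h : ∀ x (η : Finset (Fin n) → R), ext b R x η ∅ = 0 := fun x η => by
    rw [ext_apply]
    simp [create_apply]
  rw [boundary_apply, bracketPart_apply, Pi.add_apply, Pi.neg_apply, Finset.sum_apply,
    Finset.sum_apply]
  have h2 : ∑ i, (∑ j, if i < j then ext b R ⁅b i, b j⁆ (annih k j (annih k i ω)) else 0) ∅ = 0 := by
    refine Finset.sum_eq_zero fun i _ => ?_
    rw [Finset.sum_apply]
    refine Finset.sum_eq_zero fun j _ => ?_
    split_ifs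
    · exact h _ _
    · rfl
  rw [h2, neg_zero, add_zero]
  refine Finset.sum_congr rfl fun j _ => ?_
  simp [mulRight_apply, annih_apply, sgn]

/-- Linear forms on the image of the differential from top degree are combinations of the elements
`(a(bⱼ) - tr(ad bⱼ)) t`. -/
theorem pairing_boundary_single_univ (y : Finset (Fin n) → R) :
    pairing y (boundary b a (Pi.single Finset.univ 1)) =
      ∑ j, (a (b j) * pairing y (annih k j (Pi.single Finset.univ 1)) -
        LinearMap.trace k g (LieAlgebra.ad k g (b j)) •
          pairing y (annih k j (Pi.single Finset.univ 1))) := by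
  have hc : ∀ j (S : Finset (Fin n)) (r : R), annih k j (Pi.single Finset.univ 1) S * r =
      r * annih k j (Pi.single Finset.univ 1) S := by
    intro j S r
    rw [annih_apply]
    split_ifs
    · rw [zero_mul, mul_zero]
    · rw [smul_mul_assoc, mul_smul_comm]
      congr 1
      by_cases h : insert j S = Finset.univ
      · rw [h, Pi.single_eq_same, one_mul, mul_one]
      · rw [Pi.single_eq_of_ne h, zero_mul, mul_zero]
  rw [boundary_single_univ, map_sum]
  refine Finset.sum_congr rfl fun j _ => ?_
  rw [map_sub, (pairing y).map_smul_of_tower]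
  congr 1
  rw [pairing_apply, pairing_apply, Finset.mul_sum]
  refine Finset.sum_congr rfl fun S _ => ?_
  rw [mulRight_apply, hc, mul_assoc]

variable (ha : ∀ x y, a ⁅x, y⁆ = a x * a y - a y * a x) (f : PolyFiltration (Fin n) k R)
include ha

theorem diff_diff (q : ℕ) (x : Chains n R (q + 2)) : diff b a q (diff b a (q + 1) x) = 0 :=
  Subtype.ext (boundary_boundary b a ha x.1)

/-- The Koszul complex is a resolution. -/
theorem diff_exact (hf : ∀ i p, ∀ r ∈ f.F p, r * a (b i) - f.X i r ∈ f.F p) (q : ℕ)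
    (x : Chains n R (q + 1)) (hx : diff b a q x = 0) : ∃ y, diff b a (q + 1) y = x := by
  obtain ⟨y, hy⟩ := exists_sub_boundary_mem b a ha f hf x.1 (congrArg Subtype.val hx)
  refine ⟨toChains n R (q + 2) y, ?_⟩
  rw [diff_toChains]
  ext S
  rw [toChains_apply]
  split_ifs with h
  · refine (sub_eq_zero.1 (hy S fun h' => ?_)).symm
    rw [h', Finset.card_empty] at h
    omega
  · exact (x.2 S h).symm

/-- A cocycle of the Koszul complex is cohomologous to one that is concentrated in top degree, with
a value in the first step of the filtration. -/
theorem exists_eq_top_add_coboundary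
    (hf : ∀ i p, ∀ r ∈ f.F p, a (b i) * r - f.X i r ∈ f.F p) (q : ℕ) (φ : Chains n R q →ₗ[R] R)
    (hφ : ∀ x, φ (diff b a q x) = 0) :
    ∃ v ∈ f.F 1, ∃ y : Finset (Fin n) → R, ∀ x : Chains n R q,
      φ x = x.1 Finset.univ * v + pairing y (boundary b a x.1) := by
  obtain ⟨ω, hω⟩ := exists_eq_pairing (φ ∘ₗ toChains n R q)
  have hω' : coboundary b a ω = 0 := by
    refine eq_zero_of_pairing _ fun κ => ?_
    rw [← pairing_boundary, ← hω, LinearMap.comp_apply, ← diff_toChains, hφ]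
  obtain ⟨y, hy, hy'⟩ := exists_sub_coboundary_mem b a ha f hf ω hω'
  refine ⟨_, hy, y, fun x => ?_⟩
  rw [← pairing_of_eq_zero hy', pairing_boundary, ← pairing_add, sub_add_cancel, ← hω,
    LinearMap.comp_apply, toChains_coe]

end
end ChevalleyEilenberg

/-! ### The action on `U(g) ⊗ ⋀ⁿ g*` -/

namespace Coadjoint
open Hochschild MulOpposite

section
variable {k V : Type*} [Field k] [AddCommGroup V] [Module k V] {n : ℕ}

theorem sum_update_basis {N : Type*} [AddCommGroup N] [Module k N] (f : V [⋀^Fin n]→ₗ[k] N)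
    (b : Module.Basis (Fin n) k V) (φ : Module.End k V) :
    ∑ i, f (Function.update b i (φ (b i))) = LinearMap.trace k V φ • f b := by
  rw [LinearMap.trace_eq_matrix_trace k b, Matrix.trace, Finset.sum_smul]
  refine Finset.sum_congr rfl fun i _ => ?_
  conv_lhs => rw [← b.sum_repr (φ (b i)), AlternatingMap.map_update_sum]
  rw [Finset.sum_eq_single i]
  · rw [AlternatingMap.map_update_smul, Function.update_eq_self, Matrix.diag_apply,
      LinearMap.toMatrix_apply]
  · intro j _ hj
    rw [AlternatingMap.map_update_smul, AlternatingMap.map_update_self _ _ hj.symm, smul_zero]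
  · exact fun h => absurd (Finset.mem_univ i) h

/-- An endomorphism of an `n`-dimensional space acts on the `n`-th exterior power as a derivation
by its trace. -/
theorem deriv_ιMulti_basis (b : Module.Basis (Fin n) k V) (φ : Module.End k V) :
    deriv n φ (exteriorPower.ιMulti k n b) =
      LinearMap.trace k V φ • exteriorPower.ιMulti k n b := by
  rw [deriv_ιMulti, sum_update_basis]

/-- The top exterior power is spanned by the product of a basis. -/
theorem smul_ιMulti_basis_bijective (b : Module.Basis (Fin n) k V) :
    Function.Bijective (LinearMap.toSpanSingleton k (⋀[k]^n V) (exteriorPower.ιMulti k n b)) := by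
  have hdet : exteriorPower.alternatingMapLinearEquiv b.det (exteriorPower.ιMulti k n b) = 1 := by
    rw [exteriorPower.alternatingMapLinearEquiv_apply_ιMulti, b.det_self]
  have h0 : exteriorPower.ιMulti k n b ≠ 0 := fun h => by
    rw [h, map_zero] at hdet
    exact zero_ne_one hdet
  have : FiniteDimensional k V := b.finiteDimensional_of_finite
  have hfin : Module.finrank k (⋀[k]^n V) = 1 := by
    rw [exteriorPower.finrank_eq, Module.finrank_eq_card_basis b, Fintype.card_fin, Nat.choose_self]
  refine ⟨fun c c' h => ?_, fun w => (finrank_eq_one_iff_of_nonzero' _ h0).1 hfin w⟩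
  exact smul_left_injective k h0 h

end

section
variable {k g : Type*} [Field k] [LieRing g] [LieAlgebra k g] {n : ℕ}
variable (b : Module.Basis (Fin n) k (Module.Dual k g))

/-- The element `u ⊗ α` of the bimodule. -/
noncomputable def pure (u : UniversalEnvelopingAlgebra k g) (α : ⋀[k]^n (Module.Dual k g)) :
    Bimodule k g n :=
  (u ⊗ₜ[k] α : TensorSpace k g n)

theorem smul_pure (u v : UniversalEnvelopingAlgebra k g) (α : ⋀[k]^n (Module.Dual k g)) :
    u • pure v α = pure (u * v) α := rfl

theorem pure_smul (c : k) (u : UniversalEnvelopingAlgebra k g) (α : ⋀[k]^n (Module.Dual k g)) :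
    pure u (c • α) = c • pure u α :=
  TensorProduct.tmul_smul (M := UniversalEnvelopingAlgebra k g) c u α

theorem op_ι_smul_pure (x : g) (u : UniversalEnvelopingAlgebra k g)
    (α : ⋀[k]^n (Module.Dual k g)) :
    op (UniversalEnvelopingAlgebra.ι k x) • pure u α =
      pure (u * UniversalEnvelopingAlgebra.ι k x) α + pure u (coadPow k g n x α) := by
  have h : rightHom k g n (op (UniversalEnvelopingAlgebra.ι k x)) = rightGen k g n x := by
    rw [rightHom, AlgHom.opComm_apply_apply, unop_op, UniversalEnvelopingAlgebra.lift_ι_apply]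
    rfl
  change rightHom k g n (op (UniversalEnvelopingAlgebra.ι k x))
    (u ⊗ₜ[k] α : TensorSpace k g n) = _
  rw [h, rightGen_tmul]
  rfl

theorem tmul_smul_eq (u v : UniversalEnvelopingAlgebra k g) (t : Bimodule k g n) :
    (u ⊗ₜ[k] op v : Env k (UniversalEnvelopingAlgebra k g)) • t = u • op v • t :=
  TensorProduct.Algebra.smul_def u (op v) t

instance : IsScalarTower k (Env k (UniversalEnvelopingAlgebra k g)) (Bimodule k g n) where
  smul_assoc c r t := LinearMap.congr_fun (map_smul TensorProduct.Algebra.moduleAux c r) t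

theorem flip_symm_op (u v : UniversalEnvelopingAlgebra k g) :
    (Env.flip k (UniversalEnvelopingAlgebra k g)).symm (op (u ⊗ₜ op v)) = v ⊗ₜ op u := by
  rw [AlgEquiv.symm_apply_eq, Env.flip_tmul]

/-- Acting by elements of the enveloping algebra, with its factors exchanged, on the element
`1 ⊗ β` of the bimodule, for the generator `β` of `⋀ⁿ g*` given by a basis. -/
noncomputable def actGenerator : Env k (UniversalEnvelopingAlgebra k g) →ₗ[k] Bimodule k g n where
  toFun r := (Env.flip k (UniversalEnvelopingAlgebra k g)).symm (op r) •
    pure 1 (exteriorPower.ιMulti k n b)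
  map_add' r s := by
    rw [op_add, map_add]
    exact add_smul _ _ _
  map_smul' c r := by
    rw [op_smul, map_smul]
    exact smul_assoc _ _ _

theorem actGenerator_apply (r : Env k (UniversalEnvelopingAlgebra k g)) : actGenerator b r =
    (Env.flip k (UniversalEnvelopingAlgebra k g)).symm (op r) •
      pure 1 (exteriorPower.ιMulti k n b) := rfl

theorem actGenerator_mul (r s : Env k (UniversalEnvelopingAlgebra k g)) :
    actGenerator b (r * s) =
      (Env.flip k (UniversalEnvelopingAlgebra k g)).symm (op s) • actGenerator b r := by
  rw [actGenerator_apply, op_mul, map_mul]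
  exact mul_smul _ _ _

theorem actGenerator_one_tmul (v : UniversalEnvelopingAlgebra k g) :
    actGenerator b (1 ⊗ₜ op v) = pure v (exteriorPower.ιMulti k n b) := by
  rw [actGenerator_apply, flip_symm_op, tmul_smul_eq, op_one, one_smul, smul_pure, mul_one]

theorem actGenerator_one_tmul_bijective :
    Function.Bijective fun v : UniversalEnvelopingAlgebra k g => actGenerator b (1 ⊗ₜ op v) := by
  have e : (fun v : UniversalEnvelopingAlgebra k g => actGenerator b (1 ⊗ₜ op v)) =
      ((TensorProduct.rid k (UniversalEnvelopingAlgebra k g)).symm.trans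
        (TensorProduct.congr (LinearEquiv.refl k (UniversalEnvelopingAlgebra k g))
          (LinearEquiv.ofBijective _ (smul_ιMulti_basis_bijective b)))) := by
    funext v
    rw [actGenerator_one_tmul, LinearEquiv.trans_apply, TensorProduct.rid_symm_apply,
      TensorProduct.congr_tmul, LinearEquiv.ofBijective_apply, LinearMap.toSpanSingleton_apply,
      one_smul]
    rfl
  rw [e]
  exact LinearEquiv.bijective _

variable [FiniteDimensional k g]

theorem coadPow_basis (x : g) : coadPow k g n x (exteriorPower.ιMulti k n b) =
    LinearMap.trace k g (LieAlgebra.ad k g x) • exteriorPower.ιMulti k n b := by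
  rw [coadPow, deriv_ιMulti_basis]
  congr 1
  exact LinearMap.trace_transpose' _

/-- The elements `x ⊗ 1 - 1 ⊗ x` act on the generator through the character `tr ∘ ad`. -/
theorem flip_adEnv_smul_pure (x : g) :
    (Env.flip k (UniversalEnvelopingAlgebra k g)).symm (op (PBW.adEnv k x)) •
        pure 1 (exteriorPower.ιMulti k n b) =
      LinearMap.trace k g (LieAlgebra.ad k g x) • pure 1 (exteriorPower.ιMulti k n b) := by
  rw [PBW.adEnv_apply, op_sub, map_sub, ← op_one, flip_symm_op, flip_symm_op, sub_smul,
    tmul_smul_eq, tmul_smul_eq, one_smul, op_one, one_smul, op_ι_smul_pure, smul_pure, one_mul,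
    mul_one, coadPow_basis, pure_smul, add_sub_cancel_left]

/-- Through `actGenerator`, left multiplication by `x ⊗ 1 - 1 ⊗ x` becomes the scalar `tr(ad x)`. -/
theorem actGenerator_adEnv_mul (x : g) (r : Env k (UniversalEnvelopingAlgebra k g)) :
    actGenerator b (PBW.adEnv k x * r) =
      LinearMap.trace k g (LieAlgebra.ad k g x) • actGenerator b r := by
  rw [actGenerator_mul, actGenerator_apply, flip_adEnv_smul_pure, smul_comm]
  rfl

end
end Coadjoint

/-! ### Comparison of the Koszul and the bar resolutions -/

namespace ChevalleyEilenberg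
open Hochschild BarResolution PBW Fock MulOpposite
variable {k g : Type*} [Field k] [LieRing g] [LieAlgebra k g]
variable {n : ℕ} (b : Module.Basis (Fin n) k g)

variable (k g n) in
/-- The identification of the Koszul and the bar resolutions in degree zero. -/
noncomputable def chainsToBar : Chains n (Env k (UniversalEnvelopingAlgebra k g)) 0
    →ₗ[Env k (UniversalEnvelopingAlgebra k g)] Bar k (UniversalEnvelopingAlgebra k g) 0 where
  toFun x := x.1 ∅ ⊗ₜ PiTensorProduct.tprod k Fin.elim0
  map_add' _ _ := TensorProduct.add_tmul _ _ _
  map_smul' _ _ := rfl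

theorem chainsToBar_apply (x : Chains n (Env k (UniversalEnvelopingAlgebra k g)) 0) :
    chainsToBar k g n x = x.1 ∅ ⊗ₜ PiTensorProduct.tprod k Fin.elim0 := rfl

variable (k g n) in
/-- The inverse of `chainsToBar`. -/
noncomputable def barToChains : Bar k (UniversalEnvelopingAlgebra k g) 0
    →ₗ[Env k (UniversalEnvelopingAlgebra k g)]
      Chains n (Env k (UniversalEnvelopingAlgebra k g)) 0 :=
  lift (MultilinearMap.constOfIsEmpty k _
    (toChains n (Env k (UniversalEnvelopingAlgebra k g)) 0 (Pi.single ∅ 1)))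

theorem barToChains_apply_empty (r : Env k (UniversalEnvelopingAlgebra k g))
    (v : Fin 0 → UniversalEnvelopingAlgebra k g) :
    (barToChains k g n (r ⊗ₜ PiTensorProduct.tprod k v)).1 ∅ = r := by
  rw [barToChains, lift_tmul]
  change r * (toChains n _ 0 (Pi.single ∅ 1)).1 ∅ = r
  rw [toChains_apply, Finset.card_empty, if_pos rfl, Pi.single_eq_same, mul_one]

theorem barToChains_chainsToBar :
    barToChains k g n ∘ₗ chainsToBar k g n = LinearMap.id := by
  refine LinearMap.ext fun x => ?_
  rw [LinearMap.comp_apply, chainsToBar_apply, LinearMap.id_apply]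
  refine sub_eq_zero.1 (eq_zero_of_chain_empty _ ?_)
  change (barToChains k g n _).1 ∅ - x.1 ∅ = 0
  rw [barToChains_apply_empty, sub_self]

theorem chainsToBar_barToChains :
    chainsToBar k g n ∘ₗ barToChains k g n = LinearMap.id := by
  refine bar_ext (M := Bar k (UniversalEnvelopingAlgebra k g) 0) (q := 0) fun v => ?_
  rw [LinearMap.comp_apply, chainsToBar_apply, LinearMap.id_apply, barToChains_apply_empty,
    Subsingleton.elim v Fin.elim0]

/-- The Koszul boundaries in degree zero are bar boundaries, as `x ⊗ 1 - 1 ⊗ x` is the boundary of `x`. -/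
theorem exists_d_eq (x : Chains n (Env k (UniversalEnvelopingAlgebra k g)) 1) :
    ∃ y, d k (UniversalEnvelopingAlgebra k g) 0 y =
      chainsToBar k g n (diff b (adEnv k) 0 x) := by
  refine ⟨∑ j, x.1 {j} ⊗ₜ PiTensorProduct.tprod k fun _ => UniversalEnvelopingAlgebra.ι k (b j), ?_⟩
  rw [map_sum, chainsToBar_apply, diff_coe, boundary_apply_empty, TensorProduct.sum_tmul]
  refine Finset.sum_congr rfl fun j _ => ?_
  rw [d_zero_tmul, adEnv_apply]

/-- The elements `u ⊗ 1 - 1 ⊗ u` are in the left ideal generated by those with `u` in `g`. -/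
theorem exists_boundary_empty_eq (r : Env k (UniversalEnvelopingAlgebra k g))
    (u : UniversalEnvelopingAlgebra k g) :
    ∃ x : Chains n (Env k (UniversalEnvelopingAlgebra k g)) 1,
      (diff b (adEnv k) 0 x).1 ∅ = r * (u ⊗ₜ 1 - 1 ⊗ₜ op u) := by
  -- `u v ⊗ 1 - 1 ⊗ u v = (u ⊗ 1) (v ⊗ 1 - 1 ⊗ v) + (1 ⊗ v) (u ⊗ 1 - 1 ⊗ u)`, where the second factors
  -- are multiplied in the opposite algebra, reduces the claim to elements of `g`.
  let I : Submodule (Env k (UniversalEnvelopingAlgebra k g))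
      (Env k (UniversalEnvelopingAlgebra k g)) :=
    LinearMap.range ((LinearMap.proj ∅ ∘ₗ (degree _ _ (Fin n) 0).subtype) ∘ₗ diff b (adEnv k) 0)
  have hb : ∀ i, adEnv k (b i) ∈ I := by
    intro i
    refine ⟨toChains n _ 1 (Pi.single {i} 1), ?_⟩
    change boundary b (adEnv k) (toChains n _ 1 (Pi.single {i} 1)).1 ∅ = _
    rw [boundary_apply_empty, Finset.sum_eq_single i]
    · simp [toChains_apply]
    · intro j _ hj
      rw [toChains_apply, Pi.single_eq_of_ne (by simpa using hj), ite_self, zero_mul]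
    · exact fun h => absurd (Finset.mem_univ i) h
  have hg : ∀ x, adEnv k x ∈ I := by
    intro x
    rw [← b.sum_repr x, map_sum]
    refine sum_mem fun i _ => ?_
    rw [map_smul]
    exact (I.restrictScalars k).smul_mem _ (hb i)
  let S : Submodule k (UniversalEnvelopingAlgebra k g) :=
    { carrier := {u | (u ⊗ₜ[k] (1 : (UniversalEnvelopingAlgebra k g)ᵐᵒᵖ) - 1 ⊗ₜ op u) ∈ I}
      zero_mem' := by simp
      add_mem' := fun {u v} hu hv => by
        change ((u + v) ⊗ₜ[k] (1 : (UniversalEnvelopingAlgebra k g)ᵐᵒᵖ) - 1 ⊗ₜ op (u + v)) ∈ I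
        rw [op_add, TensorProduct.add_tmul, TensorProduct.tmul_add, add_sub_add_comm]
        exact add_mem hu hv
      smul_mem' := fun c u hu => by
        change ((c • u) ⊗ₜ[k] (1 : (UniversalEnvelopingAlgebra k g)ᵐᵒᵖ) - 1 ⊗ₜ op (c • u)) ∈ I
        rw [op_smul, TensorProduct.tmul_smul, ← TensorProduct.smul_tmul']
        have h := (I.restrictScalars k).smul_mem c hu
        have e : c • (u ⊗ₜ[k] (1 : (UniversalEnvelopingAlgebra k g)ᵐᵒᵖ) - 1 ⊗ₜ op u) =
            c • u ⊗ₜ[k] (1 : (UniversalEnvelopingAlgebra k g)ᵐᵒᵖ) - c • 1 ⊗ₜ op u :=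
          smul_sub (A := Env k (UniversalEnvelopingAlgebra k g)) c _ _
        exact e ▸ h }
  have hS : S = ⊤ := by
    refine submodule_eq_top S ?_ fun x u hu => ?_
    · change ((1 : UniversalEnvelopingAlgebra k g) ⊗ₜ[k]
        (1 : (UniversalEnvelopingAlgebra k g)ᵐᵒᵖ) - 1 ⊗ₜ op 1) ∈ I
      rw [op_one, sub_self]
      exact zero_mem I
    · have e : ((UniversalEnvelopingAlgebra.ι k x * u) ⊗ₜ[k]
          (1 : (UniversalEnvelopingAlgebra k g)ᵐᵒᵖ) -
            1 ⊗ₜ op (UniversalEnvelopingAlgebra.ι k x * u)) =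
          (UniversalEnvelopingAlgebra.ι k x ⊗ₜ 1) * (u ⊗ₜ 1 - 1 ⊗ₜ op u) +
            (1 ⊗ₜ op u) * adEnv k x := by
        rw [adEnv_apply, mul_sub, mul_sub]
        simp only [Algebra.TensorProduct.tmul_mul_tmul, one_mul, mul_one, op_mul]
        abel
      change _ ∈ I
      rw [e]
      exact add_mem (I.smul_mem _ hu) (I.smul_mem _ (hg x))
  have hu : u ∈ S := hS ▸ Submodule.mem_top
  exact I.smul_mem r hu

/-- The bar boundaries in degree zero are Koszul boundaries. -/
theorem exists_diff_eq (y : Bar k (UniversalEnvelopingAlgebra k g) 1) :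
    ∃ x, diff b (adEnv k) 0 x = barToChains k g n (d k (UniversalEnvelopingAlgebra k g) 0 y) := by
  suffices h : ∀ (r : Env k (UniversalEnvelopingAlgebra k g))
      (v : Fin 1 → UniversalEnvelopingAlgebra k g), ∃ x, diff b (adEnv k) 0 x =
        barToChains k g n (d k (UniversalEnvelopingAlgebra k g) 0
          (r ⊗ₜ PiTensorProduct.tprod k v)) by
    have add : ∀ y y' : Bar k (UniversalEnvelopingAlgebra k g) 1,
        (∃ x, diff b (adEnv k) 0 x =
          barToChains k g n (d k (UniversalEnvelopingAlgebra k g) 0 y)) →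
        (∃ x, diff b (adEnv k) 0 x =
          barToChains k g n (d k (UniversalEnvelopingAlgebra k g) 0 y')) →
        ∃ x, diff b (adEnv k) 0 x =
          barToChains k g n (d k (UniversalEnvelopingAlgebra k g) 0 (y + y')) := by
      rintro y y' ⟨x, hx⟩ ⟨x', hx'⟩
      exact ⟨x + x', by rw [map_add, map_add, map_add, hx, hx']⟩
    induction y using TensorProduct.induction_on with
    | zero => exact ⟨0, by rw [map_zero, map_zero, map_zero]⟩
    | tmul r t =>
      induction t using PiTensorProduct.induction_on with
      | smul_tprod c v =>
        rw [← TensorProduct.smul_tmul]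
        exact h _ v
      | add t t' ht ht' =>
        rw [TensorProduct.tmul_add]
        exact add _ _ ht ht'
    | add y y' hy hy' => exact add _ _ hy hy'
  intro r v
  obtain ⟨x, hx⟩ := exists_boundary_empty_eq b r (v 0)
  refine ⟨x, sub_eq_zero.1 (eq_zero_of_chain_empty _ ?_)⟩
  change (diff b (adEnv k) 0 x).1 ∅ - (barToChains k g n _).1 ∅ = 0
  rw [d_zero_tmul, barToChains_apply_empty, hx, sub_self]

end ChevalleyEilenberg

namespace ChevalleyEilenberg
open Hochschild BarResolution PBW Fock Coadjoint MulOpposite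
variable {k g : Type*} [Field k] [LieRing g] [LieAlgebra k g]
variable {n : ℕ} (b : Module.Basis (Fin n) k g) (β : Module.Basis (Fin n) k (Module.Dual k g))

variable (k g n) in
/-- The generator of the chains of degree `n`, in the Koszul resolution; it is zero in any other
degree `q`. -/
noncomputable def top (q : ℕ) : Chains n (Env k (UniversalEnvelopingAlgebra k g)) q :=
  toChains n (Env k (UniversalEnvelopingAlgebra k g)) q (Pi.single Finset.univ 1)

theorem top_apply_univ : (top k g n n).1 Finset.univ = 1 := by
  rw [top, toChains_apply, if_pos (by simp), Pi.single_eq_same]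

variable [FiniteDimensional k g]

/-- Evaluation at the generator of the top degree, followed by `actGenerator`, kills the coboundaries:
its values on them are combinations of the elements `(x ⊗ 1 - 1 ⊗ x - tr(ad x)) t`. -/
theorem actGenerator_diff_top (q : ℕ)
    (ψ : Chains n (Env k (UniversalEnvelopingAlgebra k g)) q
      →ₗ[Env k (UniversalEnvelopingAlgebra k g)] Env k (UniversalEnvelopingAlgebra k g)) :
    actGenerator β (ψ (diff b (adEnv k) q (top k g n (q + 1)))) = 0 := by
  obtain ⟨y, hy⟩ := exists_eq_pairing
    (ψ ∘ₗ toChains n (Env k (UniversalEnvelopingAlgebra k g)) q)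
  have h := LinearMap.congr_fun hy (boundary b (adEnv k) (Pi.single Finset.univ 1))
  rw [LinearMap.comp_apply, pairing_boundary_single_univ] at h
  rw [top, diff_toChains, h, map_sum]
  refine Finset.sum_eq_zero fun j _ => ?_
  rw [map_sub, actGenerator_adEnv_mul, map_smul, sub_self]

/-- Comparison of the bar and the Koszul resolutions. Hochschild cocycles are coboundaries except in
degree `n`, where the evaluation at the chain `e`, the image of the generator of the top Koszul
chains, detects the coboundaries and takes all values. -/
theorem exists_evaluation (b : Module.Basis (Fin n) k g)
    (β : Module.Basis (Fin n) k (Module.Dual k g)) :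
    (∀ q ≠ n, ∀ z : Cochain k (UniversalEnvelopingAlgebra k g)
      (Env k (UniversalEnvelopingAlgebra k g)) q, Hochschild.coboundary z = 0 →
        z ∈ coboundaries (Env k (UniversalEnvelopingAlgebra k g))ᵐᵒᵖ k
          (UniversalEnvelopingAlgebra k g) (Env k (UniversalEnvelopingAlgebra k g)) q) ∧
    ∃ e : Bar k (UniversalEnvelopingAlgebra k g) n,
      (∀ z : Cochain k (UniversalEnvelopingAlgebra k g)
        (Env k (UniversalEnvelopingAlgebra k g)) n, Hochschild.coboundary z = 0 →
        (actGenerator β (lift z e) = 0 ↔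
          z ∈ coboundaries (Env k (UniversalEnvelopingAlgebra k g))ᵐᵒᵖ k
            (UniversalEnvelopingAlgebra k g) (Env k (UniversalEnvelopingAlgebra k g)) n)) ∧
      ∀ r, ∃ z : Cochain k (UniversalEnvelopingAlgebra k g)
        (Env k (UniversalEnvelopingAlgebra k g)) n, Hochschild.coboundary z = 0 ∧
          actGenerator β (lift z e) = actGenerator β r := by
  obtain ⟨f, γ, h, h', hf, hγ, hγf0, hfγ0, hh, hh'⟩ := ProjectiveComplex.exists_homotopyEquiv
    (P := Chains n (Env k (UniversalEnvelopingAlgebra k g)))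
    (Q := Bar k (UniversalEnvelopingAlgebra k g))
    (diff b (adEnv k)) (BarResolution.d k (UniversalEnvelopingAlgebra k g))
    (diff_diff b (adEnv k) adEnv_lie) d_d
    (diff_exact b (adEnv k) adEnv_lie (envFiltration b) fun i _ _ hr => mul_adEnv_sub_X_mem b i hr)
    BarResolution.exact (chainsToBar k g n) (barToChains k g n) barToChains_chainsToBar
    chainsToBar_barToChains (exists_d_eq b) (exists_diff_eq b)
  -- On the Koszul side a cocycle is cohomologous to one with a single value `1 ⊗ v`, in top degree.
  have top_form : ∀ q (z : Cochain k (UniversalEnvelopingAlgebra k g)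
      (Env k (UniversalEnvelopingAlgebra k g)) q), Hochschild.coboundary z = 0 →
      ∃ (v : (UniversalEnvelopingAlgebra k g)ᵐᵒᵖ)
        (y : Finset (Fin n) → Env k (UniversalEnvelopingAlgebra k g)),
        ∀ x : Chains n (Env k (UniversalEnvelopingAlgebra k g)) q,
          lift z (f q x) = x.1 Finset.univ * 1 ⊗ₜ v + pairing y (boundary b (adEnv k) x.1) := by
    intro q z hz
    obtain ⟨r, hr, y, hy⟩ := exists_eq_top_add_coboundary b (adEnv k) adEnv_lie (envFiltration b)
      (fun i _ _ hr => adEnv_mul_sub_X_mem b i hr) q (lift z ∘ₗ f q) fun x => by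
        rw [LinearMap.comp_apply, ← hf, lift_d_eq_zero hz]
    obtain ⟨v, rfl⟩ := mem_envFiltration_one b hr
    exact ⟨v, y, hy⟩
  -- A Hochschild cocycle is a coboundary if it becomes one on the Koszul resolution.
  have cobound : ∀ q (z : Cochain k (UniversalEnvelopingAlgebra k g)
      (Env k (UniversalEnvelopingAlgebra k g)) q), Hochschild.coboundary z = 0 →
      ∀ y : Finset (Fin n) → Env k (UniversalEnvelopingAlgebra k g),
      (∀ x : Chains n (Env k (UniversalEnvelopingAlgebra k g)) q,
        lift z (f q x) = pairing y (boundary b (adEnv k) x.1)) →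
      z ∈ coboundaries (Env k (UniversalEnvelopingAlgebra k g))ᵐᵒᵖ k
        (UniversalEnvelopingAlgebra k g) (Env k (UniversalEnvelopingAlgebra k g)) q := by
    intro q z hz y hy
    cases q with
    | zero =>
      refine mem_coboundaries_zero z fun w => ?_
      rw [← hfγ0 w, hy, boundary_chain_zero, map_zero]
    | succ q =>
      refine mem_coboundaries_succ z ((pairing y ∘ₗ (degree _ _ (Fin n) q).subtype) ∘ₗ γ q -
        lift z ∘ₗ h' q) fun w => ?_
      have e := congrArg (lift z) (hh' q w)
      rw [map_sub, map_add, lift_d_eq_zero hz, zero_add, hy, ← diff_coe, hγ] at e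
      rw [LinearMap.sub_apply, LinearMap.comp_apply (lift z), ← e]
      exact (sub_sub_cancel _ _).symm
  refine ⟨fun q hq z hz => ?_, f n (top k g n n), fun z hz => ⟨fun h0 => ?_, fun h0 => ?_⟩,
    fun r => ?_⟩
  · obtain ⟨v, y, hy⟩ := top_form q z hz
    refine cobound q z hz y fun x => ?_
    rw [hy, chain_univ_eq_zero hq, zero_mul, zero_add]
  · obtain ⟨v, y, hy⟩ := top_form n z hz
    have hv : actGenerator β (1 ⊗ₜ v) = 0 := by
      rw [hy, top_apply_univ, one_mul, map_add] at h0
      have h1 : actGenerator β (pairing y (boundary b (adEnv k) (top k g n n).1)) = 0 := by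
        clear * -
        cases n with
        | zero => rw [boundary_chain_zero, map_zero, map_zero]
        | succ q =>
          exact actGenerator_diff_top b β q (pairing y ∘ₗ (degree _ _ (Fin (q + 1)) q).subtype)
      rwa [h1, add_zero] at h0
    have hv' : v = 0 := by
      have := (actGenerator_one_tmul_bijective β).1 (a₁ := unop v) (a₂ := 0) (by
        simp only [op_unop, op_zero, TensorProduct.tmul_zero, map_zero]
        exact hv)
      exact unop_injective this
    refine cobound n z hz y fun x => ?_
    rw [hy, hv', TensorProduct.tmul_zero, mul_zero, zero_add]
  · cases n with
    | zero =>
      rw [(Submodule.mem_bot _).1 h0, lift_zero, map_zero]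
    | succ q =>
      obtain ⟨c, rfl⟩ := h0
      have e : lift (Hochschild.coboundary c) (f (q + 1) (top k g (q + 1) (q + 1))) =
          (lift c ∘ₗ f q) (diff b (adEnv k) q (top k g (q + 1) (q + 1))) := by
        rw [← lift_d, hf, LinearMap.comp_apply]
      exact (congrArg (actGenerator β) e).trans (actGenerator_diff_top b β q _)
  · let φ : Chains n (Env k (UniversalEnvelopingAlgebra k g)) n
        →ₗ[Env k (UniversalEnvelopingAlgebra k g)] Env k (UniversalEnvelopingAlgebra k g) :=
      LinearMap.toSpanSingleton _ _ r ∘ₗ LinearMap.proj Finset.univ ∘ₗ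
        (degree _ _ (Fin n) n).subtype
    have hφ : φ (top k g n n) = r := by
      change (top k g n n).1 Finset.univ * r = r
      rw [top_apply_univ, one_mul]
    obtain ⟨z, hz⟩ := exists_lift_eq (φ ∘ₗ γ n)
    refine ⟨z, coboundary_eq_zero fun w => ?_, ?_⟩
    · rw [hz, LinearMap.comp_apply, ← hγ, chain_eq_zero (Nat.lt_succ_self n) (γ (n + 1) w),
        map_zero, map_zero]
    · rw [hz, LinearMap.comp_apply]
      cases n with
      | zero => rw [hγf0, hφ]
      | succ q =>
        rw [sub_eq_iff_eq_add.1 (hh q _), chain_eq_zero (Nat.lt_succ_self _) (h (q + 1) _),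
          map_zero, zero_add, map_add, map_add, hφ]
        have e := actGenerator_diff_top b β q (φ ∘ₗ h q)
        rw [LinearMap.comp_apply] at e
        rw [e, zero_add]

end ChevalleyEilenberg

/-! ### Hochschild cohomology of the enveloping algebra -/

namespace Coadjoint
open Hochschild BarResolution MulOpposite
variable {k g : Type*} [Field k] [LieRing g] [LieAlgebra k g]

/-- The bimodule as a right module over the enveloping algebra, by exchange of the factors. -/
@[reducible]
noncomputable def opModule (n : ℕ) :
    Module (Env k (UniversalEnvelopingAlgebra k g))ᵐᵒᵖ (Bimodule k g n) :=
  Module.compHom _ ((Env.flip k (UniversalEnvelopingAlgebra k g)).symm :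
    (Env k (UniversalEnvelopingAlgebra k g))ᵐᵒᵖ →+* Env k (UniversalEnvelopingAlgebra k g))

attribute [local instance] opModule

theorem flip_smul (n : ℕ) (r : Env k (UniversalEnvelopingAlgebra k g)) (m : Bimodule k g n) :
    Env.flip k (UniversalEnvelopingAlgebra k g) r • m = r • m := by
  change (Env.flip k (UniversalEnvelopingAlgebra k g)).symm
    (Env.flip k (UniversalEnvelopingAlgebra k g) r) • m = r • m
  rw [AlgEquiv.symm_apply_apply]

/-- The evaluation of cocycles at a chain of the bar resolution, followed by the action on the
generator. -/
noncomputable def evaluation {n : ℕ} (β : Module.Basis (Fin n) k (Module.Dual k g))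
    (e : Bar k (UniversalEnvelopingAlgebra k g) n) :
    cocycles (Env k (UniversalEnvelopingAlgebra k g))ᵐᵒᵖ k (UniversalEnvelopingAlgebra k g)
      (Env k (UniversalEnvelopingAlgebra k g)) n
      →ₗ[(Env k (UniversalEnvelopingAlgebra k g))ᵐᵒᵖ] Bimodule k g n where
  toFun z := actGenerator β (lift z.1 e)
  map_add' z z' := by
    rw [← map_add, ← lift_add]
    rfl
  map_smul' s z := by
    refine Eq.trans ?_ (actGenerator_mul β (lift z.1 e) (unop s))
    rw [← lift_op_smul]
    rfl

end Coadjoint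

theorem corollary2p5 {k g : Type*} [Field k] [LieRing g] [LieAlgebra k g] [FiniteDimensional k g] :
    (∀ q : ℕ, q ≠ Module.finrank k g →
      Subsingleton (Hochschild.EnvCohomology k (UniversalEnvelopingAlgebra k g) q)) ∧
    Nonempty
      (Hochschild.EnvCohomology k (UniversalEnvelopingAlgebra k g) (Module.finrank k g)
        ≃ₗ[Hochschild.Env k (UniversalEnvelopingAlgebra k g)]
          Coadjoint.Bimodule k g (Module.finrank k g)) := by
  obtain ⟨vanish, e, he, hsurj⟩ := ChevalleyEilenberg.exists_evaluation (Module.finBasis k g)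
    (Module.finBasis k g).dualBasis
  refine ⟨fun q hq => subsingleton_of_forall_eq 0 fun h => ?_, ?_⟩
  · obtain ⟨z, rfl⟩ := Hochschild.Cohomology.mk_surjective _ _ _ _ q h
    exact (Hochschild.Cohomology.mk_eq_zero _ _ _ _ q z).2 (vanish q hq z.1 z.2)
  · let := Coadjoint.opModule (k := k) (g := g) (Module.finrank k g)
    let φ := Coadjoint.evaluation (Module.finBasis k g).dualBasis e
    let Φ : Hochschild.EnvCohomology k (UniversalEnvelopingAlgebra k g) (Module.finrank k g)
        →ₗ[(Hochschild.Env k (UniversalEnvelopingAlgebra k g))ᵐᵒᵖ]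
          Coadjoint.Bimodule k g (Module.finrank k g) :=
      Submodule.liftQ _ φ fun z hz => (he z.1 z.2).2 hz
    have hΦ : Function.Bijective Φ := by
      constructor
      · refine (injective_iff_map_eq_zero Φ).2 fun h h0 => ?_
        obtain ⟨z, rfl⟩ := Hochschild.Cohomology.mk_surjective _ _ _ _ _ h
        exact (Hochschild.Cohomology.mk_eq_zero _ _ _ _ _ z).2 ((he z.1 z.2).1 h0)
      · intro m
        obtain ⟨v, hv⟩ :=
          (Coadjoint.actGenerator_one_tmul_bijective (Module.finBasis k g).dualBasis).2 m
        obtain ⟨z, hz, hz'⟩ := hsurj (1 ⊗ₜ MulOpposite.op v)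
        exact ⟨Hochschild.Cohomology.mk _ _ _ _ _ ⟨z, hz⟩, hz'.trans hv⟩
    exact ⟨{ Equiv.ofBijective Φ hΦ with
      map_add' := Φ.map_add
      map_smul' := fun r h => (Φ.map_smul (Hochschild.Env.flip k _ r) h).trans
        (Coadjoint.flip_smul _ r (Φ h)) }⟩
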